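/- **Setting.** Let $f_0:(0,1)\to\mathbb R$ be continuously differentiable and strictly increasing with $f_0(1/2)=0$ and $f_0(3/4)-f_0(1/4)=1$. Fix $0<\delta<1/4$ and put $d(g,h)=\sup\{|g(x)-h(x)|:\delta\le x\le 1-\delta\}$. **Prior on $f$.** For every $J\ge 4$ let $B_1,\dots,B_J$ be the cubic B-splines (order four) of a knot sequence whose knots in $[0,1]$ form a partition $0=t_3<t_4<\dots<t_J=1$, with three further knots $t_0\le t_1\le t_2\le 0$ and $1\le t_{J+1}\le t_{J+2}\le t_{J+3}$ (for example repeated end points), and suppose that the mesh of the partition tends to $0$ as $J\to\infty$ (for example equally spaced knots). Let $A$ be the $2\times J$ matrix with rows $(B_j(1/2))_j$ and $(B_j(3/4)-B_j(1/4))_j$ and let $c=(0,1)'$. Given any $\zeta=\zeta_J\in\mathbb R^J$ and $s>0$, let $$\xi=\zeta+A'(AA')^{-1}(c-A\zeta),\qquad \Gamma=s^2\,[I-A'(AA')^{-1}A],$$ so that $\mathrm N_J(\xi,\Gamma)$ is the law of $\theta\sim\mathrm N_J(\zeta,s^2I)$ given $A\theta=c$. Given $J$, the coefficient vector $\theta$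 has the truncated normal law $\mathrm N_J(\xi,\Gamma)$ conditioned on $\theta_1<\theta_2<\dots<\theta_J$; the prior on $J$ is a probability distribution on $\{4,5,\dots\}$ with infinite support. Let $\Pi$ be the resulting prior on $f=\sum_{j=1}^J\theta_jB_j$. **Data and modified posterior.** Let $X_1,X_2,\dots$ be i.i.d. in $(0,1)$ with $f_0(X_i)\sim \mathrm N(\mu_0,\sigma_0^2)$, $\sigma_0>0$. For $\sigma>0$ and increasing $f$ write $F_{\mu,\sigma,f}(x)=\Phi((f(x)-\mu)/\sigma)$, $F_0=F_{\mu_0,\sigma_0,f_0}$, and let $$F^*(x)=\frac{F_{\mu,\sigma,f}(x)-F_{\mu,\sigma,f}(\delta)}{F_{\mu,\sigma,f}(1-\delta)-F_{\mu,\sigma,f}(\delta)},\qquad x\in[\delta,1-\delta],$$ be the conditional distribution function given $X\in[\delta,1-\delta]$. Among $X_1,\dots,X_n$, let $X_1^*,\dots,X_{n^*}^*$ be those in $[\delta,1-\delta]$, and let $n^*_-$, $n^*_+$ be the numbers of those $<\delta$ and $>1-\delta$. * Give $(\mu,\sigma)\in\mathbb R\times(0,\infty)$ a $\sigma$-finite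 prior $M$ having $(\mu_0,\sigma_0)$ in its support, independent of $f\sim\Pi$. Either $M$ is a probability measure, or $M$ is improper and, almost surely, the marginal likelihood of $X_1^*,\dots,X_{n^*}^*$ is finite for some $n$. Bayes' formula with the likelihood $\prod_{i\le n^*}(F^*)'(X_i^*)$ gives a posterior of $(\mu,\sigma,f)$, hence of $F^*$. * Give $(\pi^-,\pi^+)=(P(X<\delta),P(X>1-\delta))$ a prior probability measure on $\{(a,b):a,b\ge0,\ a+b\le1\}$ (for example a Dirichlet prior). Its posterior given the counts is obtained from the likelihood $(\pi^-)^{n_-^*}(\pi^+)^{n_+^*}(1-\pi^--\pi^+)^{n^*}$. It is assumed that this posterior is consistent, i.e. that almost surely the posterior probability of every neighbourhood of $(F_0(\delta),1-F_0(1-\delta))$ tends to $1$. * The modified posterior of $(\mu,\sigma,f)$ is the law of $$\sigma=\frac1{\Phi^{-1}(F(3/4))-\Phi^{-1}(F(1/4))},\quad \mu=-\frac{\Phi^{-1}(F(1/2))}{\Phi^{-1}(F(3/4))-\Phi^{-1}(F(1/4))},\quad f(x)=\mu+\sigma\Phi^{-1}(F(x)),$$ where $F=\pi^-+(1-\pi^+-\pi^-)F^*$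 on $[\delta,1-\delta]$ and $F^*$ and $(\pi^-,\pi^+)$ are drawn independently from their posteriors. **Claim.** For every $\epsilon>0$, $$\Pi\big(f:\ d(f,f_0)<\epsilon,\ d(f',f_0')<\epsilon\big)>0,$$ and, under the modified posterior, for every $\epsilon>0$, $$\Pi\big(|\mu-\mu_0|<\epsilon,\ |\sigma-\sigma_0|<\epsilon,\ d(f,f_0)<\epsilon\,\big|\,X_1^*,\dots,X_{n^*}^*,n^*_-,n^*_+\big)\to1\quad\text{almost surely.}$$ -/

import Mathlib

open MeasureTheory ProbabilityTheory Filter Topology Set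
open scoped ENNReal NNReal Matrix

noncomputable section

namespace Nonparanormal

/-! ### Cubic B-splines -/

/-- The `i`-th B-spline basis function of polynomial degree `k` for the knots
`t 0 ≤ t 1 ≤ …`, by the Cox–de Boor recursion (with the usual convention `0 / 0 = 0`). -/
def bspline (t : ℕ → ℝ) : ℕ → ℕ → ℝ → ℝ
  | 0, i, x => if t i ≤ x ∧ x < t (i + 1) then 1 else 0
  | k + 1, i, x =>
      (x - t i) / (t (i + k + 1) - t i) * bspline t k i x +
        (t (i + k + 2) - x) / (t (i + k + 2) - t (i + 1)) * bspline t k (i + 1) x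

/-- `t 0 ≤ … ≤ t (J + 3)` are knots of `J` cubic B-splines (order four) on `[0, 1]`: the knots
`0 = t 3 < t 4 < … < t J = 1` form a partition of the unit interval, and there are three further
knots on each side (equal to `0` and `1` for clamped knots, but other choices are allowed). -/
structure IsCubicKnots (J : ℕ) (t : ℕ → ℝ) : Prop where
  mono : ∀ i, i < J + 3 → t i ≤ t (i + 1)
  left : t 3 = 0
  right : t J = 1
  strict : ∀ i, 3 ≤ i → i < J → t i < t (i + 1)

/-- The function `f = ∑ j, θ j • B j` with the cubic B-splines `B j`. -/
def spline {J : ℕ} (t : ℕ → ℝ) (θ : EuclideanSpace ℝ (Fin J)) (x : ℝ) : ℝ :=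
  ∑ j : Fin J, θ j * bspline t 3 j x

/-! ### The prior on the transformation -/

/-- The `2 × J` matrix `A`, for which `A θ = (0, 1)` says that `f (1/2) = 0` and
`f (3/4) - f (1/4) = 1`. -/
def constraintMatrix (J : ℕ) (t : ℕ → ℝ) : Matrix (Fin 2) (Fin J) ℝ :=
  Matrix.of ![fun j => bspline t 3 j (1 / 2),
    fun j => bspline t 3 j (3 / 4) - bspline t 3 j (1 / 4)]

/-- The mean `ζ + Aᵀ (A Aᵀ)⁻¹ (c - A ζ)`, `c = (0, 1)`, of `N_J(ζ, s² I)` given `A θ = c`. -/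
def condMean (J : ℕ) (t : ℕ → ℝ) (ζ : Fin J → ℝ) : Fin J → ℝ :=
  let A := constraintMatrix J t
  ζ + Aᵀ *ᵥ ((A * Aᵀ)⁻¹ *ᵥ (![0, 1] - A *ᵥ ζ))

/-- The (singular) covariance `s² (I - Aᵀ (A Aᵀ)⁻¹ A)` of `N_J(ζ, s² I)` given `A θ = c`. -/
def condCov (J : ℕ) (t : ℕ → ℝ) (s : ℝ) : Matrix (Fin J) (Fin J) ℝ :=
  let A := constraintMatrix J t
  s ^ 2 • (1 - Aᵀ * (A * Aᵀ)⁻¹ * A)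

/-- The truncated normal prior on `θ`: the law `N_J(ξ, Γ)` of a normal vector `N_J(ζ, s² I)` given
the linear constraints, conditioned on `θ 1 < … < θ J`. -/
def coeffPrior (J : ℕ) (t : ℕ → ℝ) (ζ : Fin J → ℝ) (s : ℝ) :
    Measure (EuclideanSpace ℝ (Fin J)) :=
  ProbabilityTheory.cond (multivariateGaussian (WithLp.toLp 2 (condMean J t ζ)) (condCov J t s))
    {θ | ∀ i j : Fin J, i < j → θ i < θ j}

/-- The parameter `(J, θ)` of a spline. -/
abbrev SplineParam : Type := Σ J : ℕ, EuclideanSpace ℝ (Fin J)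

/-- The spline with parameter `(J, θ)`, where `t J` are the knots used with `J` basis functions. -/
def toFun (t : ℕ → ℕ → ℝ) (q : SplineParam) : ℝ → ℝ := spline (t q.1) q.2

/-- The prior on `(J, θ)`: draw `J` from `π`, then `θ` from the truncated normal prior. -/
def splinePrior (t : ℕ → ℕ → ℝ) (ζ : ∀ J : ℕ, Fin J → ℝ) (s : ℝ) (π : PMF ℕ) :
    Measure SplineParam :=
  Measure.sum fun J => π J • (coeffPrior J (t J) (ζ J) s).map (Sigma.mk J)

/-- `sup {|f x - g x| : δ ≤ x ≤ 1 - δ}`, with values in `[0, ∞]`. -/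
def supDist (δ : ℝ) (f g : ℝ → ℝ) : ℝ≥0∞ := ⨆ x ∈ Icc δ (1 - δ), ENNReal.ofReal |f x - g x|

/-! ### The model and the modified posterior -/

/-- The standard normal distribution function. -/
def Phi (x : ℝ) : ℝ := cdf (gaussianReal 0 1) x

/-- The standard normal quantile function (meaningful on `(0, 1)`). -/
def PhiInv (p : ℝ) : ℝ := sInf {x | p ≤ Phi x}

/-- The distribution function `F x = Φ ((f x - μ) / σ)` of `X` when `f X ∼ N(μ, σ²)`. -/
def cdfX (μ σ : ℝ) (f : ℝ → ℝ) (x : ℝ) : ℝ := Phi ((f x - μ) / σ)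

/-- For `x ∈ [δ, 1 - δ]`, the distribution function `F*` of `X` given `X ∈ [δ, 1 - δ]`. -/
def cdfTrunc (δ μ σ : ℝ) (f : ℝ → ℝ) (x : ℝ) : ℝ :=
  (cdfX μ σ f x - cdfX μ σ f δ) / (cdfX μ σ f (1 - δ) - cdfX μ σ f δ)

/-- The density of `F*` on `[δ, 1 - δ]`. -/
def densTrunc (δ μ σ : ℝ) (f : ℝ → ℝ) (x : ℝ) : ℝ :=
  deriv f x * (gaussianPDFReal 0 1 ((f x - μ) / σ) / σ) /
    (cdfX μ σ f (1 - δ) - cdfX μ σ f δ)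

/-- The parameter `((μ, σ), (J, θ))`. -/
abbrev Param : Type := (ℝ × ℝ) × SplineParam

/-- The likelihood of `((μ, σ), (J, θ))` given those among `x 0, …, x (n - 1)` that fall in
`[δ, 1 - δ]`. -/
def likelihood (δ : ℝ) (t : ℕ → ℕ → ℝ) (n : ℕ) (x : ℕ → ℝ) (η : Param) : ℝ≥0∞ :=
  ∏ i ∈ Finset.range n with x i ∈ Icc δ (1 - δ),
    ENNReal.ofReal (densTrunc δ η.1.1 η.1.2 (toFun t η.2) (x i))

/-- The marginal likelihood under the prior `Q` on `((μ, σ), (J, θ))`. -/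
def evidence (δ : ℝ) (t : ℕ → ℕ → ℝ) (Q : Measure Param) (n : ℕ) (x : ℕ → ℝ) : ℝ≥0∞ :=
  ∫⁻ η, likelihood δ t n x η ∂Q

/-- The posterior of `((μ, σ), (J, θ))` given the truncated observations (Bayes' formula). -/
def truncPosterior (δ : ℝ) (t : ℕ → ℕ → ℝ) (Q : Measure Param) (n : ℕ) (x : ℕ → ℝ) :
    Measure Param :=
  (evidence δ t Q n x)⁻¹ • Q.withDensity (likelihood δ t n x)

/-- The likelihood of `(π⁻, π⁺) = (P(X < δ), P(X > 1 - δ))` given how many of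
`x 0, …, x (n - 1)` fall below `δ`, above `1 - δ` and in `[δ, 1 - δ]`. -/
def countLikelihood (δ : ℝ) (n : ℕ) (x : ℕ → ℝ) (p : ℝ × ℝ) : ℝ≥0∞ :=
  ENNReal.ofReal (p.1 ^ (Finset.card {i ∈ Finset.range n | x i < δ}) *
    p.2 ^ (Finset.card {i ∈ Finset.range n | 1 - δ < x i}) *
    (1 - p.1 - p.2) ^ (Finset.card {i ∈ Finset.range n | x i ∈ Icc δ (1 - δ)}))

/-- The posterior of `(π⁻, π⁺)` given the counts, for the prior `ρ` (Bayes' formula). -/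
def countPosterior (δ : ℝ) (ρ : Measure (ℝ × ℝ)) (n : ℕ) (x : ℕ → ℝ) : Measure (ℝ × ℝ) :=
  (∫⁻ p, countLikelihood δ n x p ∂ρ)⁻¹ • ρ.withDensity (countLikelihood δ n x)

/-- The distribution function `F = π⁻ + (1 - π⁺ - π⁻) F*` on `[δ, 1 - δ]`, where `F*` comes from
the parameter `((μ, σ), (J, θ))`. -/
def cdfMod (δ : ℝ) (t : ℕ → ℕ → ℝ) (z : Param × (ℝ × ℝ)) (x : ℝ) : ℝ :=
  z.2.1 + (1 - z.2.2 - z.2.1) * cdfTrunc δ z.1.1.1 z.1.1.2 (toFun t z.1.2) x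

/-- The scale parameter determined by a distribution function `F`. -/
def sigmaOf (F : ℝ → ℝ) : ℝ := 1 / (PhiInv (F (3 / 4)) - PhiInv (F (1 / 4)))

/-- The location parameter determined by a distribution function `F`. -/
def muOf (F : ℝ → ℝ) : ℝ :=
  -(PhiInv (F (1 / 2)) / (PhiInv (F (3 / 4)) - PhiInv (F (1 / 4))))

/-- The transformation determined by a distribution function `F`. -/
def transOf (F : ℝ → ℝ) (x : ℝ) : ℝ := muOf F + sigmaOf F * PhiInv (F x)

/-- The probability, under the modified posterior given the first `n` observations, that
`|μ - μ₀| < ε`, `|σ - σ₀| < ε` and `d(f, f₀) < ε`. Here `F*` is drawn from its posterior given the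
truncated observations, independently `(π⁻, π⁺)` is drawn from its posterior given the counts, and
`(μ, σ, f)` is determined by the resulting `F`. -/
def modifiedPosteriorProb (δ : ℝ) (t : ℕ → ℕ → ℝ) (Q : Measure Param) (ρ : Measure (ℝ × ℝ))
    (μ₀ σ₀ : ℝ) (f₀ : ℝ → ℝ) (ε : ℝ) (n : ℕ) (x : ℕ → ℝ) : ℝ≥0∞ :=
  ((truncPosterior δ t Q n x).prod (countPosterior δ ρ n x))
    {z | |muOf (cdfMod δ t z) - μ₀| < ε ∧ |sigmaOf (cdfMod δ t z) - σ₀| < ε ∧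
      supDist δ (transOf (cdfMod δ t z)) f₀ < ENNReal.ofReal ε}

end Nonparanormal

end

open MeasureTheory ProbabilityTheory Filter Topology Set
open scoped ENNReal NNReal Matrix

noncomputable section

namespace Nonparanormal

/-! ### B-splines -/

/-! Prior mass. The derivative of a cubic spline is a combination of quadratic B-splines with
coefficients `3 (θ (j+1) - θ j) / (t (j+4) - t (j+1))` (`IsCubicKnots.dspline_eq`). These B-splines
are nonnegative, locally supported and sum to one, so increments that make the coefficients equal to
`g (t (j+1))` approximate a continuous `g > 0` uniformly as the mesh shrinks, and the coefficient
vector is increasing. An affine correction restores the two constraints. Since `f₀'` may vanish,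
`f₀` is first tilted by a small linear term. The constrained normal law charges every open set that
meets the affine space `A θ = c`, and both monotonicity of `θ` and closeness on a compact interval
hold on a neighbourhood of the approximating vector; hence `splinePrior_pos`.

Consistency follows the pattern of Schwartz's theorem. The ratio of the truncated densities, set to
1 outside `[δ, 1 - δ]`, turns the random number of retained observations into `n` i.i.d. factors.
Denominator: for each `r < 1` the prior charges the parameters whose ratio is everywhere at least
`r` (`prior_densRatio_ge_ne_zero`), so the integrated ratio is at least a constant times `r ^ n`.
Numerator: if `F* y` is away from its true value at a point `y`, a two-valued function `τ` has
positive mean under the truth, while the ratio tilted by `exp τ` has integral at most some `ρ < 1`.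
By the strong law the tilt eventually only enlarges the numerator, whose tilted version decays like
`ρ ^ n` (`ae_tendsto_intLik_div`). For an improper prior, expectations are taken after division by
the marginal likelihood of the first `m` observations.

Finitely many points `y` suffice, because monotone functions close to a continuous one on a fine
grid are uniformly close. Together with the consistent `(π⁻, π⁺)` this makes `F` uniformly close to
`F₀`, and `(μ, σ, f)` depends continuously on `F` there (`exists_transOf_close`). -/

lemma bspline_succ (t : ℕ → ℝ) (k i : ℕ) (x : ℝ) : bspline t (k + 1) i x =
    (x - t i) / (t (i + k + 1) - t i) * bspline t k i x +
      (t (i + k + 2) - x) / (t (i + k + 2) - t (i + 1)) * bspline t k (i + 1) x := rfl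

/-- Only finitely many knots are assumed ordered. This locality allows the theory for monotone
sequences to be applied to `stopKnots`. -/
lemma bspline_congr {t t' : ℕ → ℝ} {k i : ℕ} (h : ∀ m, i ≤ m → m ≤ i + k + 1 → t m = t' m)
    (x : ℝ) : bspline t k i x = bspline t' k i x := by
  induction k generalizing i with
  | zero => simp only [bspline]; rw [h i (by lia) (by lia), h (i + 1) (by lia) (by lia)]
  | succ k ih =>
    rw [bspline_succ, bspline_succ, ih fun m h1 h2 => h m (by lia) (by lia),
      ih fun m h1 h2 => h m (by lia) (by lia), h i (by lia) (by lia),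
      h (i + k + 1) (by lia) (by lia), h (i + k + 2) (by lia) (by lia),
      h (i + 1) (by lia) (by lia)]

lemma measurable_bspline (t : ℕ → ℝ) (k i : ℕ) : Measurable (bspline t k i) := by
  induction k generalizing i with
  | zero =>
    exact Measurable.ite (measurableSet_Ici.inter measurableSet_Iio) measurable_const
      measurable_const
  | succ k ih =>
    have h1 := ih i
    have h2 := ih (i + 1)
    simp only [bspline_succ, show bspline t (k + 1) i = fun x => bspline t (k + 1) i x
      from rfl]
    fun_prop

lemma bspline_eq_zero_of_lt {t : ℕ → ℝ} (ht : Monotone t) {k i : ℕ} {x : ℝ} (hx : x < t i) :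
    bspline t k i x = 0 := by
  induction k generalizing i with
  | zero => simp [bspline, hx]
  | succ k ih => rw [bspline_succ, ih hx, ih (hx.trans_le (ht (Nat.le_succ i)))]; simp

lemma bspline_eq_zero_of_le {t : ℕ → ℝ} (ht : Monotone t) {k i : ℕ} {x : ℝ}
    (hx : t (i + k + 1) ≤ x) : bspline t k i x = 0 := by
  induction k generalizing i with
  | zero => simp only [bspline]; rw [if_neg]; rintro ⟨_, h⟩; exact absurd h (not_lt.2 hx)
  | succ k ih =>
    rw [bspline_succ, ih ((ht (by lia)).trans hx),
      ih (by rw [show i + 1 + k + 1 = i + (k + 1) + 1 by ring]; exact hx)]; simp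

lemma bspline_nonneg {t : ℕ → ℝ} (ht : Monotone t) (k i : ℕ) (x : ℝ) : 0 ≤ bspline t k i x := by
  induction k generalizing i with
  | zero => simp only [bspline]; split_ifs <;> norm_num
  | succ k ih =>
    rw [bspline_succ]
    apply add_nonneg
    · rcases lt_or_ge x (t i) with h | h
      · rw [bspline_eq_zero_of_lt ht h, mul_zero]
      · exact mul_nonneg (div_nonneg (by linarith) (sub_nonneg.2 (ht (by lia)))) (ih _)
    · rcases lt_or_ge x (t (i + k + 2)) with h | h
      · exact mul_nonneg (div_nonneg (by linarith) (sub_nonneg.2 (ht (by lia)))) (ih _)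
      · rw [bspline_eq_zero_of_le ht (k := k) (i := i + 1)
          (by rw [show i + 1 + k + 1 = i + k + 2 by ring]; exact h), mul_zero]

lemma bspline_eq_zero_of_eq {t : ℕ → ℝ} (ht : Monotone t) {k i : ℕ} (h : t (i + k + 1) ≤ t i)
    (x : ℝ) : bspline t k i x = 0 := by
  rcases lt_or_ge x (t i) with h' | h'
  · exact bspline_eq_zero_of_lt ht h'
  · exact bspline_eq_zero_of_le ht (h.trans h')

/-- Shifting the index in the second half of the recursion puts the two weights of each lower-degree
B-spline together, and they add up to one. The end terms vanish because `x` lies outside their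
supports. -/
lemma sum_bspline {t : ℕ → ℝ} (ht : Monotone t) {k a b : ℕ} {x : ℝ} (ha : t (a + k) ≤ x)
    (hb : x < t b) : ∑ i ∈ Finset.Ico a b, bspline t k i x = 1 := by
  induction k generalizing a with
  | zero =>
    have hab : a ≤ b := by
      by_contra! h
      exact absurd (ht h.le) (not_le.2 (ha.trans_lt hb))
    induction b, hab using Nat.le_induction with
    | base => exact absurd ha (not_le.2 hb)
    | succ b hab ih =>
      rw [Finset.sum_Ico_succ_top hab]
      rcases lt_or_ge x (t b) with h | h
      · rw [ih h, bspline_eq_zero_of_lt ht h, add_zero]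
      · rw [Finset.sum_eq_zero, bspline, if_pos ⟨h, hb⟩, zero_add]
        intro i hi
        exact bspline_eq_zero_of_le ht ((ht (by have := (Finset.mem_Ico.1 hi).2; lia)).trans h)
  | succ k ih =>
    have hab : a < b := by
      by_contra! h
      exact absurd (ht (h.trans (by lia : a ≤ a + (k + 1)))) (not_le.2 (ha.trans_lt hb))
    have h1 : ∑ i ∈ Finset.Ico a b, (x - t i) / (t (i + k + 1) - t i) * bspline t k i x =
        ∑ i ∈ Finset.Ico (a + 1) b, (x - t i) / (t (i + k + 1) - t i) * bspline t k i x := by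
      rw [Finset.sum_eq_sum_Ico_succ_bot hab, bspline_eq_zero_of_le ht ha]; simp
    have h2 : ∑ i ∈ Finset.Ico a b,
        (t (i + k + 2) - x) / (t (i + k + 2) - t (i + 1)) * bspline t k (i + 1) x =
        ∑ i ∈ Finset.Ico (a + 1) b,
          (t (i + k + 1) - x) / (t (i + k + 1) - t i) * bspline t k i x := by
      have h := Finset.sum_Ico_add' (fun i =>
        (t (i + k + 1) - x) / (t (i + k + 1) - t i) * bspline t k i x) a b 1
      rw [Finset.sum_Ico_succ_top (by lia), bspline_eq_zero_of_lt ht hb, mul_zero, add_zero] at h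
      rw [← h]
      refine Finset.sum_congr rfl fun i _ => ?_
      rw [show i + 1 + k + 1 = i + k + 2 by ring]
    simp only [bspline_succ]
    rw [Finset.sum_add_distrib, h1, h2, ← Finset.sum_add_distrib,
      ← ih (a := a + 1) (by rw [show a + 1 + k = a + (k + 1) by ring]; exact ha)]
    refine Finset.sum_congr rfl fun i _ => ?_
    -- With coinciding knots the weights are `0 / 0 = 0`, but then the B-spline itself vanishes.
    rcases (ht (show i ≤ i + k + 1 by lia)).eq_or_lt with h | h
    · rw [bspline_eq_zero_of_eq ht h.ge]; simp
    · rw [← add_mul, ← add_div]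
      have : t (i + k + 1) - t i ≠ 0 := by linarith
      field_simp
      ring

/-! ### Differentiability of B-splines -/

/-- The derivative of `bspline t (k + 1) i`. -/
def dbspline (t : ℕ → ℝ) (k i : ℕ) (x : ℝ) : ℝ :=
  (k + 1) * (bspline t k i x / (t (i + k + 1) - t i) -
    bspline t k (i + 1) x / (t (i + k + 2) - t (i + 1)))

lemma measurable_dbspline (t : ℕ → ℝ) (k i : ℕ) : Measurable (dbspline t k i) := by
  have h1 := measurable_bspline t k i
  have h2 := measurable_bspline t k (i + 1)
  unfold dbspline
  fun_prop

/-- Degree zero gives right-continuous steps, locally constant to the right of every point. Right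
derivatives therefore obey the recursion everywhere, knots included. -/
lemma hasDerivWithinAt_bspline_zero (t : ℕ → ℝ) (i : ℕ) (x : ℝ) :
    HasDerivWithinAt (bspline t 0 i) 0 (Ici x) x := by
  refine (hasDerivWithinAt_const x (Ici x) (bspline t 0 i x)).congr_of_eventuallyEq ?_ rfl
  have h1 : ∀ c : ℝ, ∀ᶠ y in 𝓝[≥] x, (c ≤ y ↔ c ≤ x) := by
    intro c
    rcases le_or_gt c x with h | h
    · filter_upwards [self_mem_nhdsWithin] with y hy
      exact ⟨fun _ => h, fun _ => h.trans hy⟩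
    · filter_upwards [mem_nhdsWithin_of_mem_nhds (Iio_mem_nhds h)] with y hy
      exact ⟨fun h' => absurd h' (not_le.2 hy), fun h' => absurd h' (not_le.2 h)⟩
  filter_upwards [h1 (t i), h1 (t (i + 1))] with y h2 h3
  simp only [bspline, h2, ← not_le, h3]

lemma hasDerivWithinAt_bspline {t : ℕ → ℝ} (ht : Monotone t) (k i : ℕ) (x : ℝ) :
    HasDerivWithinAt (bspline t (k + 1) i) (dbspline t k i x) (Ici x) x := by
  have step : ∀ (k i : ℕ) (d e : ℝ), HasDerivWithinAt (bspline t k i) d (Ici x) x →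
      HasDerivWithinAt (bspline t k (i + 1)) e (Ici x) x →
      HasDerivWithinAt (bspline t (k + 1) i)
        ((1 / (t (i + k + 1) - t i) * bspline t k i x + (x - t i) / (t (i + k + 1) - t i) * d) +
        (-1 / (t (i + k + 2) - t (i + 1)) * bspline t k (i + 1) x +
          (t (i + k + 2) - x) / (t (i + k + 2) - t (i + 1)) * e)) (Ici x) x := by
    intro k i d e hd he
    have h1 : HasDerivWithinAt (fun x => (x - t i) / (t (i + k + 1) - t i))
        (1 / (t (i + k + 1) - t i)) (Ici x) x :=
      ((hasDerivWithinAt_id x _).sub_const _).div_const _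
    have h2 : HasDerivWithinAt (fun x => (t (i + k + 2) - x) / (t (i + k + 2) - t (i + 1)))
        (-1 / (t (i + k + 2) - t (i + 1))) (Ici x) x :=
      ((hasDerivWithinAt_id x _).const_sub _).div_const _
    exact (h1.mul hd).add (h2.mul he)
  induction k generalizing i with
  | zero =>
    convert step 0 i 0 0 (hasDerivWithinAt_bspline_zero t i x)
      (hasDerivWithinAt_bspline_zero t (i + 1) x) using 1
    simp only [dbspline]
    push_cast
    ring
  | succ k ih =>
    convert step (k + 1) i _ _ (ih i) (ih (i + 1)) using 1
    simp only [dbspline, bspline_succ t k]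
    rw [show i + (k + 1) + 1 = i + k + 2 by ring, show i + (k + 1) + 2 = i + k + 3 by ring,
      show i + 1 + k + 1 = i + k + 2 by ring, show i + 1 + k + 2 = i + k + 3 by ring,
      show i + 1 + 1 = i + 2 by ring]
    have m1 : t i ≤ t (i + 1) := ht (by lia)
    have m2 : t (i + 1) ≤ t (i + k + 2) := ht (by lia)
    have m3 : t (i + k + 2) ≤ t (i + k + 3) := ht (by lia)
    -- If the middle knots coincide, the B-spline they carry is zero; otherwise the larger spans are
    -- nonzero as well.
    rcases m2.eq_or_lt with h | h
    · rw [bspline_eq_zero_of_eq ht (k := k) (i := i + 1)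
        (by rw [show i + 1 + k + 1 = i + k + 2 by ring]; exact h.ge)]
      push_cast
      ring
    · have e1 : t (i + k + 2) - t i ≠ 0 := by linarith
      have e2 : t (i + k + 3) - t (i + 1) ≠ 0 := by linarith
      have e3 : t (i + k + 2) - t (i + 1) ≠ 0 := by linarith
      -- The two outer spans may still be zero, so their inverses are made arbitrary numbers; the
      -- identity does not depend on their values.
      simp only [div_eq_mul_inv (_ : ℝ) (t (i + k + 1) - t i),
        div_eq_mul_inv (_ : ℝ) (t (i + k + 3) - t (i + 2))]
      generalize (t (i + k + 1) - t i)⁻¹ = u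
      generalize (t (i + k + 3) - t (i + 2))⁻¹ = v
      push_cast
      field_simp
      ring

/-- The knots inside `(0, 1)` are simple. -/
def SimpleKnots (t : ℕ → ℝ) : Prop := ∀ i, 0 < t (i + 1) → t i < 1 → t i < t (i + 1)

lemma continuousAt_bspline_one {t : ℕ → ℝ} (ht : Monotone t) (hs : SimpleKnots t) (i : ℕ) {x : ℝ}
    (hx : x ∈ Ioo (0 : ℝ) 1) : ContinuousAt (bspline t 1 i) x := by
  rw [continuousAt_iff_continuous_left'_right']
  refine ⟨?_, (hasDerivWithinAt_bspline ht 0 i x).continuousWithinAt.mono Ioi_subset_Ici_self⟩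
  -- Right continuity is known. Just to the left of `x` the indicators take the values with the
  -- opposite half-open convention, so it remains to see that the convention does not affect the
  -- value at `x`.
  have h1 : ∀ c : ℝ, ∀ᶠ y in 𝓝[<] x, (c ≤ y ↔ c < x) := by
    intro c
    rcases lt_or_ge c x with h | h
    · filter_upwards [mem_nhdsWithin_of_mem_nhds (Ioi_mem_nhds h)] with y hy
      exact ⟨fun _ => h, fun _ => le_of_lt hy⟩
    · filter_upwards [self_mem_nhdsWithin] with y hy
      exact ⟨fun h' => absurd (h'.trans_lt hy) (not_lt.2 h), fun h' => absurd h' (not_lt.2 h)⟩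
  have h2 : ∀ᶠ y in 𝓝[<] x, bspline t 1 i y =
      (y - t i) / (t (i + 1) - t i) * (if t i < x ∧ x ≤ t (i + 1) then 1 else 0) +
      (t (i + 2) - y) / (t (i + 2) - t (i + 1)) *
        (if t (i + 1) < x ∧ x ≤ t (i + 2) then 1 else 0) := by
    filter_upwards [h1 (t i), h1 (t (i + 1)), h1 (t (i + 2))] with y e0 e1 e2
    simp only [bspline, ← not_le, e0, e1, e2]
    simp only [not_le, not_lt]
  have h3 : bspline t 1 i x =
      (x - t i) / (t (i + 1) - t i) * (if t i < x ∧ x ≤ t (i + 1) then 1 else 0) +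
      (t (i + 2) - x) / (t (i + 2) - t (i + 1)) *
        (if t (i + 1) < x ∧ x ≤ t (i + 2) then 1 else 0) := by
    simp only [bspline]
    have m1 : t i ≤ t (i + 1) := ht (by lia)
    have m2 : t (i + 1) ≤ t (i + 2) := ht (by lia)
    have s1 := hs i
    have s2 := hs (i + 1)
    -- At the peak of the hat function both pieces equal 1, because the knots there are simple. At
    -- the outer knots the linear factor vanishes.
    rcases eq_or_ne x (t (i + 1)) with h | h
    · rw [← h] at m1 m2 s1 s2 ⊢
      have h1 : t i < x := s1 hx.1 (m1.trans_lt hx.2)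
      have h2 : x < t (i + 2) := s2 (hx.1.trans_le m2) hx.2
      rw [if_neg (by simp), if_pos ⟨le_rfl, h2⟩, if_pos ⟨h1, le_rfl⟩, if_neg (by simp),
        div_self (by linarith), div_self (by linarith)]
      ring
    · congr 1
      · rcases eq_or_ne x (t i) with h' | h'
        · rw [h', sub_self]; simp
        · congr 1
          refine if_congr ?_ rfl rfl
          rw [le_iff_lt_or_eq, le_iff_lt_or_eq]
          simp [h, h'.symm]
      · rcases eq_or_ne x (t (i + 2)) with h' | h'
        · rw [h', sub_self]; simp
        · congr 1
          refine if_congr ?_ rfl rfl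
          rw [le_iff_lt_or_eq, le_iff_lt_or_eq]
          simp [h.symm, h']
  refine Tendsto.congr' (h2.mono fun y h => h.symm) ?_
  rw [h3]
  apply tendsto_nhdsWithin_of_tendsto_nhds
  exact Continuous.tendsto (by fun_prop) x

lemma continuousOn_bspline {t : ℕ → ℝ} (ht : Monotone t) (hs : SimpleKnots t) (k i : ℕ) :
    ContinuousOn (bspline t (k + 1) i) (Ioo 0 1) := by
  induction k generalizing i with
  | zero => exact fun x hx => (continuousAt_bspline_one ht hs i hx).continuousWithinAt
  | succ k ih =>
    have h1 := ih i
    have h2 := ih (i + 1)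
    rw [show bspline t (k + 1 + 1) i = fun x => bspline t (k + 1 + 1) i x from rfl]
    simp only [bspline_succ t (k + 1)]
    fun_prop

lemma continuousOn_dbspline {t : ℕ → ℝ} (ht : Monotone t) (hs : SimpleKnots t) (k i : ℕ) :
    ContinuousOn (dbspline t (k + 1) i) (Ioo 0 1) := by
  have h1 := continuousOn_bspline ht hs k i
  have h2 := continuousOn_bspline ht hs k (i + 1)
  unfold dbspline
  fun_prop

/-- A continuous function with a continuous right derivative is differentiable. -/
lemma hasDerivAt_of_hasDerivWithinAt_Ici {f f' : ℝ → ℝ} {a b : ℝ}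
    (hf : ContinuousOn f (Ioo a b)) (hf' : ContinuousOn f' (Ioo a b))
    (hd : ∀ x ∈ Ioo a b, HasDerivWithinAt f (f' x) (Ici x) x) {x : ℝ} (hx : x ∈ Ioo a b) :
    HasDerivAt f (f' x) x := by
  obtain ⟨c, hac, hcx⟩ := exists_between hx.1
  obtain ⟨d, hxd, hdb⟩ := exists_between hx.2
  have hsub : Icc c d ⊆ Ioo a b := fun y hy => ⟨hac.trans_le hy.1, hy.2.trans_lt hdb⟩
  have hc : c ∈ Ioo a b := ⟨hac, hcx.trans hx.2⟩
  have hG : ∀ y ∈ Icc c d, HasDerivAt (fun y => f c + ∫ z in c..y, f' z) (f' y) y := by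
    intro y hy
    have hI : uIcc c y ⊆ Ioo a b := by
      rw [uIcc_of_le hy.1]
      exact (Icc_subset_Icc_right hy.2).trans hsub
    refine (intervalIntegral.integral_hasDerivAt_right ((hf'.mono hI).intervalIntegrable)
      (hf'.stronglyMeasurableAtFilter isOpen_Ioo y (hsub hy)) ?_).const_add _
    exact hf'.continuousAt (isOpen_Ioo.mem_nhds (hsub hy))
  -- Continuous functions with equal right derivatives and equal initial values agree, so `f` is a
  -- primitive of the continuous `f'`.
  have heq : ∀ y ∈ Icc c d, f y = f c + ∫ z in c..y, f' z := by
    refine eq_of_has_deriv_right_eq (f' := f') (fun y hy => hd y (hsub ⟨hy.1, hy.2.le⟩))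
      (fun y hy => (hG y ⟨hy.1, hy.2.le⟩).hasDerivWithinAt) (hf.mono hsub)
      (fun y hy => (hG y hy).continuousAt.continuousWithinAt) (by simp)
  refine (hG x ⟨hcx.le, hxd.le⟩).congr_of_eventuallyEq ?_
  filter_upwards [Icc_mem_nhds hcx hxd] with y hy using heq y hy

lemma hasDerivAt_bspline {t : ℕ → ℝ} (ht : Monotone t) (hs : SimpleKnots t) (k i : ℕ) {x : ℝ}
    (hx : x ∈ Ioo (0 : ℝ) 1) : HasDerivAt (bspline t (k + 2) i) (dbspline t (k + 1) i x) x :=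
  hasDerivAt_of_hasDerivWithinAt_Ici (continuousOn_bspline ht hs (k + 1) i)
    (continuousOn_dbspline ht hs k i) (fun y _ => hasDerivWithinAt_bspline ht (k + 1) i y) hx

/-! ### Cubic splines -/

/-- The derivative of `spline t θ` on `(0, 1)`. -/
def dspline {J : ℕ} (t : ℕ → ℝ) (θ : EuclideanSpace ℝ (Fin J)) (x : ℝ) : ℝ :=
  ∑ j : Fin J, θ j * dbspline t 2 j x

/-- Extend knots `t 0, …, t (J + 3)` by a constant. -/
def stopKnots (J : ℕ) (t : ℕ → ℝ) (i : ℕ) : ℝ := t (min i (J + 3))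

lemma stopKnots_of_le {J : ℕ} (t : ℕ → ℝ) {i : ℕ} (h : i ≤ J + 3) : stopKnots J t i = t i := by
  simp [stopKnots, h]

lemma IsCubicKnots.monotone_stopKnots {J : ℕ} {t : ℕ → ℝ} (h : IsCubicKnots J t) :
    Monotone (stopKnots J t) := by
  refine monotone_nat_of_le_succ fun i => ?_
  rcases lt_or_ge i (J + 3) with h' | h'
  · rw [stopKnots_of_le t h'.le, stopKnots_of_le t h']
    exact h.mono i h'
  · simp [stopKnots, h', h'.trans (Nat.le_succ i)]

lemma IsCubicKnots.simple_stopKnots {J : ℕ} {t : ℕ → ℝ} (h : IsCubicKnots J t) :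
    SimpleKnots (stopKnots J t) := by
  intro i h0 h1
  have h3 : 3 ≤ i := by
    by_contra! h'
    have := h.monotone_stopKnots (show i + 1 ≤ 3 by lia)
    rw [stopKnots_of_le t (show 3 ≤ J + 3 by lia), h.left] at this
    linarith
  have h4 : i < J := by
    by_contra! h'
    have := h.monotone_stopKnots h'
    rw [stopKnots_of_le t (show J ≤ J + 3 by lia), h.right] at this
    linarith
  rw [stopKnots_of_le t (by lia), stopKnots_of_le t (by lia)]
  exact h.strict i h3 h4

lemma bspline_stopKnots {J : ℕ} (t : ℕ → ℝ) {k i : ℕ} (h : i + k + 1 ≤ J + 3) :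
    bspline (stopKnots J t) k i = bspline t k i :=
  funext fun x => bspline_congr (fun _ _ hm => stopKnots_of_le t (hm.trans h)) x

lemma dbspline_stopKnots {J : ℕ} (t : ℕ → ℝ) (j : Fin J) :
    dbspline (stopKnots J t) 2 j = dbspline t 2 j := by
  have := j.2
  funext x
  rw [dbspline, dbspline, bspline_stopKnots t (by lia), bspline_stopKnots t (by lia),
    stopKnots_of_le t (by lia), stopKnots_of_le t (by lia), stopKnots_of_le t (by lia),
    stopKnots_of_le t (by lia)]

section Knots

variable {J : ℕ} {t : ℕ → ℝ}

lemma IsCubicKnots.continuousOn_bspline (h : IsCubicKnots J t) (j : Fin J) :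
    ContinuousOn (bspline t 3 j) (Ioo 0 1) := by
  rw [← bspline_stopKnots (J := J) t (by lia)]
  exact Nonparanormal.continuousOn_bspline h.monotone_stopKnots h.simple_stopKnots 2 j

lemma IsCubicKnots.continuousOn_dbspline (h : IsCubicKnots J t) (j : Fin J) :
    ContinuousOn (dbspline t 2 j) (Ioo 0 1) := by
  rw [← dbspline_stopKnots (J := J) t]
  exact Nonparanormal.continuousOn_dbspline h.monotone_stopKnots h.simple_stopKnots 1 j

lemma IsCubicKnots.hasDerivAt_spline (h : IsCubicKnots J t)
    (θ : EuclideanSpace ℝ (Fin J)) {x : ℝ} (hx : x ∈ Ioo (0 : ℝ) 1) :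
    HasDerivAt (spline t θ) (dspline t θ x) x := by
  refine HasDerivAt.fun_sum fun j _ => HasDerivAt.const_mul _ ?_
  rw [← bspline_stopKnots (J := J) t (by lia), ← dbspline_stopKnots (J := J) t]
  exact hasDerivAt_bspline h.monotone_stopKnots h.simple_stopKnots 1 j hx

lemma IsCubicKnots.continuousOn_dspline (h : IsCubicKnots J t)
    (θ : EuclideanSpace ℝ (Fin J)) : ContinuousOn (dspline t θ) (Ioo 0 1) :=
  continuousOn_finsetSum _ fun j _ => continuousOn_const.mul (h.continuousOn_dbspline j)

lemma IsCubicKnots.sum_bspline_three (h : IsCubicKnots J t) {x : ℝ}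
    (hx : x ∈ Ioo (0 : ℝ) 1) : ∑ j : Fin J, bspline t 3 j x = 1 := by
  rw [Fin.sum_univ_eq_sum_range (fun j => bspline t 3 j x) J, Finset.range_eq_Ico,
    ← sum_bspline h.monotone_stopKnots (a := 0) (b := J) (k := 3) (x := x)]
  · refine Finset.sum_congr rfl fun i hi => ?_
    rw [bspline_stopKnots t (by have := (Finset.mem_Ico.1 hi).2; lia)]
  · rw [stopKnots_of_le t (by lia), zero_add, h.left]; exact hx.1.le
  · rw [stopKnots_of_le t (by lia), h.right]; exact hx.2

end Knots

/-- The derivative of a cubic spline in terms of the quadratic B-splines. -/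
lemma IsCubicKnots.dspline_eq {m : ℕ} {t : ℕ → ℝ} (h : IsCubicKnots (m + 1) t)
    (θ : EuclideanSpace ℝ (Fin (m + 1))) {x : ℝ} (hx : x ∈ Ioo (0 : ℝ) 1) :
    dspline t θ x = ∑ j : Fin m, (θ j.succ - θ j.castSucc) *
      (3 / (t (j + 4) - t (j + 1)) * bspline t 2 (j + 1) x) := by
  have h0 : bspline t 2 0 x = 0 := by
    rw [← bspline_stopKnots (J := m + 1) t (by lia)]
    refine bspline_eq_zero_of_le h.monotone_stopKnots ?_
    rw [stopKnots_of_le t (by lia)]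
    exact h.left.le.trans hx.1.le
  have h1 : bspline t 2 (m + 1) x = 0 := by
    rw [← bspline_stopKnots (J := m + 1) t (by lia)]
    refine bspline_eq_zero_of_lt h.monotone_stopKnots ?_
    rw [stopKnots_of_le t (by lia), h.right]
    exact hx.2
  -- Summation by parts. The boundary terms drop out since the first and the last quadratic B-spline
  -- vanish on `(0, 1)`.
  let c : ℕ → ℝ := fun j => 3 / (t (j + 3) - t j) * bspline t 2 j x
  have hc : dspline t θ x = ∑ j : Fin (m + 1), θ j * c j - ∑ j : Fin (m + 1), θ j * c (j + 1) := by
    rw [← Finset.sum_sub_distrib]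
    refine Finset.sum_congr rfl fun j _ => ?_
    simp only [c, dbspline]
    rw [show (j : ℕ) + 1 + 3 = j + 2 + 2 by ring]
    push_cast
    ring
  rw [hc, Fin.sum_univ_succ, Fin.sum_univ_castSucc (fun j : Fin (m + 1) => θ j * c (j + 1))]
  have e0 : c 0 = 0 := by simp only [c, h0, mul_zero]
  have e1 : c (m + 1) = 0 := by simp only [c, h1, mul_zero]
  simp only [Fin.val_zero, Fin.val_last, Fin.val_succ, Fin.val_castSucc, e0, e1, mul_zero, zero_add,
    add_zero]
  rw [← Finset.sum_sub_distrib]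
  exact Finset.sum_congr rfl fun j _ => (sub_mul _ _ _).symm

lemma IsCubicKnots.sum_bspline_two {m : ℕ} {t : ℕ → ℝ} (h : IsCubicKnots (m + 1) t)
    {x : ℝ} (hx : x ∈ Ioo (0 : ℝ) 1) :
    ∑ j : Fin m, bspline t 2 (j + 1) x = 1 := by
  rw [Fin.sum_univ_eq_sum_range (fun j => bspline t 2 (j + 1) x) m, Finset.range_eq_Ico,
    Finset.sum_Ico_add' (fun j => bspline t 2 j x) 0 m 1,
    ← sum_bspline h.monotone_stopKnots (a := 0 + 1) (b := m + 1) (k := 2) (x := x)]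
  · refine Finset.sum_congr rfl fun i hi => ?_
    rw [bspline_stopKnots t (by have := (Finset.mem_Ico.1 hi).2; lia)]
  · rw [stopKnots_of_le t (by lia), h.left]; exact hx.1.le
  · rw [stopKnots_of_le t (by lia), h.right]; exact hx.2

lemma IsCubicKnots.bspline_two_nonneg {m : ℕ} {t : ℕ → ℝ} (h : IsCubicKnots (m + 1) t)
    (j : Fin m) (x : ℝ) : 0 ≤ bspline t 2 (j + 1) x := by
  rw [← bspline_stopKnots (J := m + 1) t (by lia)]
  exact bspline_nonneg h.monotone_stopKnots _ _ _

lemma IsCubicKnots.mem_of_bspline_two_ne_zero {m : ℕ} {t : ℕ → ℝ} (h : IsCubicKnots (m + 1) t)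
    {j : Fin m} {x : ℝ} (hB : bspline t 2 (j + 1) x ≠ 0) : x ∈ Ico (t (j + 1)) (t (j + 4)) := by
  rw [← bspline_stopKnots (J := m + 1) t (by lia)] at hB
  constructor
  · by_contra! h'
    exact hB (bspline_eq_zero_of_lt h.monotone_stopKnots (by rwa [stopKnots_of_le t (by lia)]))
  · by_contra! h'
    exact hB (bspline_eq_zero_of_le h.monotone_stopKnots (by rwa [stopKnots_of_le t (by lia)]))

lemma IsCubicKnots.le_of_le {J : ℕ} {t : ℕ → ℝ} (h : IsCubicKnots J t) {i j : ℕ} (hij : i ≤ j)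
    (hj : j ≤ J + 3) : t i ≤ t j := by
  rw [← stopKnots_of_le t hj, ← stopKnots_of_le t (hij.trans hj)]
  exact h.monotone_stopKnots hij

/-- Even if exterior knots coincide, the support of each of these quadratic B-splines contains a
nondegenerate cell of the partition. -/
lemma IsCubicKnots.lt_add_three {m : ℕ} {t : ℕ → ℝ} (h : IsCubicKnots (m + 1) t)
    (hJ : 4 ≤ m + 1) (j : Fin m) : t (j + 1) < t (j + 4) := by
  rcases le_or_gt (j + 1 : ℕ) 3 with h' | h'
  · exact ((h.le_of_le h' (by lia)).trans_lt (h.strict 3 le_rfl (by lia))).trans_le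
      (h.le_of_le (by lia) (by lia))
  · exact (h.strict (j + 1) h'.le (by lia)).trans_le (h.le_of_le (by lia) (by lia))

/-- All terms of the derivative are nonnegative, and since the quadratic B-splines sum to one, some
term is positive. -/
lemma IsCubicKnots.dspline_pos {J : ℕ} {t : ℕ → ℝ} (h : IsCubicKnots J t) (hJ : 4 ≤ J)
    {θ : EuclideanSpace ℝ (Fin J)} (hθ : ∀ i j : Fin J, i < j → θ i < θ j) {x : ℝ}
    (hx : x ∈ Ioo (0 : ℝ) 1) : 0 < dspline t θ x := by
  obtain ⟨m, rfl⟩ : ∃ m, J = m + 1 := ⟨J - 1, by lia⟩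
  rw [h.dspline_eq θ hx]
  have h0 : ∀ j : Fin m, 0 < (θ j.succ - θ j.castSucc) * (3 / (t (j + 4) - t (j + 1))) :=
    fun j => mul_pos (sub_pos.2 (hθ _ _ Fin.castSucc_lt_succ))
      (div_pos three_pos (sub_pos.2 (h.lt_add_three hJ j)))
  have h1 : ∃ j : Fin m, bspline t 2 (j + 1) x ≠ 0 := by
    by_contra! h'
    have := h.sum_bspline_two hx
    simp [h'] at this
  obtain ⟨j, hj⟩ := h1
  refine Finset.sum_pos' (fun i _ => ?_) ⟨j, Finset.mem_univ _, ?_⟩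
  · rw [← mul_assoc]
    exact mul_nonneg (h0 i).le (h.bspline_two_nonneg i x)
  · rw [← mul_assoc]
    exact mul_pos (h0 j) ((h.bspline_two_nonneg j x).lt_of_ne' hj)

/-! ### The truncated normal prior -/

instance isOpenPosMeasure_gaussianReal_zero_one : (gaussianReal 0 1).IsOpenPosMeasure :=
  (gaussianReal_absolutelyContinuous' 0 one_ne_zero).isOpenPosMeasure

instance isOpenPosMeasure_stdGaussian {ι : Type*} [Fintype ι] :
    (stdGaussian (EuclideanSpace ℝ ι)).IsOpenPosMeasure := by
  rw [← map_pi_eq_stdGaussian]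
  exact (PiLp.continuous_toLp 2 _).isOpenPosMeasure_map (WithLp.toLp_surjective 2)

open scoped MatrixOrder in
-- The law is the image of the standard normal law under `x ↦ μ + √S x`, and `S y = √S (√S y)`
-- exhibits the given point as an image. Stating this with `S` avoids an explicit square root later.
lemma multivariateGaussian_pos {ι : Type*} [Fintype ι] [DecidableEq ι]
    {μ : EuclideanSpace ℝ ι} {S : Matrix ι ι ℝ} (hS : S.PosSemidef) {U : Set (EuclideanSpace ℝ ι)}
    (hU : IsOpen U) (y : EuclideanSpace ℝ ι)
    (hy : μ + Matrix.toEuclideanCLM (𝕜 := ℝ) S y ∈ U) : 0 < multivariateGaussian μ S U := by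
  have hcont : Continuous (fun x => μ + Matrix.toEuclideanCLM (𝕜 := ℝ) (CFC.sqrt S) x) := by
    fun_prop
  rw [multivariateGaussian, Measure.map_apply hcont.measurable hU.measurableSet]
  refine (hU.preimage hcont).measure_pos _
    ⟨Matrix.toEuclideanCLM (𝕜 := ℝ) (CFC.sqrt S) y, ?_⟩
  rw [mem_preimage, ← mul_apply_eq_comp, ← map_mul]
  rwa [CFC.sqrt_mul_sqrt_self _ hS.nonneg]

lemma constraintMatrix_mulVec {J : ℕ} (t : ℕ → ℝ) (θ : EuclideanSpace ℝ (Fin J)) :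
    constraintMatrix J t *ᵥ θ.ofLp =
      ![spline t θ (1 / 2), spline t θ (3 / 4) - spline t θ (1 / 4)] := by
  ext i
  fin_cases i
  · simp [constraintMatrix, Matrix.mulVec, dotProduct, spline, mul_comm]
  · simp [constraintMatrix, Matrix.mulVec, dotProduct, spline, sub_mul, mul_comm,
      Finset.sum_sub_distrib]

/-- A strictly increasing coefficient vector gives a strictly increasing spline. -/
lemma IsCubicKnots.strictMonoOn_spline {J : ℕ} {t : ℕ → ℝ} (h : IsCubicKnots J t) (hJ : 4 ≤ J)
    {θ : EuclideanSpace ℝ (Fin J)} (hθ : ∀ i j : Fin J, i < j → θ i < θ j) :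
    StrictMonoOn (spline t θ) (Ioo 0 1) := by
  refine strictMonoOn_of_deriv_pos (convex_Ioo 0 1)
    (fun x hx => (h.hasDerivAt_spline θ hx).continuousAt.continuousWithinAt) fun x hx => ?_
  rw [interior_Ioo] at hx
  rw [(h.hasDerivAt_spline θ hx).deriv]
  exact h.dspline_pos hJ hθ hx

/-- The two rows are independent: the constant coefficient vector is mapped to `(1, 0)`, and an
increasing one has a positive second coordinate. Hence the Gram matrix is positive definite. -/
lemma IsCubicKnots.isUnit_det {J : ℕ} {t : ℕ → ℝ} (h : IsCubicKnots J t) (hJ : 4 ≤ J) :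
    IsUnit (constraintMatrix J t * (constraintMatrix J t)ᵀ).det := by
  rw [← Matrix.isUnit_iff_isUnit_det, ← Matrix.conjTranspose_eq_transpose_of_trivial]
  refine (Matrix.PosDef.mul_conjTranspose_self _ ?_).isUnit
  have key : ∀ v : Fin 2 → ℝ, v ᵥ* constraintMatrix J t = 0 → v = 0 := by
    intro v hv
    have hdot : ∀ θ : EuclideanSpace ℝ (Fin J), v 0 * spline t θ (1 / 2) +
        v 1 * (spline t θ (3 / 4) - spline t θ (1 / 4)) = 0 := by
      intro θ
      have h1 : v ⬝ᵥ constraintMatrix J t *ᵥ θ.ofLp = 0 := by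
        rw [Matrix.dotProduct_mulVec, hv, zero_dotProduct]
      rw [constraintMatrix_mulVec] at h1
      simpa [dotProduct] using h1
    have hone : ∀ x ∈ Ioo (0 : ℝ) 1, spline t (WithLp.toLp 2 fun _ : Fin J => (1 : ℝ)) x = 1 := by
      intro x hx
      simpa [spline] using h.sum_bspline_three hx
    have h0 := hdot (WithLp.toLp 2 fun _ => 1)
    rw [hone _ (by norm_num), hone _ (by norm_num), hone _ (by norm_num)] at h0
    have h1 := hdot (WithLp.toLp 2 fun i => (i : ℕ))
    have h2 := h.strictMonoOn_spline hJ (θ := WithLp.toLp 2 fun i => ((i : ℕ) : ℝ))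
      (fun i j hij => by simpa using hij) (a := 1 / 4) (b := 3 / 4) (by norm_num) (by norm_num)
      (by norm_num)
    have h3 : v 0 = 0 := by linarith
    rw [h3, zero_mul, zero_add] at h1
    have h4 : v 1 = 0 := (mul_eq_zero.1 h1).resolve_right (sub_pos.2 h2).ne'
    ext i
    fin_cases i
    · exact h3
    · exact h4
  intro v w hvw
  refine sub_eq_zero.1 (key _ ?_)
  rw [Matrix.sub_vecMul, sub_eq_zero]
  exact hvw

/-- Up to `s ^ 2` this is the orthogonal projection onto the kernel of `A`: symmetric and
idempotent, so equal to `Rᴴ R`. -/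
lemma IsCubicKnots.posSemidef_condCov {J : ℕ} {t : ℕ → ℝ} (h : IsCubicKnots J t) (hJ : 4 ≤ J)
    (s : ℝ) : (condCov J t s).PosSemidef := by
  set A := constraintMatrix J t with hA
  set R := 1 - Aᵀ * (A * Aᵀ)⁻¹ * A with hR
  have hsymm : Rᴴ = R := by
    rw [Matrix.conjTranspose_eq_transpose_of_trivial, hR, Matrix.transpose_sub,
      Matrix.transpose_mul, Matrix.transpose_mul, Matrix.transpose_nonsing_inv,
      Matrix.transpose_mul, Matrix.transpose_transpose, Matrix.transpose_one, Matrix.mul_assoc]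
  have hAR : A * R = 0 := by
    rw [hR, Matrix.mul_sub, Matrix.mul_one, ← Matrix.mul_assoc, ← Matrix.mul_assoc,
      Matrix.mul_nonsing_inv _ (h.isUnit_det hJ), Matrix.one_mul, sub_self]
  have hRR : R * R = R := by
    conv_lhs => enter [1]; rw [hR]
    rw [Matrix.sub_mul, Matrix.one_mul, Matrix.mul_assoc, hAR, Matrix.mul_zero, sub_zero]
  have h1 : condCov J t s = s ^ 2 • (Rᴴ * R) := by
    rw [hsymm, hRR]; rfl
  rw [h1]
  exact (Matrix.posSemidef_conjTranspose_mul_self R).smul (sq_nonneg s)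

/-- The coefficient prior charges every open set that contains a strictly increasing coefficient
vector satisfying the constraints. -/
lemma IsCubicKnots.coeffPrior_pos {J : ℕ} {t : ℕ → ℝ} (h : IsCubicKnots J t) (hJ : 4 ≤ J)
    (ζ : Fin J → ℝ) {s : ℝ} (hs : 0 < s) {U : Set (EuclideanSpace ℝ (Fin J))} (hU : IsOpen U)
    {θ : EuclideanSpace ℝ (Fin J)} (hθU : θ ∈ U) (hθ : ∀ i j : Fin J, i < j → θ i < θ j)
    (h1 : spline t θ (1 / 2) = 0) (h2 : spline t θ (3 / 4) - spline t θ (1 / 4) = 1) :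
    0 < coeffPrior J t ζ s U := by
  set S : Set (EuclideanSpace ℝ (Fin J)) := {θ | ∀ i j : Fin J, i < j → θ i < θ j} with hS
  have hSo : IsOpen S := by
    simp only [hS, ofPred_forall]
    refine isOpen_iInter_of_finite fun i => isOpen_iInter_of_finite fun j =>
      isOpen_iInter_of_finite fun _ => isOpen_lt ?_ ?_ <;> fun_prop
  rw [coeffPrior, ProbabilityTheory.cond_apply hSo.measurableSet]
  refine ENNReal.mul_pos (ENNReal.inv_ne_zero.2 (measure_ne_top _ _)) (ne_of_gt ?_)
  -- As `c = A θ`, the mean is `ζ` plus the projection of `θ - ζ` onto the row space of `A`. The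
  -- covariance applied to `(θ - ζ) / s²` supplies the complementary projection, and the sum is `θ`.
  refine multivariateGaussian_pos (h.posSemidef_condCov hJ s) (hSo.inter hU)
    (WithLp.toLp 2 ((s ^ 2)⁻¹ • (θ.ofLp - ζ))) ?_
  have hc : constraintMatrix J t *ᵥ θ.ofLp = ![0, 1] := by
    rw [constraintMatrix_mulVec, h1, h2]
  suffices hh : WithLp.toLp 2 (condMean J t ζ) + Matrix.toEuclideanCLM (𝕜 := ℝ) (condCov J t s)
      (WithLp.toLp 2 ((s ^ 2)⁻¹ • (θ.ofLp - ζ))) = θ by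
    rw [hh]; exact ⟨hθ, hθU⟩
  apply (WithLp.ofLp_injective 2)
  rw [WithLp.ofLp_add, Matrix.ofLp_toEuclideanCLM, condMean, condCov]
  simp only
  rw [← hc, Matrix.smul_mulVec, Matrix.mulVec_smul, smul_smul, mul_inv_cancel₀ (by positivity),
    one_smul, Matrix.sub_mulVec, Matrix.one_mulVec, ← Matrix.mulVec_sub, Matrix.mulVec_mulVec,
    Matrix.mulVec_mulVec]
  abel

/-! ### The prior charges neighbourhoods of increasing functions -/

lemma IsCubicKnots.le_add_mesh {J : ℕ} {t : ℕ → ℝ} {μ : ℝ}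
    (hmesh : ∀ i, 3 ≤ i → i < J → t (i + 1) - t i < μ) {i : ℕ} (hi : 3 ≤ i) (k : ℕ)
    (hk : i + k ≤ J) : t (i + k) ≤ t i + k * μ := by
  induction k with
  | zero => simp
  | succ k ih =>
    have h1 := ih (by lia)
    have h2 := hmesh (i + k) (by lia) (by lia)
    rw [← add_assoc]
    push_cast
    linarith

/-- The mesh bound says nothing about exterior knots. A support that starts before `t 3 = 0` ends
before `3 μ < δ`, so it misses `[δ, 1 - δ]`; one that extends beyond 1 reaches 1 in fewer than three
cells. -/
lemma IsCubicKnots.abs_sub_knot_le {m : ℕ} {t : ℕ → ℝ} (h : IsCubicKnots (m + 1) t)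
    (hJ : 4 ≤ m + 1) {μ δ : ℝ} (hμ : 0 < μ) (hμδ : 3 * μ < δ)
    (hmesh : ∀ i, 3 ≤ i → i < m + 1 → t (i + 1) - t i < μ) {j : Fin m} {x : ℝ}
    (hx : x ∈ Icc δ (1 - δ)) (hB : bspline t 2 (j + 1) x ≠ 0) :
    t (j + 1) ≤ x ∧ x ≤ t (j + 1) + 3 * μ := by
  obtain ⟨h1, h2⟩ := h.mem_of_bspline_two_ne_zero hB
  refine ⟨h1, ?_⟩
  have hj := j.2
  have key : ∀ {i : ℕ}, 3 ≤ i → ∀ k ≤ 3, i + k ≤ m + 1 → t (i + k) ≤ t i + 3 * μ := by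
    intro i hi k hk hik
    refine (le_add_mesh hmesh hi k hik).trans ?_
    have : (k : ℝ) ≤ 3 := by exact_mod_cast hk
    gcongr
  rcases le_or_gt 3 (j + 1 : ℕ) with h3 | h3
  · rcases le_or_gt (j + 1 + 3 : ℕ) (m + 1) with h4 | h4
    · exact h2.le.trans (key h3 3 le_rfl h4)
    · have := key h3 (m + 1 - (j + 1)) (by lia) (by lia)
      rw [show (j : ℕ) + 1 + (m + 1 - (j + 1)) = m + 1 by lia, h.right] at this
      linarith [hx.2]
  · exfalso
    have h5 : t (min ((j : ℕ) + 4) (m + 1)) ≤ t 3 + 3 * μ := by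
      have := key (le_refl 3) (min ((j : ℕ) + 4) (m + 1) - 3) (by lia) (by lia)
      rwa [show 3 + (min ((j : ℕ) + 4) (m + 1) - 3) = min ((j : ℕ) + 4) (m + 1) by lia] at this
    rw [h.left] at h5
    rcases le_total (j + 4 : ℕ) (m + 1) with h6 | h6
    · rw [min_eq_left h6] at h5
      linarith [hx.1]
    · rw [min_eq_right h6, h.right] at h5
      linarith [hx.1, hx.2]

/-- A positive function is approximated by the derivatives of splines with increasing
coefficients. -/
lemma IsCubicKnots.exists_dspline_close {m : ℕ} {t : ℕ → ℝ} (h : IsCubicKnots (m + 1) t)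
    (hJ : 4 ≤ m + 1) {μ δ ε : ℝ} (hδ : 0 < δ) (hμ : 0 < μ) (hμδ : 3 * μ < δ)
    (hmesh : ∀ i, 3 ≤ i → i < m + 1 → t (i + 1) - t i < μ) {g : ℝ → ℝ} (hg : ∀ x, 0 < g x)
    (hgε : ∀ x ∈ Icc δ (1 - δ), ∀ y, y ≤ x → x ≤ y + 3 * μ → |g y - g x| ≤ ε) :
    ∃ θ : EuclideanSpace ℝ (Fin (m + 1)), (∀ i j : Fin (m + 1), i < j → θ i < θ j) ∧
      ∀ x ∈ Icc δ (1 - δ), |dspline t θ x - g x| ≤ ε := by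
  -- With these increments the coefficient of the `j`-th quadratic B-spline in the derivative is `g
  -- (t (j + 1))`.
  let a : ℕ → ℝ := fun i => (t (i + 4) - t (i + 1)) / 3 * g (t (i + 1))
  let θ : EuclideanSpace ℝ (Fin (m + 1)) := WithLp.toLp 2 fun j => ∑ i ∈ Finset.range j, a i
  have hdiff : ∀ j : Fin m, θ j.succ - θ j.castSucc = a j := by
    intro j
    simp only [θ, Fin.val_succ, Fin.val_castSucc, Finset.sum_range_succ]
    ring
  have hapos : ∀ j : Fin m, 0 < a j := fun j =>
    mul_pos (div_pos (sub_pos.2 (h.lt_add_three hJ j)) three_pos) (hg _)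
  have hmono : StrictMono θ.ofLp := Fin.strictMono_iff_lt_succ.2 fun j => by
    have h1 := hdiff j
    have h2 := hapos j
    linarith
  refine ⟨θ, fun i j hij => hmono hij, fun x hx => ?_⟩
  have hx' : x ∈ Ioo (0 : ℝ) 1 := ⟨hδ.trans_le hx.1, by linarith [hx.2]⟩
  have h1 : dspline t θ x - g x =
      ∑ j : Fin m, (g (t (j + 1)) - g x) * bspline t 2 (j + 1) x := by
    simp only [sub_mul]
    rw [Finset.sum_sub_distrib, ← Finset.mul_sum, h.sum_bspline_two hx', mul_one,
      h.dspline_eq θ hx']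
    congr 1
    refine Finset.sum_congr rfl fun j _ => ?_
    have : t (j + 4) - t (j + 1) ≠ 0 := (sub_pos.2 (h.lt_add_three hJ j)).ne'
    rw [hdiff]
    simp only [a]
    field_simp
  rw [h1]
  calc |∑ j : Fin m, (g (t (j + 1)) - g x) * bspline t 2 (j + 1) x|
      ≤ ∑ j : Fin m, |(g (t (j + 1)) - g x) * bspline t 2 (j + 1) x| :=
        Finset.abs_sum_le_sum_abs _ _
    _ ≤ ∑ j : Fin m, ε * bspline t 2 (j + 1) x := by
        refine Finset.sum_le_sum fun j _ => ?_
        rw [abs_mul, abs_of_nonneg (h.bspline_two_nonneg j x)]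
        by_cases hB : bspline t 2 (j + 1) x = 0
        · simp [hB]
        · obtain ⟨h2, h3⟩ := h.abs_sub_knot_le hJ hμ hμδ hmesh hx hB
          exact mul_le_mul_of_nonneg_right (hgε x hx _ h2 h3) (h.bspline_two_nonneg j x)
    _ = ε := by rw [← Finset.mul_sum, h.sum_bspline_two hx', mul_one]

/-- Normalised splines with increasing coefficients approximate increasing functions. -/
lemma IsCubicKnots.exists_spline_close {J : ℕ} {t : ℕ → ℝ} (h : IsCubicKnots J t)
    (hJ : 4 ≤ J) {μ δ ε B : ℝ} (hδ : 0 < δ) (hδ' : δ < 1 / 4) (hμ : 0 < μ) (hμδ : 3 * μ < δ)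
    (hmesh : ∀ i, 3 ≤ i → i < J → t (i + 1) - t i < μ) {G g : ℝ → ℝ} (hg : ∀ x, 0 < g x)
    (hε : 0 < ε) (hε1 : ε ≤ 1) (hB : ∀ x ∈ Icc δ (1 - δ), g x ≤ B)
    (hG : ∀ x ∈ Icc δ (1 - δ), HasDerivAt G (g x) x) (hG0 : G (1 / 2) = 0)
    (hG1 : G (3 / 4) - G (1 / 4) = 1)
    (hgε : ∀ x ∈ Icc δ (1 - δ), ∀ y, y ≤ x → x ≤ y + 3 * μ → |g y - g x| ≤ ε) :
    ∃ θ : EuclideanSpace ℝ (Fin J), (∀ i j : Fin J, i < j → θ i < θ j) ∧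
      spline t θ (1 / 2) = 0 ∧ spline t θ (3 / 4) - spline t θ (1 / 4) = 1 ∧
      ∀ x ∈ Icc δ (1 - δ), |spline t θ x - G x| ≤ 2 * (1 + B) * ε ∧
        |dspline t θ x - g x| ≤ 2 * (1 + B) * ε := by
  obtain ⟨m, rfl⟩ : ∃ m, J = m + 1 := ⟨J - 1, by lia⟩
  obtain ⟨θ₀, hθ₀, hd⟩ := h.exists_dspline_close hJ hδ hμ hμδ hmesh hg hgε
  have hI : ∀ {x : ℝ}, x ∈ Icc δ (1 - δ) → x ∈ Ioo (0 : ℝ) 1 := fun hx =>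
    ⟨hδ.trans_le hx.1, by linarith [hx.2]⟩
  have hlip : ∀ (θ : EuclideanSpace ℝ (Fin (m + 1))) (C : ℝ),
      (∀ x ∈ Icc δ (1 - δ), |dspline t θ x - g x| ≤ C) →
      ∀ x ∈ Icc δ (1 - δ), ∀ y ∈ Icc δ (1 - δ),
        |(spline t θ y - G y) - (spline t θ x - G x)| ≤ C * |y - x| := by
    intro θ C hC x hx y hy
    exact (convex_Icc δ (1 - δ)).norm_image_sub_le_of_norm_hasDerivWithin_le
      (f := fun z => spline t θ z - G z) (f' := fun z => dspline t θ z - g z)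
      (fun z hz => ((h.hasDerivAt_spline θ (hI hz)).sub (hG z hz)).hasDerivWithinAt)
      hC hx hy
  have m1 : (1 / 4 : ℝ) ∈ Icc δ (1 - δ) := ⟨by linarith, by linarith⟩
  have m2 : (1 / 2 : ℝ) ∈ Icc δ (1 - δ) := ⟨by linarith, by linarith⟩
  have m3 : (3 / 4 : ℝ) ∈ Icc δ (1 - δ) := ⟨by linarith, by linarith⟩
  -- Subtracting the value at `1/2` and dividing by `κ` enforces both constraints and keeps the
  -- coefficients increasing. Integrating the derivative error over `[1/4, 3/4]` shows that `κ` is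
  -- within `ε / 2` of 1.
  set κ := spline t θ₀ (3 / 4) - spline t θ₀ (1 / 4) with hκ
  have hκ1 : |κ - 1| ≤ ε / 2 := by
    have := hlip θ₀ ε hd _ m1 _ m3
    rw [show (3 / 4 : ℝ) - 1 / 4 = 1 / 2 by norm_num, abs_of_pos (by norm_num : (0 : ℝ) < 1 / 2),
      show spline t θ₀ (3 / 4) - G (3 / 4) - (spline t θ₀ (1 / 4) - G (1 / 4)) = κ - 1 by
        rw [hκ]; linarith] at this
    linarith
  have hκ2 : 1 / 2 ≤ κ := by linarith [(abs_le.1 hκ1).1]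
  have hκ0 : 0 < κ := by linarith
  let θ : EuclideanSpace ℝ (Fin (m + 1)) :=
    WithLp.toLp 2 fun j => (θ₀ j - spline t θ₀ (1 / 2)) / κ
  have hs : ∀ x ∈ Ioo (0 : ℝ) 1, spline t θ x = (spline t θ₀ x - spline t θ₀ (1 / 2)) / κ := by
    intro x hx
    have h1 : spline t θ x = ∑ j : Fin (m + 1), (θ₀ j * bspline t 3 j x -
        spline t θ₀ (1 / 2) * bspline t 3 j x) / κ :=
      Finset.sum_congr rfl fun j _ => by simp only [θ]; ring
    rw [h1, ← Finset.sum_div, Finset.sum_sub_distrib, ← Finset.mul_sum, h.sum_bspline_three hx,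
      mul_one]
    rfl
  have hds : ∀ x ∈ Ioo (0 : ℝ) 1, dspline t θ x = dspline t θ₀ x / κ := by
    intro x hx
    refine (h.hasDerivAt_spline θ hx).unique ?_
    refine (((h.hasDerivAt_spline θ₀ hx).sub_const (spline t θ₀ (1 / 2))).div_const
      κ).congr_of_eventuallyEq ?_
    filter_upwards [Ioo_mem_nhds hx.1 hx.2] with y hy using hs y hy
  have hs0 : spline t θ (1 / 2) = 0 := by rw [hs _ (hI m2), sub_self, zero_div]
  have hdc : ∀ x ∈ Icc δ (1 - δ), |dspline t θ x - g x| ≤ 2 * (1 + B) * ε := by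
    intro x hx
    have e1 : dspline t θ x - g x = ((dspline t θ₀ x - g x) - g x * (κ - 1)) / κ := by
      rw [hds x (hI hx)]; field_simp; ring
    rw [e1, abs_div, abs_of_pos hκ0, div_le_iff₀ hκ0]
    have e2 : |g x * (κ - 1)| ≤ B * ε := by
      rw [abs_mul, abs_of_pos (hg x)]
      exact mul_le_mul (hB x hx) (hκ1.trans (by linarith)) (abs_nonneg _)
        ((hg x).le.trans (hB x hx))
    have hB0 : 0 < B := (hg x).trans_le (hB x hx)
    calc |(dspline t θ₀ x - g x) - g x * (κ - 1)| ≤ ε + B * ε :=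
          (abs_sub _ _).trans (add_le_add (hd x hx) e2)
      _ = 2 * (1 + B) * ε * (1 / 2) := by ring
      _ ≤ 2 * (1 + B) * ε * κ := by gcongr
  refine ⟨θ, fun i j hij => ?_, hs0, ?_, fun x hx => ⟨?_, hdc x hx⟩⟩
  · exact (div_lt_div_iff_of_pos_right hκ0).2 (sub_lt_sub_right (hθ₀ i j hij) _)
  · rw [hs _ (hI m1), hs _ (hI m3), ← sub_div, sub_sub_sub_cancel_right, ← hκ,
      div_self hκ0.ne']
  -- Both functions vanish at `1/2`, so the error of the values is the integrated error of the
  -- derivatives.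
  · have e1 := hlip θ _ hdc _ m2 x hx
    rw [hs0, hG0, sub_zero, sub_zero] at e1
    have hB0 : 0 < B := (hg x).trans_le (hB x hx)
    refine e1.trans (mul_le_of_le_one_right (by positivity) ?_)
    rw [abs_le]
    constructor <;> linarith [hx.1, hx.2]

lemma measurable_sigma_mk {α : Type*} {β : α → Type*} [∀ a, MeasurableSpace (β a)] (a : α) :
    Measurable (Sigma.mk a : β a → Sigma β) := by
  intro s hs
  have h : MeasurableSet[⨅ a, (inferInstance : MeasurableSpace (β a)).map (Sigma.mk a)] s := hs
  exact (MeasurableSpace.measurableSet_iInf.1 h) a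

/-- Some large `J` in the support of `π` admits an approximating `θ`, and by compactness of `[δ, 1 -
δ]` a whole neighbourhood of `θ` approximates equally well. -/
lemma splinePrior_pos {δ : ℝ} (hδ : 0 < δ) (hδ' : δ < 1 / 4)
    {t : ℕ → ℕ → ℝ} (ht : ∀ J, 4 ≤ J → IsCubicKnots J (t J))
    (ht_mesh : ∀ h : ℝ, 0 < h → ∃ N : ℕ, ∀ J, N ≤ J → ∀ i, 3 ≤ i → i < J →
      t J (i + 1) - t J i < h)
    (ζ : ∀ J : ℕ, Fin J → ℝ) {s : ℝ} (hs : 0 < s)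
    {π : PMF ℕ} (hπ_inf : π.support.Infinite) {G g : ℝ → ℝ}
    (hG : ∀ x ∈ Ioo (0 : ℝ) 1, HasDerivAt G (g x) x) (hgc : ContinuousOn g (Ioo 0 1))
    (hg : ∀ x ∈ Ioo (0 : ℝ) 1, 0 < g x) (hG0 : G (1 / 2) = 0) (hG1 : G (3 / 4) - G (1 / 4) = 1)
    {ε : ℝ} (hε : 0 < ε) :
    0 < splinePrior t ζ s π {q | 4 ≤ q.1 ∧ ∀ x ∈ Icc δ (1 - δ), |toFun t q x - G x| < ε ∧
      |dspline (t q.1) q.2 x - g x| < ε} := by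
  have hI : ∀ {x : ℝ}, x ∈ Icc δ (1 - δ) → x ∈ Ioo (0 : ℝ) 1 := fun hx =>
    ⟨hδ.trans_le hx.1, by linarith [hx.2]⟩
  have hK : Icc (δ / 2) (1 - δ / 2) ⊆ Ioo 0 1 := fun x hx =>
    ⟨by linarith [hx.1], by linarith [hx.2]⟩
  obtain ⟨B, hB⟩ := (isCompact_Icc (a := δ) (b := 1 - δ)).bddAbove_image
    (hgc.mono fun x hx => hI hx)
  have hB' : ∀ x ∈ Icc δ (1 - δ), g x ≤ B := fun x hx => hB (mem_image_of_mem g hx)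
  have m2 : (1 / 2 : ℝ) ∈ Icc δ (1 - δ) := ⟨by linarith, by linarith⟩
  have hB0 : 0 < B := (hg _ (hI m2)).trans_le (hB' _ m2)
  set ε' := min 1 (ε / (4 * (1 + B))) with hε'
  have hε'0 : 0 < ε' := lt_min one_pos (by positivity)
  have hε'1 : 2 * (1 + B) * ε' < ε := by
    calc 2 * (1 + B) * ε' ≤ 2 * (1 + B) * (ε / (4 * (1 + B))) := by gcongr; exact min_le_right _ _
      _ = ε / 2 := by field_simp; norm_num
      _ < ε := by linarith
  -- Knots to the left of `δ` enter the approximation, so uniform continuity is needed on a larger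
  -- interval; `3 μ < δ / 2` keeps them inside it.
  obtain ⟨ρ, hρ, hρg⟩ := Metric.uniformContinuousOn_iff.1
    ((isCompact_Icc (a := δ / 2) (b := 1 - δ / 2)).uniformContinuousOn_of_continuous
      (hgc.mono hK)) ε' hε'0
  set μ := min (ρ / 4) (δ / 8) with hμ
  have hμ0 : 0 < μ := lt_min (by linarith) (by linarith)
  have hμρ : μ ≤ ρ / 4 := min_le_left _ _
  have hμδ : μ ≤ δ / 8 := min_le_right _ _
  obtain ⟨N, hN⟩ := ht_mesh μ hμ0
  obtain ⟨J, hJπ, hJ⟩ := hπ_inf.exists_gt (max N 4)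
  have hJ4 : 4 ≤ J := (le_max_right _ _).trans hJ.le
  have htJ := ht J hJ4
  let g' : ℝ → ℝ := fun x => open scoped Classical in if x ∈ Ioo (0 : ℝ) 1 then g x else 1
  have hg' : ∀ x ∈ Ioo (0 : ℝ) 1, g' x = g x := fun x hx => if_pos hx
  obtain ⟨θ, hθ, hθ0, hθ1, hθc⟩ := htJ.exists_spline_close hJ4 (μ := μ) (ε := ε') (B := B)
    (G := G) (g := g') hδ hδ' hμ0 (by linarith) (hN J ((le_max_left _ _).trans hJ.le))
    (by intro x; simp only [g']; split_ifs with hx; exacts [hg x hx, one_pos]) hε'0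
    (min_le_left _ _) (fun x hx => by rw [hg' x (hI hx)]; exact hB' x hx)
    (fun x hx => by rw [hg' x (hI hx)]; exact hG x (hI hx)) hG0 hG1 (by
      intro x hx y h1 h2
      have hy : y ∈ Icc (δ / 2) (1 - δ / 2) := ⟨by linarith [hx.1], by linarith [hx.2]⟩
      rw [hg' x (hI hx), hg' y (hK hy)]
      refine (hρg y hy x ⟨by linarith [hx.1], by linarith [hx.2]⟩ ?_).le
      rw [Real.dist_eq, abs_lt]
      constructor <;> linarith)
  have hev : ∀ᶠ θ' in 𝓝 θ, ∀ x ∈ Icc δ (1 - δ), |spline (t J) θ' x - G x| < ε ∧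
      |dspline (t J) θ' x - g x| < ε := by
    refine isCompact_Icc.eventually_forall_of_forall_eventually fun x hx => ?_
    obtain ⟨c1, c2⟩ := hθc x hx
    rw [hg' x (hI hx)] at c2
    have hnh := isOpen_Ioo.mem_nhds (hI hx)
    have k1 : ContinuousAt (fun z : EuclideanSpace ℝ (Fin J) × ℝ => |spline (t J) z.1 z.2 - G z.2|)
        (θ, x) := by
      refine ContinuousAt.abs (ContinuousAt.sub ?_ ?_)
      · refine tendsto_finsetSum _ fun j _ => ContinuousAt.mul (by fun_prop) ?_
        exact ContinuousAt.comp (f := Prod.snd) (g := bspline (t J) 3 j) (x := (θ, x))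
          ((htJ.continuousOn_bspline j).continuousAt hnh) continuousAt_snd
      · exact ContinuousAt.comp (f := Prod.snd) (g := G) (x := (θ, x))
          (hG x (hI hx)).continuousAt continuousAt_snd
    have k2 : ContinuousAt (fun z : EuclideanSpace ℝ (Fin J) × ℝ => |dspline (t J) z.1 z.2 - g z.2|)
        (θ, x) := by
      refine ContinuousAt.abs (ContinuousAt.sub ?_ ?_)
      · refine tendsto_finsetSum _ fun j _ => ContinuousAt.mul (by fun_prop) ?_
        exact ContinuousAt.comp (f := Prod.snd) (g := dbspline (t J) 2 j) (x := (θ, x))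
          ((htJ.continuousOn_dbspline j).continuousAt hnh) continuousAt_snd
      · exact ContinuousAt.comp (f := Prod.snd) (g := g) (x := (θ, x))
          (hgc.continuousAt hnh) continuousAt_snd
    exact (k1.eventually_lt_const (c1.trans_lt hε'1)).and
      (k2.eventually_lt_const (c2.trans_lt hε'1))
  obtain ⟨U, hUsub, hUo, hθU⟩ := mem_nhds_iff.1 hev
  have hpos := htJ.coeffPrior_pos hJ4 (ζ J) hs hUo hθU hθ hθ0 hθ1
  -- Only lower bounds for the sum and the image measure are used, which require no measurability of
  -- the event.
  refine lt_of_lt_of_le ?_ ((ENNReal.le_tsum J).trans (Measure.le_sum_apply _ _))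
  rw [Measure.smul_apply, smul_eq_mul]
  refine ENNReal.mul_pos hJπ (ne_of_gt ?_)
  refine (hpos.trans_le (measure_mono ?_)).trans_le
    (Measure.le_map_apply (measurable_sigma_mk J).aemeasurable _)
  intro θ' hθ'
  exact ⟨hJ4, hUsub hθ'⟩

/-! ### Concentration of posterior distributions -/

section Concentration

variable {Ω E T : Type*} [MeasurableSpace Ω] [MeasurableSpace E] [MeasurableSpace T]
  {P : Measure Ω} {X : ℕ → Ω → E} {ν : Measure E}
  {Q : Measure T} [SFinite Q] {ℓ : T → E → ℝ≥0∞}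

/-- The integrated likelihood ratio over a set `U` of parameters. -/
def intLik (Q : Measure T) (ℓ : T → E → ℝ≥0∞) (U : Set T) (n : ℕ) (x : ℕ → E) : ℝ≥0∞ :=
  ∫⁻ η in U, ∏ i ∈ Finset.range n, ℓ η (x i) ∂Q

/-- Splitting at time `m` lets a statistic of the first `m` observations, such as the inverse of
their marginal likelihood, be carried through the expectation. -/
lemma lintegral_mul_prod_Ico (hX : ∀ i, Measurable (X i)) (hi : iIndepFun X P)
    (hν : ∀ i, P.map (X i) = ν) {m n : ℕ} {W : (Finset.range m → E) → ℝ≥0∞} (hW : Measurable W)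
    {b : E → ℝ≥0∞} (hb : Measurable b) :
    ∫⁻ ω, W (fun i => X i ω) * ∏ i ∈ Finset.Ico m n, b (X i ω) ∂P =
      (∫⁻ ω, W (fun i => X i ω) ∂P) * (∫⁻ x, b x ∂ν) ^ (n - m) := by
  have hdisj : Disjoint (Finset.range m) (Finset.Ico m n) := by
    rw [Finset.disjoint_left]
    intro i h1 h2
    have h3 := Finset.mem_range.1 h1
    have h4 := (Finset.mem_Ico.1 h2).1
    lia
  have hind := (hi.indepFun_finset _ _ hdisj hX).comp hW
    (ψ := fun y : Finset.Ico m n → E => ∏ i, b (y i)) (by fun_prop)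
  have h1 := lintegral_mul_eq_lintegral_mul_lintegral_of_indepFun''
    (Measurable.aemeasurable (by fun_prop)) (Measurable.aemeasurable (by fun_prop)) hind
  have h2 : ∀ ω, ∏ i ∈ Finset.Ico m n, b (X i ω) = ∏ i : Finset.Ico m n, b (X i ω) :=
    fun ω => (Finset.prod_coe_sort (Finset.Ico m n) (fun i => b (X i ω))).symm
  have h3 := lintegral_prod_eq_prod_lintegral_of_indepFun (Finset.Ico m n) (fun i => b ∘ X i)
    (hi.comp (fun _ => b) fun _ => hb) (fun i => hb.comp (hX i))
  have h4 : ∀ i, ∫⁻ ω, (b ∘ X i) ω ∂P = ∫⁻ x, b x ∂ν := fun i => by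
    rw [← hν i, lintegral_map hb (hX i)]; rfl
  simp only [h4, Finset.prod_const, Nat.card_Ico] at h3
  rw [← h3]
  simp only [Function.comp_apply, h2] at h1 ⊢
  exact h1

lemma measurable_intLik (hX : ∀ i, Measurable (X i))
    (hℓ : Measurable (Function.uncurry ℓ)) (U : Set T) (n : ℕ) :
    Measurable fun ω => intLik Q ℓ U n (fun i => X i ω) := by
  refine Measurable.lintegral_prod_right' (ν := Q.restrict U)
    (f := fun z : Ω × T => ∏ i ∈ Finset.range n, ℓ z.2 (X i z.1)) ?_
  refine Finset.measurable_prod _ fun i _ => ?_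
  exact hℓ.comp (measurable_snd.prodMk ((hX i).comp measurable_fst))

variable [IsProbabilityMeasure P]

/-- The expectation of an integrated tilted likelihood ratio, normalised by the marginal likelihood
of the first `m` observations. -/
lemma lintegral_inv_mul_intLik_le (hX : ∀ i, Measurable (X i)) (hi : iIndepFun X P)
    (hν : ∀ i, P.map (X i) = ν) (hℓ : Measurable (Function.uncurry ℓ))
    {U : Set T} (hU : MeasurableSet U) {w : E → ℝ≥0∞} (hw : Measurable w) {C ρ : ℝ≥0∞}
    (hwC : ∀ x, w x ≤ C) (hρ : ∀ᵐ η ∂Q, η ∈ U → ∫⁻ x, ℓ η x * w x ∂ν ≤ ρ) {m n : ℕ}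
    (hmn : m ≤ n) :
    ∫⁻ ω, (intLik Q ℓ univ m (fun i => X i ω))⁻¹ *
      intLik Q (fun η x => ℓ η x * w x) U n (fun i => X i ω) ∂P ≤ C ^ m * ρ ^ (n - m) := by
  have hℓη : ∀ η, Measurable (ℓ η) := fun η => hℓ.comp measurable_prodMk_left
  let D : (Finset.range m → E) → ℝ≥0∞ := fun y => ∫⁻ η, ∏ i, ℓ η (y i) ∂Q
  have hD : Measurable D := by
    refine Measurable.lintegral_prod_right' (ν := Q)
      (f := fun z : (Finset.range m → E) × T => ∏ i, ℓ z.2 (z.1 i)) ?_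
    refine Finset.measurable_prod _ fun i _ => ?_
    exact hℓ.comp (measurable_snd.prodMk ((measurable_pi_apply i).comp measurable_fst))
  have hDX : ∀ ω, intLik Q ℓ univ m (fun i => X i ω) = D (fun i => X i ω) := by
    intro ω
    simp only [intLik, D, Measure.restrict_univ]
    refine lintegral_congr fun η => ?_
    rw [Finset.prod_coe_sort (Finset.range m) (fun i => ℓ η (X i ω))]
  have hYm : Measurable fun ω => (fun i : Finset.range m => X i ω) :=
    measurable_pi_lambda _ fun i => hX i
  let ℓw : T → E → ℝ≥0∞ := fun η x => ℓ η x * w x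
  have hℓw : Measurable (Function.uncurry ℓw) := hℓ.mul (hw.comp measurable_snd)
  have hprod : Measurable fun z : Ω × T => ∏ i ∈ Finset.range n, ℓw z.2 (X i z.1) := by
    refine Finset.measurable_prod _ fun i _ => ?_
    exact hℓw.comp (measurable_snd.prodMk ((hX i).comp measurable_fst))
  calc ∫⁻ ω, (intLik Q ℓ univ m (fun i => X i ω))⁻¹ * intLik Q ℓw U n (fun i => X i ω) ∂P
      = ∫⁻ ω, ∫⁻ η in U, (D (fun i => X i ω))⁻¹ *
          ∏ i ∈ Finset.range n, ℓw η (X i ω) ∂Q ∂P := by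
        refine lintegral_congr fun ω => ?_
        rw [hDX, intLik]
        exact (lintegral_const_mul _ (hprod.comp measurable_prodMk_left)).symm
    _ = ∫⁻ η in U, ∫⁻ ω, (D (fun i => X i ω))⁻¹ *
          ∏ i ∈ Finset.range n, ℓw η (X i ω) ∂P ∂Q := by
        refine lintegral_lintegral_swap (Measurable.aemeasurable ?_)
        exact (hD.comp (hYm.comp measurable_fst)).inv.mul hprod
    -- The first `m` tilts are bounded by `C`; each later observation contributes a factor of at
    -- most `ρ` by independence.
    _ ≤ ∫⁻ η in U, C ^ m * ρ ^ (n - m) * ∫⁻ ω, (D (fun i => X i ω))⁻¹ *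
          ∏ i : Finset.range m, ℓ η (X i ω) ∂P ∂Q := by
        refine lintegral_mono_ae ?_
        filter_upwards [(ae_restrict_iff' hU).2 hρ] with η hη
        have hHm : Measurable fun y : Finset.range m → E => (D y)⁻¹ * ∏ i, ℓ η (y i) :=
          hD.inv.mul (Finset.measurable_prod _ fun i _ => (hℓη η).comp (measurable_pi_apply i))
        have hbm : Measurable (ℓw η) := (hℓη η).mul hw
        have key := lintegral_mul_prod_Ico hX hi hν (m := m) (n := n) hHm hbm
        calc ∫⁻ ω, (D (fun i => X i ω))⁻¹ * ∏ i ∈ Finset.range n, ℓw η (X i ω) ∂P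
            ≤ ∫⁻ ω, C ^ m * (((D (fun i => X i ω))⁻¹ * ∏ i : Finset.range m, ℓ η (X i ω)) *
                ∏ i ∈ Finset.Ico m n, ℓw η (X i ω)) ∂P := by
              refine lintegral_mono fun ω => ?_
              simp only
              rw [← Finset.prod_range_mul_prod_Ico _ hmn,
                Finset.prod_coe_sort (Finset.range m) (fun i => ℓ η (X i ω))]
              have : ∏ i ∈ Finset.range m, ℓw η (X i ω) ≤
                  (∏ i ∈ Finset.range m, ℓ η (X i ω)) * C ^ m := by
                simp only [ℓw]
                rw [Finset.prod_mul_distrib]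
                refine mul_le_mul_right (le_trans (Finset.prod_le_prod' fun i _ => hwC _) ?_) _
                simp
              calc _ ≤ (D (fun i => X i ω))⁻¹ * ((∏ i ∈ Finset.range m, ℓ η (X i ω)) * C ^ m *
                    ∏ i ∈ Finset.Ico m n, ℓw η (X i ω)) := by gcongr
                _ = _ := by ring
          _ = C ^ m * ((∫⁻ ω, (D (fun i => X i ω))⁻¹ * ∏ i : Finset.range m, ℓ η (X i ω) ∂P) *
                (∫⁻ x, ℓw η x ∂ν) ^ (n - m)) := by
              rw [lintegral_const_mul, key]
              exact (hHm.comp hYm).mul (Finset.measurable_prod _ fun i _ => hbm.comp (hX i))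
          _ ≤ C ^ m * ((∫⁻ ω, (D (fun i => X i ω))⁻¹ * ∏ i : Finset.range m, ℓ η (X i ω) ∂P) *
                ρ ^ (n - m)) := by gcongr
          _ = _ := by ring
    _ ≤ ∫⁻ η, C ^ m * ρ ^ (n - m) * ∫⁻ ω, (D (fun i => X i ω))⁻¹ *
          ∏ i : Finset.range m, ℓ η (X i ω) ∂P ∂Q := setLIntegral_le_lintegral _ _
    _ = C ^ m * ρ ^ (n - m) * ∫⁻ ω, ∫⁻ η, (D (fun i => X i ω))⁻¹ *
          ∏ i : Finset.range m, ℓ η (X i ω) ∂Q ∂P := by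
        have hm2 : Measurable fun z : T × Ω => (D (fun i => X i z.2))⁻¹ *
            ∏ i : Finset.range m, ℓ z.1 (X i z.2) := by
          refine (hD.comp (hYm.comp measurable_snd)).inv.mul
            (Finset.measurable_prod _ fun i _ => ?_)
          exact hℓ.comp (measurable_fst.prodMk ((hX i).comp measurable_snd))
        rw [lintegral_const_mul _ hm2.lintegral_prod_right',
          lintegral_lintegral_swap hm2.aemeasurable]
    -- After interchanging back, the inner integral is `D⁻¹ * D`, which is at most 1 even where `D`
    -- is `0` or `∞`.
    _ ≤ C ^ m * ρ ^ (n - m) * ∫⁻ ω, 1 ∂P := by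
        gcongr with ω
        rw [lintegral_const_mul]
        · exact ENNReal.inv_mul_le_one _
        · exact Finset.measurable_prod _ fun i _ => hℓ.comp measurable_prodMk_right
    _ = C ^ m * ρ ^ (n - m) := by simp

lemma le_intLik {Q : Measure T} (hℓ : Measurable (Function.uncurry ℓ)) (r : ℝ≥0∞) (n : ℕ) (x : ℕ → E) :
    r ^ n * Q {η | ∀ x, r ≤ ℓ η x} ≤ intLik Q ℓ univ n x := by
  rw [intLik, Measure.restrict_univ]
  refine le_trans ?_ (mul_meas_ge_le_lintegral₀ (Measurable.aemeasurable ?_) (r ^ n))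
  · refine mul_le_mul_right (measure_mono fun η hη => ?_) _
    simpa using Finset.prod_le_prod' (s := Finset.range n) fun i _ => hη (x i)
  · exact Finset.measurable_prod _ fun i _ => hℓ.comp measurable_prodMk_right

/-- Without a tilt the normalised ratio has expectation at most one, so a finite marginal likelihood
almost surely stays finite as observations are added. -/
lemma ae_intLik_ne_top (hX : ∀ i, Measurable (X i)) (hi : iIndepFun X P)
    (hν : ∀ i, P.map (X i) = ν) (hℓ : Measurable (Function.uncurry ℓ))
    (hone : ∀ᵐ η ∂Q, ∫⁻ x, ℓ η x ∂ν ≤ 1)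
    (hfin : ∀ᵐ ω ∂P, ∃ m, intLik Q ℓ univ m (fun i => X i ω) ≠ ∞) :
    ∀ᵐ ω ∂P, ∀ᶠ n in atTop, intLik Q ℓ univ n (fun i => X i ω) ≠ ∞ := by
  have h1 : ∀ m k, ∀ᵐ ω ∂P, (intLik Q ℓ univ m (fun i => X i ω))⁻¹ *
      intLik Q ℓ univ (m + k) (fun i => X i ω) < ∞ := by
    intro m k
    refine ae_lt_top ((measurable_intLik hX hℓ _ _).inv.mul (measurable_intLik hX hℓ _ _)) ?_
    have := lintegral_inv_mul_intLik_le hX hi hν hℓ (U := univ) MeasurableSet.univ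
      (w := fun _ => 1) measurable_const (C := 1) (ρ := 1) (fun _ => le_rfl)
      (by filter_upwards [hone] with η hη _; simpa using hη) (Nat.le_add_right m k)
    simp only [mul_one, one_pow] at this
    exact ne_top_of_le_ne_top ENNReal.one_ne_top this
  filter_upwards [hfin, ae_all_iff.2 fun m => ae_all_iff.2 (h1 m)] with ω ⟨m, hm⟩ h2
  filter_upwards [eventually_ge_atTop m] with n hn h3
  obtain ⟨k, rfl⟩ := Nat.exists_eq_add_of_le hn
  have h4 := h2 m k
  rw [h3, ENNReal.mul_top (ENNReal.inv_ne_zero.2 hm)] at h4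
  exact lt_irrefl _ h4

/-- The normalised terms have geometrically decaying expectations, so almost surely they are
summable. This is shown for all `m` at once because the `m` with finite marginal likelihood depends
on `ω`. -/
lemma ae_tendsto_intLik_mul_pow (hX : ∀ i, Measurable (X i)) (hi : iIndepFun X P)
    (hν : ∀ i, P.map (X i) = ν) (hℓ : Measurable (Function.uncurry ℓ))
    (hfin : ∀ᵐ ω ∂P, ∃ m, intLik Q ℓ univ m (fun i => X i ω) ≠ ∞)
    (hne : ∀ x n, intLik Q ℓ univ n x ≠ 0)
    {U : Set T} (hU : MeasurableSet U) {w : E → ℝ≥0∞} (hw : Measurable w) {C ρ R : ℝ≥0∞}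
    (hC : C ≠ ∞) (hwC : ∀ x, w x ≤ C) (hρ : ∀ᵐ η ∂Q, η ∈ U → ∫⁻ x, ℓ η x * w x ∂ν ≤ ρ)
    (hR : R ≠ ∞) (hρR : ρ * R < 1) :
    ∀ᵐ ω ∂P, Tendsto (fun n => intLik Q (fun η x => ℓ η x * w x) U n (fun i => X i ω) * R ^ n)
      atTop (𝓝 0) := by
  have hℓw : Measurable (Function.uncurry fun η x => ℓ η x * w x) :=
    hℓ.mul (hw.comp measurable_snd)
  have h1 : ∀ m, ∀ᵐ ω ∂P, ∑' k, (intLik Q ℓ univ m (fun i => X i ω))⁻¹ *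
      intLik Q (fun η x => ℓ η x * w x) U (m + k) (fun i => X i ω) * R ^ (m + k) < ∞ := by
    intro m
    have hmeas : ∀ k, Measurable fun ω => (intLik Q ℓ univ m (fun i => X i ω))⁻¹ *
        intLik Q (fun η x => ℓ η x * w x) U (m + k) (fun i => X i ω) * R ^ (m + k) := fun k =>
      ((measurable_intLik hX hℓ _ _).inv.mul (measurable_intLik hX hℓw _ _)).mul_const _
    refine ae_lt_top (Measurable.tsum hmeas) ?_
    rw [lintegral_tsum fun k => (hmeas k).aemeasurable]
    have h2 : ∀ k, ∫⁻ ω, (intLik Q ℓ univ m (fun i => X i ω))⁻¹ *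
        intLik Q (fun η x => ℓ η x * w x) U (m + k) (fun i => X i ω) * R ^ (m + k) ∂P ≤
        C ^ m * R ^ m * (ρ * R) ^ k := by
      intro k
      have h3 : Measurable fun ω => (intLik Q ℓ univ m (fun i => X i ω))⁻¹ *
          intLik Q (fun η x => ℓ η x * w x) U (m + k) (fun i => X i ω) :=
        (measurable_intLik hX hℓ _ _).inv.mul (measurable_intLik hX hℓw _ _)
      rw [lintegral_mul_const _ h3]
      refine (mul_le_mul_left (lintegral_inv_mul_intLik_le hX hi hν hℓ hU hw hwC hρ
        (Nat.le_add_right m k)) _).trans (le_of_eq ?_)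
      rw [Nat.add_sub_cancel_left, pow_add, mul_pow]
      ring
    refine ne_top_of_le_ne_top ?_ (ENNReal.tsum_le_tsum h2)
    rw [ENNReal.tsum_mul_left, ENNReal.tsum_geometric]
    refine ENNReal.mul_ne_top (ENNReal.mul_ne_top (ENNReal.pow_ne_top hC) (ENNReal.pow_ne_top hR))
      (ENNReal.inv_ne_top.2 (tsub_pos_of_lt hρR).ne')
  filter_upwards [hfin, ae_all_iff.2 h1] with ω ⟨m, hm⟩ h2
  have h3 := ENNReal.tendsto_atTop_zero_of_tsum_ne_top (h2 m).ne
  have h4 := ENNReal.Tendsto.const_mul (a := intLik Q ℓ univ m (fun i => X i ω)) h3 (Or.inr hm)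
  rw [mul_zero] at h4
  refine (tendsto_add_atTop_iff_nat m).1 (h4.congr fun k => ?_)
  rw [add_comm k m, ← mul_assoc, ← mul_assoc, ENNReal.mul_inv_cancel (hne _ _) hm, one_mul]

/-- Posterior concentration: the posterior mass of a set `U` of parameters that can be separated
from the truth tends to zero. -/
theorem ae_tendsto_intLik_div (hX : ∀ i, Measurable (X i)) (hi : iIndepFun X P)
    (hν : ∀ i, P.map (X i) = ν) (hℓ : Measurable (Function.uncurry ℓ))
    (hlow : ∀ r < 1, Q {η | ∀ x, r ≤ ℓ η x} ≠ 0)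
    (hfin : ∀ᵐ ω ∂P, ∃ m, intLik Q ℓ univ m (fun i => X i ω) ≠ ∞)
    {U : Set T} (hU : MeasurableSet U) {τ : E → ℝ} (hτ : Measurable τ) {c : ℝ}
    (hτc : ∀ x, |τ x| ≤ c) (hτν : 0 < ∫ x, τ x ∂ν) {ρ : ℝ≥0∞} (hρ1 : ρ < 1)
    (hρ : ∀ᵐ η ∂Q, η ∈ U → ∫⁻ x, ℓ η x * ENNReal.ofReal (Real.exp (τ x)) ∂ν ≤ ρ) :
    ∀ᵐ ω ∂P, Tendsto (fun n => intLik Q ℓ U n (fun i => X i ω) /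
      intLik Q ℓ univ n (fun i => X i ω)) atTop (𝓝 0) := by
  -- The denominator is at least `r ^ n * K`, which loses to the decay `ρ ^ n` of the numerator
  -- since `ρ < r`.
  obtain ⟨r, hρr, hr1⟩ := exists_between hρ1
  have hr0 : r ≠ 0 := (zero_le.trans_lt hρr).ne'
  have hrt : r ≠ ∞ := (hr1.trans ENNReal.one_lt_top).ne
  set K := Q {η | ∀ x, r ≤ ℓ η x} with hK
  have hK0 : K ≠ 0 := hlow r hr1
  have hne : ∀ x n, intLik Q ℓ univ n x ≠ 0 := fun x n h0 => by
    have := le_intLik (Q := Q) hℓ r n x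
    rw [h0, nonpos_iff_eq_zero, mul_eq_zero] at this
    exact this.elim (pow_ne_zero n hr0) hK0
  have hρR : ρ * r⁻¹ < 1 := by
    rw [← div_eq_mul_inv]
    exact ENNReal.div_lt_of_lt_mul (by rwa [one_mul])
  have hτint : Integrable (fun ω => τ (X 0 ω)) P := by
    refine Integrable.of_bound (hτ.comp (hX 0)).aestronglyMeasurable c ?_
    exact Eventually.of_forall fun ω => hτc _
  have hslln := strong_law_ae_real (fun i ω => τ (X i ω)) hτint
    (fun i j hij => (hi.indepFun hij).comp hτ hτ)
    (fun i => IdentDistrib.comp (u := τ) ⟨(hX i).aemeasurable, (hX 0).aemeasurable, by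
      rw [hν, hν]⟩ hτ)
  have hmean : ∫ ω, τ (X 0 ω) ∂P = ∫ x, τ x ∂ν := by
    rw [← hν 0, integral_map (hX 0).aemeasurable hτ.aestronglyMeasurable]
  have hlim := ae_tendsto_intLik_mul_pow hX hi hν hℓ hfin hne hU
    (w := fun x => ENNReal.ofReal (Real.exp (τ x))) (by fun_prop)
    (C := ENNReal.ofReal (Real.exp c)) ENNReal.ofReal_ne_top
    (fun x => ENNReal.ofReal_le_ofReal (Real.exp_le_exp.2 ((le_abs_self _).trans (hτc x))))
    hρ (ENNReal.inv_ne_top.2 hr0) hρR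
  filter_upwards [hslln, hlim] with ω h1 h2
  rw [hmean] at h1
  have h3 := ENNReal.Tendsto.const_mul (a := K⁻¹) h2 (Or.inr (ENNReal.inv_ne_top.2 hK0))
  rw [mul_zero] at h3
  refine tendsto_of_tendsto_of_tendsto_of_le_of_le' tendsto_const_nhds h3
    (Eventually.of_forall fun _ => zero_le) ?_
  filter_upwards [h1.eventually_const_lt hτν, eventually_gt_atTop 0] with n hn hn0
  have hsum : 0 ≤ ∑ i ∈ Finset.range n, τ (X i ω) := by
    by_contra! hneg
    have : (∑ i ∈ Finset.range n, τ (X i ω)) / n ≤ 0 :=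
      div_nonpos_of_nonpos_of_nonneg hneg.le (Nat.cast_nonneg n)
    linarith
  -- Once the sum of the `τ (X i)` is nonnegative, the tilt factor is at least one.
  have hnum : intLik Q ℓ U n (fun i => X i ω) ≤
      intLik Q (fun η x => ℓ η x * ENNReal.ofReal (Real.exp (τ x))) U n (fun i => X i ω) := by
    refine lintegral_mono fun η => ?_
    simp only
    rw [Finset.prod_mul_distrib, ← ENNReal.ofReal_prod_of_nonneg fun i _ => (Real.exp_pos _).le,
      ← Real.exp_sum]
    refine le_mul_of_one_le_right zero_le ?_
    rw [← ENNReal.ofReal_one]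
    exact ENNReal.ofReal_le_ofReal (Real.one_le_exp hsum)
  calc intLik Q ℓ U n (fun i => X i ω) / intLik Q ℓ univ n (fun i => X i ω)
      ≤ intLik Q (fun η x => ℓ η x * ENNReal.ofReal (Real.exp (τ x))) U n (fun i => X i ω) /
        (r ^ n * K) := ENNReal.div_le_div hnum (le_intLik hℓ r n _)
    _ = _ := by
      rw [div_eq_mul_inv, ENNReal.mul_inv (Or.inl (pow_ne_zero n hr0))
        (Or.inl (ENNReal.pow_ne_top hrt)), ENNReal.inv_pow]
      ring

end Concentration

/-! ### The standard normal distribution function -/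

lemma continuous_gaussianPDFReal (μ : ℝ) (v : ℝ≥0) : Continuous (gaussianPDFReal μ v) := by
  unfold gaussianPDFReal
  fun_prop

lemma hasDerivAt_Phi (x : ℝ) : HasDerivAt Phi (gaussianPDFReal 0 1 x) x := by
  have h1 : ∀ y, Phi y = ∫ z in Iic y, gaussianPDFReal 0 1 z := by
    intro y
    rw [Phi, cdf_eq_real, Measure.real, gaussianReal_apply_eq_integral 0 one_ne_zero,
      ENNReal.toReal_ofReal (integral_nonneg (gaussianPDFReal_nonneg 0 1))]
  have h2 : ∀ y, Phi y = Phi 0 + ∫ z in (0 : ℝ)..y, gaussianPDFReal 0 1 z := by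
    intro y
    rw [h1 0, h1 y, ← intervalIntegral.integral_Iic_sub_Iic
      (integrable_gaussianPDFReal 0 1).integrableOn (integrable_gaussianPDFReal 0 1).integrableOn]
    ring
  rw [funext h2]
  exact (intervalIntegral.integral_hasDerivAt_right
    ((continuous_gaussianPDFReal 0 1).intervalIntegrable _ _)
    ((continuous_gaussianPDFReal 0 1).stronglyMeasurableAtFilter _ _)
    (continuous_gaussianPDFReal 0 1).continuousAt).const_add _

lemma strictMono_Phi : StrictMono Phi := by
  refine strictMono_of_deriv_pos fun x => ?_
  rw [(hasDerivAt_Phi x).deriv]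
  exact gaussianPDFReal_pos _ _ _ one_ne_zero

lemma continuous_Phi : Continuous Phi :=
  continuous_iff_continuousAt.2 fun x => (hasDerivAt_Phi x).continuousAt

lemma gaussianReal_Iic (μ : ℝ) {σ : ℝ} (hσ : 0 < σ) (y : ℝ) :
    gaussianReal μ (Real.toNNReal (σ ^ 2)) (Iic y) = ENNReal.ofReal (Phi ((y - μ) / σ)) := by
  have h : (gaussianReal μ (Real.toNNReal (σ ^ 2))).map (fun x => (x - μ) / σ) =
      gaussianReal 0 1 := by
    have h1 := gaussianReal_map_sub_const (μ := μ) (v := Real.toNNReal (σ ^ 2)) μ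
    have h2 := gaussianReal_map_div_const (μ := μ - μ) (v := Real.toNNReal (σ ^ 2)) σ
    rw [← h1, Measure.map_map (by fun_prop) (by fun_prop)] at h2
    have h3 : Real.toNNReal (σ ^ 2) / NNReal.mk (σ ^ 2) (sq_nonneg σ) = 1 := by
      rw [Real.toNNReal_of_nonneg (sq_nonneg σ)]
      exact div_self (by rw [ne_eq, ← NNReal.coe_inj]; simp [hσ.ne'])
    rw [h3, sub_self, zero_div] at h2
    exact h2
  rw [Phi, ofReal_cdf, ← h, Measure.map_apply (by fun_prop) measurableSet_Iic]
  congr 1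
  ext x
  simp only [mem_Iic, mem_preimage]
  rw [div_le_div_iff_of_pos_right hσ, sub_le_sub_iff_right]

/-- `PhiInv` is a uniformly continuous inverse of `Phi` on compact sets. -/
lemma exists_abs_PhiInv_sub_le (a b : ℝ) {ε : ℝ} (hε : 0 < ε) :
    ∃ κ : ℝ, 0 < κ ∧ ∀ x ∈ Icc a b, ∀ p, |p - Phi x| < κ → |PhiInv p - x| ≤ ε := by
  rcases lt_or_ge b a with hab | hab
  · exact ⟨1, one_pos, fun x hx => absurd (hx.1.trans hx.2) (not_le.2 hab)⟩
  -- The minimum over `[a, b]` of these increments of `Phi` serves as `κ`. Then `p` lies between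
  -- `Phi (x - ε)` and `Phi (x + ε)`, which locates the infimum defining `PhiInv p`.
  have hc : Continuous fun x => min (Phi (x + ε) - Phi x) (Phi x - Phi (x - ε)) := by
    have := continuous_Phi
    fun_prop
  obtain ⟨x₀, -, hx₀⟩ := isCompact_Icc.exists_isMinOn (nonempty_Icc.2 hab) hc.continuousOn
  refine ⟨min (Phi (x₀ + ε) - Phi x₀) (Phi x₀ - Phi (x₀ - ε)),
    lt_min (sub_pos.2 (strictMono_Phi (by linarith))) (sub_pos.2 (strictMono_Phi (by linarith))),
    fun x hx p hp => ?_⟩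
  have h1 := hp.trans_le (hx₀ hx)
  rw [lt_min_iff] at h1
  have h2 := abs_lt.1 h1.1
  have h3 := abs_lt.1 h1.2
  have hlow : ∀ y, p ≤ Phi y → x - ε ≤ y := by
    intro y hy
    by_contra! hlt
    have := strictMono_Phi hlt
    linarith
  have hup : p ≤ Phi (x + ε) := by linarith
  rw [abs_le]
  constructor
  · have : x - ε ≤ PhiInv p := le_csInf ⟨_, hup⟩ hlow
    linarith
  · have : PhiInv p ≤ x + ε := csInf_le ⟨_, hlow⟩ hup
    linarith

/-! ### Transformed normal distributions -/

/-- A strictly increasing continuously differentiable function on `(0, 1)`. -/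
structure IsTransform (f : ℝ → ℝ) : Prop where
  diff : ∀ x ∈ Ioo (0 : ℝ) 1, DifferentiableAt ℝ f x
  cont : ContinuousOn (deriv f) (Ioo 0 1)
  mono : StrictMonoOn f (Ioo 0 1)

section Transform

variable {f : ℝ → ℝ} {δ μ σ : ℝ}

lemma Icc_subset_Ioo_zero_one (hδ : 0 < δ) : Icc δ (1 - δ) ⊆ Ioo (0 : ℝ) 1 := fun x hx =>
  ⟨hδ.trans_le hx.1, by linarith [hx.2]⟩

lemma IsTransform.deriv_nonneg (hf : IsTransform f) {x : ℝ} (hx : x ∈ Ioo (0 : ℝ) 1) :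
    0 ≤ deriv f x := by
  rw [← derivWithin_of_isOpen isOpen_Ioo hx]
  exact hf.mono.monotoneOn.derivWithin_nonneg

lemma IsTransform.continuousOn (hf : IsTransform f) : ContinuousOn f (Ioo 0 1) :=
  fun x hx => (hf.diff x hx).continuousAt.continuousWithinAt

lemma IsTransform.strictMonoOn_cdfX (hf : IsTransform f) (hσ : 0 < σ) :
    StrictMonoOn (cdfX μ σ f) (Ioo 0 1) := fun _ hx _ hy hxy =>
  strictMono_Phi ((div_lt_div_iff_of_pos_right hσ).2 (sub_lt_sub_right (hf.mono hx hy hxy) μ))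

lemma IsTransform.cdfX_lt (hf : IsTransform f) (hσ : 0 < σ) (hδ : 0 < δ) (hδ' : δ < 1 / 4) :
    cdfX μ σ f δ < cdfX μ σ f (1 - δ) :=
  hf.strictMonoOn_cdfX hσ ⟨hδ, by linarith⟩ ⟨by linarith, by linarith⟩ (by linarith)

lemma IsTransform.hasDerivAt_cdfTrunc (hf : IsTransform f) {x : ℝ}
    (hx : x ∈ Ioo (0 : ℝ) 1) :
    HasDerivAt (cdfTrunc δ μ σ f) (densTrunc δ μ σ f x) x := by
  have h1 := (hasDerivAt_Phi ((f x - μ) / σ)).comp x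
    (((hf.diff x hx).hasDerivAt.sub_const μ).div_const σ)
  convert! (h1.sub_const (cdfX μ σ f δ)).div_const (cdfX μ σ f (1 - δ) - cdfX μ σ f δ) using 1
  rw [densTrunc]
  ring

lemma IsTransform.continuousOn_densTrunc (hf : IsTransform f) :
    ContinuousOn (densTrunc δ μ σ f) (Ioo 0 1) := by
  have h1 := hf.cont
  have h2 : ContinuousOn (fun x => gaussianPDFReal 0 1 ((f x - μ) / σ)) (Ioo 0 1) :=
    (continuous_gaussianPDFReal 0 1).comp_continuousOn
      ((hf.continuousOn.sub continuousOn_const).div_const _)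
  unfold densTrunc
  fun_prop

lemma IsTransform.densTrunc_nonneg (hf : IsTransform f) (hσ : 0 < σ) (hδ : 0 < δ)
    (hδ' : δ < 1 / 4) {x : ℝ} (hx : x ∈ Ioo (0 : ℝ) 1) : 0 ≤ densTrunc δ μ σ f x :=
  div_nonneg (mul_nonneg (hf.deriv_nonneg hx)
    (div_nonneg (gaussianPDFReal_nonneg _ _ _) hσ.le)) (sub_pos.2 (hf.cdfX_lt hσ hδ hδ')).le

lemma cdfTrunc_left : cdfTrunc δ μ σ f δ = 0 := by simp [cdfTrunc]

lemma IsTransform.cdfTrunc_right (hf : IsTransform f) (hσ : 0 < σ) (hδ : 0 < δ)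
    (hδ' : δ < 1 / 4) : cdfTrunc δ μ σ f (1 - δ) = 1 :=
  div_self (sub_pos.2 (hf.cdfX_lt hσ hδ hδ')).ne'

lemma IsTransform.monotoneOn_cdfTrunc (hf : IsTransform f) (hσ : 0 < σ) (hδ : 0 < δ)
    (hδ' : δ < 1 / 4) : MonotoneOn (cdfTrunc δ μ σ f) (Icc δ (1 - δ)) := fun _ hx _ hy hxy =>
  div_le_div_of_nonneg_right (sub_le_sub_right ((hf.strictMonoOn_cdfX hσ).monotoneOn
    (Icc_subset_Ioo_zero_one hδ hx) (Icc_subset_Ioo_zero_one hδ hy) hxy) _)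
    (sub_pos.2 (hf.cdfX_lt hσ hδ hδ')).le

lemma IsTransform.continuousOn_cdfTrunc (hf : IsTransform f) :
    ContinuousOn (cdfTrunc δ μ σ f) (Ioo 0 1) :=
  fun _ hx => (hf.hasDerivAt_cdfTrunc hx).continuousAt.continuousWithinAt

lemma IsTransform.cdfTrunc_mem (hf : IsTransform f) (hσ : 0 < σ) (hδ : 0 < δ)
    (hδ' : δ < 1 / 4) {x : ℝ} (hx : x ∈ Icc δ (1 - δ)) :
    cdfTrunc δ μ σ f x ∈ Icc (0 : ℝ) 1 := by
  have hm := hf.monotoneOn_cdfTrunc (μ := μ) hσ hδ hδ'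
  constructor
  · rw [← cdfTrunc_left (f := f) (δ := δ) (μ := μ) (σ := σ)]
    exact hm ⟨le_rfl, by linarith⟩ hx hx.1
  · rw [← hf.cdfTrunc_right (μ := μ) hσ hδ hδ']
    exact hm hx ⟨by linarith, le_rfl⟩ hx.2

lemma IsTransform.lintegral_densTrunc (hf : IsTransform f) (hσ : 0 < σ) (hδ : 0 < δ)
    (hδ' : δ < 1 / 4) {a b : ℝ} (ha : δ ≤ a) (hab : a ≤ b) (hb : b ≤ 1 - δ) :
    ∫⁻ x in Icc a b, ENNReal.ofReal (densTrunc δ μ σ f x) =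
      ENNReal.ofReal (cdfTrunc δ μ σ f b - cdfTrunc δ μ σ f a) := by
  have hsub : Icc a b ⊆ Ioo 0 1 :=
    (Icc_subset_Icc ha hb).trans (Icc_subset_Ioo_zero_one hδ)
  have hcont : ContinuousOn (densTrunc δ μ σ f) (Icc a b) := hf.continuousOn_densTrunc.mono hsub
  rw [← ofReal_integral_eq_lintegral_ofReal]
  · rw [integral_Icc_eq_integral_Ioc, ← intervalIntegral.integral_of_le hab]
    rw [intervalIntegral.integral_eq_sub_of_hasDerivAt (f := cdfTrunc δ μ σ f)]
    · intro x hx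
      rw [uIcc_of_le hab] at hx
      exact hf.hasDerivAt_cdfTrunc (hsub hx)
    · exact ContinuousOn.intervalIntegrable (by rwa [uIcc_of_le hab])
  · exact hcont.integrableOn_Icc
  · refine (ae_restrict_iff' measurableSet_Icc).2 (Eventually.of_forall fun x hx => ?_)
    exact hf.densTrunc_nonneg hσ hδ hδ' (hsub hx)

end Transform

/-- `ν` is the law on `(0, 1)` of an `X` with `f X ∼ N(μ, σ²)`. -/
structure IsLaw (μ σ : ℝ) (f : ℝ → ℝ) (ν : Measure ℝ) : Prop where
  Iic_eq : ∀ x ∈ Ioo (0 : ℝ) 1, ν (Iic x) = ENNReal.ofReal (cdfX μ σ f x)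
  Iic_zero : ν (Iic 0) = 0
  Iio_one : ν (Iio 1) = 1

lemma isLaw_map {Ω : Type*} [MeasurableSpace Ω] {P : Measure Ω} [IsProbabilityMeasure P]
    {X : Ω → ℝ} (hX : Measurable X) (hX01 : ∀ᵐ ω ∂P, X ω ∈ Ioo 0 1) {f : ℝ → ℝ} {μ σ : ℝ}
    (hf : StrictMonoOn f (Ioo 0 1)) (hσ : 0 < σ)
    (hlaw : P.map (fun ω => f (X ω)) = gaussianReal μ (Real.toNNReal (σ ^ 2))) :
    IsLaw μ σ f (P.map X) := by
  -- No measurability of `f` is assumed; a map that is not a.e. measurable would have image measure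
  -- zero, not a normal law.
  have hfX : AEMeasurable (fun ω => f (X ω)) P := by
    by_contra h
    rw [Measure.map_of_not_aemeasurable h] at hlaw
    exact (IsProbabilityMeasure.ne_zero _) hlaw.symm
  refine ⟨fun x hx => ?_, ?_, ?_⟩
  · rw [cdfX, ← gaussianReal_Iic μ hσ, ← hlaw, Measure.map_apply hX measurableSet_Iic,
      Measure.map_apply_of_aemeasurable hfX measurableSet_Iic]
    refine measure_congr ?_
    filter_upwards [hX01] with ω hω
    exact propext (hf.le_iff_le hω hx).symm
  · rw [Measure.map_apply hX measurableSet_Iic, measure_eq_zero_iff_ae_notMem]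
    filter_upwards [hX01] with ω hω h
    exact absurd hω.1 (not_lt.2 h)
  · rw [Measure.map_apply hX measurableSet_Iio, prob_compl_eq_zero_iff (hX measurableSet_Iio) |>.1]
    rw [measure_eq_zero_iff_ae_notMem]
    filter_upwards [hX01] with ω hω h
    exact h hω.2

section Law

variable {f f₀ : ℝ → ℝ} {δ μ σ μ₀ σ₀ : ℝ} {ν ν' : Measure ℝ} [IsProbabilityMeasure ν]
  [IsProbabilityMeasure ν']

/-- Only the laws of the `f₀ (X i)` are given; that the `X i` have a common law follows from this.
-/
lemma IsLaw.eq (h : IsLaw μ₀ σ₀ f₀ ν) (h' : IsLaw μ₀ σ₀ f₀ ν') : ν = ν' := by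
  refine Measure.ext_of_Iic ν ν' fun x => ?_
  rcases le_or_gt x 0 with hx | hx
  · rw [measure_mono_null (Iic_subset_Iic.2 hx) h.Iic_zero,
      measure_mono_null (Iic_subset_Iic.2 hx) h'.Iic_zero]
  rcases lt_or_ge x 1 with hx1 | hx1
  · rw [h.Iic_eq x ⟨hx, hx1⟩, h'.Iic_eq x ⟨hx, hx1⟩]
  · have key : ∀ (κ : Measure ℝ) [IsProbabilityMeasure κ], κ (Iio 1) = 1 → κ (Iic x) = 1 := by
      intro κ _ h1
      refine le_antisymm prob_le_one ?_
      rw [← h1]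
      exact measure_mono fun y hy => (le_of_lt hy).trans hx1
    rw [key ν h.Iio_one, key ν' h'.Iio_one]

lemma IsLaw.Icc_eq (h : IsLaw μ₀ σ₀ f₀ ν) (hf₀ : IsTransform f₀) {a b : ℝ}
    (ha : a ∈ Ioo (0 : ℝ) 1) (hb : b ∈ Ioo (0 : ℝ) 1) (hab : a ≤ b) :
    ν (Icc a b) = ENNReal.ofReal (cdfX μ₀ σ₀ f₀ b - cdfX μ₀ σ₀ f₀ a) := by
  have hnn : ∀ x, 0 ≤ cdfX μ₀ σ₀ f₀ x := fun x => cdf_nonneg _ _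
  have hcont : ContinuousOn (cdfX μ₀ σ₀ f₀) (Ioo 0 1) :=
    continuous_Phi.comp_continuousOn ((hf₀.continuousOn.sub continuousOn_const).div_const _)
  -- There is no atom at `a`, by continuity of the distribution function from the left.
  have hIio : ν (Iio a) = ENNReal.ofReal (cdfX μ₀ σ₀ f₀ a) := by
    refine le_antisymm ((measure_mono Iio_subset_Iic_self).trans (h.Iic_eq a ha).le) ?_
    have hlim : Tendsto (fun x => ENNReal.ofReal (cdfX μ₀ σ₀ f₀ x)) (𝓝[<] a)
        (𝓝 (ENNReal.ofReal (cdfX μ₀ σ₀ f₀ a))) :=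
      (ENNReal.continuous_ofReal.tendsto _).comp
        ((hcont.continuousAt (isOpen_Ioo.mem_nhds ha)).tendsto.mono_left nhdsWithin_le_nhds)
    refine le_of_tendsto hlim ?_
    filter_upwards [self_mem_nhdsWithin, mem_nhdsWithin_of_mem_nhds (Ioo_mem_nhds ha.1 ha.2)]
      with x hx hx01
    rw [← h.Iic_eq x hx01]
    exact measure_mono (Iic_subset_Iio.2 hx)
  have hdiff : Icc a b = Iic b \ Iio a := by
    ext x
    simp
  rw [hdiff, measure_sdiff (Iio_subset_Iic_self.trans (Iic_subset_Iic.2 hab))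
    measurableSet_Iio.nullMeasurableSet
    (measure_ne_top _ _), h.Iic_eq b hb, hIio, ENNReal.ofReal_sub _ (hnn a)]

lemma IsLaw.restrict_eq (h : IsLaw μ₀ σ₀ f₀ ν) (hf₀ : IsTransform f₀) (hσ₀ : 0 < σ₀) (hδ : 0 < δ)
    (hδ' : δ < 1 / 4) : ν.restrict (Icc δ (1 - δ)) = ν (Icc δ (1 - δ)) •
      (volume.restrict (Icc δ (1 - δ))).withDensity
        (fun x => ENNReal.ofReal (densTrunc δ μ₀ σ₀ f₀ x)) := by
  have hδ1 : δ ≤ 1 - δ := by linarith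
  have hI := Icc_subset_Ioo_zero_one hδ
  have hlt := sub_pos.2 (hf₀.cdfX_lt (μ := μ₀) hσ₀ hδ hδ')
  have hc := h.Icc_eq hf₀ (hI ⟨le_rfl, hδ1⟩) (hI ⟨hδ1, le_rfl⟩) hδ1
  refine Measure.ext_of_Iic _ _ fun a => ?_
  rw [Measure.restrict_apply measurableSet_Iic, Measure.smul_apply,
    withDensity_apply _ measurableSet_Iic, Measure.restrict_restrict measurableSet_Iic]
  have hset : Iic a ∩ Icc δ (1 - δ) = Icc δ (min a (1 - δ)) := by
    ext x
    simp only [mem_inter_iff, mem_Iic, mem_Icc, le_min_iff]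
    tauto
  rw [hset]
  rcases lt_or_ge a δ with ha | ha
  · rw [Icc_eq_empty (by simp [ha])]
    simp
  · have h1 : δ ≤ min a (1 - δ) := le_min ha hδ1
    rw [h.Icc_eq hf₀ (hI ⟨le_rfl, hδ1⟩) (hI ⟨h1, min_le_right _ _⟩) h1,
      hf₀.lintegral_densTrunc hσ₀ hδ hδ' le_rfl h1 (min_le_right _ _), hc, smul_eq_mul,
      ← ENNReal.ofReal_mul hlt.le, cdfTrunc_left, sub_zero, cdfTrunc,
      mul_div_cancel₀ _ hlt.ne']

lemma IsLaw.measure_Icc_pos (h : IsLaw μ₀ σ₀ f₀ ν) (hf₀ : IsTransform f₀) (hσ₀ : 0 < σ₀)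
    (hδ : 0 < δ) (hδ' : δ < 1 / 4) : 0 < ν (Icc δ (1 - δ)) := by
  have hδ1 : δ ≤ 1 - δ := by linarith
  have hI := Icc_subset_Ioo_zero_one hδ
  rw [h.Icc_eq hf₀ (hI ⟨le_rfl, hδ1⟩) (hI ⟨hδ1, le_rfl⟩) hδ1]
  exact ENNReal.ofReal_pos.2 (sub_pos.2 (hf₀.cdfX_lt hσ₀ hδ hδ'))

lemma IsLaw.measure_Icc_left (h : IsLaw μ₀ σ₀ f₀ ν) (hf₀ : IsTransform f₀) (hσ₀ : 0 < σ₀)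
    (hδ : 0 < δ) (hδ' : δ < 1 / 4) {y : ℝ} (hy : y ∈ Icc δ (1 - δ)) :
    ν (Icc δ y) = ν (Icc δ (1 - δ)) * ENNReal.ofReal (cdfTrunc δ μ₀ σ₀ f₀ y) := by
  have hδ1 : δ ≤ 1 - δ := by linarith
  have hI := Icc_subset_Ioo_zero_one hδ
  have hlt := sub_pos.2 (hf₀.cdfX_lt (μ := μ₀) hσ₀ hδ hδ')
  rw [h.Icc_eq hf₀ (hI ⟨le_rfl, hδ1⟩) (hI ⟨hδ1, le_rfl⟩) hδ1,
    h.Icc_eq hf₀ (hI ⟨le_rfl, hδ1⟩) (hI hy) hy.1, ← ENNReal.ofReal_mul hlt.le, cdfTrunc,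
    mul_div_cancel₀ _ hlt.ne']

/-! ### Test functions and tilted density ratios -/

/-- A function that is constant on `[δ, y]`, on `(y, 1 - δ]` and outside `[δ, 1 - δ]`. -/
def stepFun (δ y u v : ℝ) (x : ℝ) : ℝ :=
  (Icc δ y).indicator (fun _ => u) x + (Ioc y (1 - δ)).indicator (fun _ => v) x

lemma measurable_stepFun (δ y u v : ℝ) : Measurable (stepFun δ y u v) :=
  (measurable_const.indicator measurableSet_Icc).add (measurable_const.indicator measurableSet_Ioc)

lemma abs_stepFun_le (δ y u v x : ℝ) : |stepFun δ y u v x| ≤ |u| + |v| := by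
  refine (abs_add_le _ _).trans (add_le_add ?_ ?_)
  · by_cases h : x ∈ Icc δ y <;> simp [h]
  · by_cases h : x ∈ Ioc y (1 - δ) <;> simp [h]

lemma stepFun_left {δ y u v x : ℝ} (hx : x ∈ Icc δ y) : stepFun δ y u v x = u := by
  rw [stepFun, indicator_of_mem hx, indicator_of_notMem (fun h => not_lt.2 hx.2 h.1), add_zero]

lemma stepFun_right {δ y u v x : ℝ} (hx : x ∈ Ioc y (1 - δ)) : stepFun δ y u v x = v := by
  rw [stepFun, indicator_of_notMem (fun h => not_le.2 hx.1 h.2), indicator_of_mem hx, zero_add]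

lemma stepFun_compl {δ y u v x : ℝ} (hy : y ∈ Icc δ (1 - δ)) (hx : x ∉ Icc δ (1 - δ)) :
    stepFun δ y u v x = 0 := by
  rw [stepFun, indicator_of_notMem (fun h => hx ⟨h.1, h.2.trans hy.2⟩),
    indicator_of_notMem (fun h => hx ⟨hy.1.trans h.1.le, h.2⟩), add_zero]

lemma IsLaw.integral_stepFun (h : IsLaw μ₀ σ₀ f₀ ν) (hf₀ : IsTransform f₀) (hσ₀ : 0 < σ₀)
    (hδ : 0 < δ) (hδ' : δ < 1 / 4) {y : ℝ} (hy : y ∈ Icc δ (1 - δ)) (u v : ℝ) :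
    ∫ x, stepFun δ y u v x ∂ν = ν.real (Icc δ (1 - δ)) *
      (cdfTrunc δ μ₀ σ₀ f₀ y * u + (1 - cdfTrunc δ μ₀ σ₀ f₀ y) * v) := by
  have h1 : ν.real (Icc δ y) = ν.real (Icc δ (1 - δ)) * cdfTrunc δ μ₀ σ₀ f₀ y := by
    rw [Measure.real, h.measure_Icc_left hf₀ hσ₀ hδ hδ' hy, ENNReal.toReal_mul,
      ENNReal.toReal_ofReal (hf₀.cdfTrunc_mem hσ₀ hδ hδ' hy).1, Measure.real]
  have h2 : ν.real (Ioc y (1 - δ)) = ν.real (Icc δ (1 - δ)) - ν.real (Icc δ y) := by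
    rw [← measureReal_sdiff (Icc_subset_Icc_right hy.2) measurableSet_Icc]
    congr 1
    ext x
    simp only [mem_Ioc, Set.mem_sdiff, mem_Icc, not_and, not_le]
    exact ⟨fun hx => ⟨⟨hy.1.trans hx.1.le, hx.2⟩, fun _ => hx.1⟩, fun hx => ⟨hx.2 hx.1.1, hx.1.2⟩⟩
  simp only [stepFun]
  rw [integral_add ((integrable_const u).indicator measurableSet_Icc)
    ((integrable_const v).indicator measurableSet_Ioc), integral_indicator measurableSet_Icc,
    integral_indicator measurableSet_Ioc, setIntegral_const, setIntegral_const, h2, h1, smul_eq_mul,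
    smul_eq_mul]
  ring

/-- The ratio of the densities `p` and `p₀` on `[δ, 1 - δ]`, and `1` outside of this interval. -/
def densRatio (δ : ℝ) (p₀ p : ℝ → ℝ) (x : ℝ) : ℝ≥0∞ :=
  open scoped Classical in
  if x ∈ Icc δ (1 - δ) then ENNReal.ofReal (p x) / ENNReal.ofReal (p₀ x) else 1

/-- The tilt is constant on either side of `y`, so only `F* y` matters. There is merely an
inequality, as `p₀ * (p / p₀)` is zero where `p₀` vanishes, even if `p` does not. -/
lemma IsLaw.lintegral_densRatio_le (h : IsLaw μ₀ σ₀ f₀ ν) (hf₀ : IsTransform f₀) (hσ₀ : 0 < σ₀)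
    (hδ : 0 < δ) (hδ' : δ < 1 / 4) (hf : IsTransform f) (hσ : 0 < σ) {p p₀ : ℝ → ℝ}
    (hp : ∀ x ∈ Icc δ (1 - δ), p x = densTrunc δ μ σ f x) (hpm : Measurable p)
    (hp₀ : ∀ x ∈ Icc δ (1 - δ), p₀ x = densTrunc δ μ₀ σ₀ f₀ x) (hpm₀ : Measurable p₀)
    {y : ℝ} (hy : y ∈ Icc δ (1 - δ)) (u v : ℝ) :
    ∫⁻ x, densRatio δ p₀ p x * ENNReal.ofReal (Real.exp (stepFun δ y u v x)) ∂ν ≤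
      ν (Icc δ (1 - δ))ᶜ + ν (Icc δ (1 - δ)) * ENNReal.ofReal
        (cdfTrunc δ μ σ f y * Real.exp u + (1 - cdfTrunc δ μ σ f y) * Real.exp v) := by
  set I := Icc δ (1 - δ) with hI
  have hIm : MeasurableSet I := measurableSet_Icc
  set e : ℝ → ℝ≥0∞ := fun x => ENNReal.ofReal (Real.exp (stepFun δ y u v x)) with he
  have hem : Measurable e := by
    have := measurable_stepFun δ y u v
    fun_prop
  obtain ⟨hF0, hF1⟩ := hf.cdfTrunc_mem (μ := μ) hσ hδ hδ' hy
  rw [← lintegral_add_compl _ hIm, add_comm]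
  refine add_le_add ?_ ?_
  · refine le_of_eq ?_
    rw [← setLIntegral_one]
    refine setLIntegral_congr_fun hIm.compl fun x hx => ?_
    simp only [densRatio]
    rw [if_neg hx, stepFun_compl hy hx]
    simp
  · have h1 : ∫⁻ x in I, densRatio δ p₀ p x * e x ∂ν =
        ∫⁻ x in I, ENNReal.ofReal (p x) / ENNReal.ofReal (p₀ x) * e x ∂ν := by
      refine setLIntegral_congr_fun hIm fun x hx => ?_
      simp only [densRatio]
      rw [if_pos hx]
    have hw : (volume.restrict I).withDensity (fun x => ENNReal.ofReal (densTrunc δ μ₀ σ₀ f₀ x)) =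
        (volume.restrict I).withDensity fun x => ENNReal.ofReal (p₀ x) := by
      refine withDensity_congr_ae ((ae_restrict_iff' hIm).2 (Eventually.of_forall fun x hx => ?_))
      simp only [hp₀ x hx]
    rw [h1, h.restrict_eq hf₀ hσ₀ hδ hδ', lintegral_smul_measure, hw,
      lintegral_withDensity_eq_lintegral_mul _ (by fun_prop) (by fun_prop), smul_eq_mul]
    gcongr
    have hunion : I = Icc δ y ∪ Ioc y (1 - δ) := (Icc_union_Ioc_eq_Icc hy.1 hy.2).symm
    have hdisj : Disjoint (Icc δ y) (Ioc y (1 - δ)) :=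
      Set.disjoint_left.2 fun x hx hx' => not_lt.2 hx.2 hx'.1
    have hint : ∀ {a b c : ℝ} {s : Set ℝ}, δ ≤ a → a ≤ b → b ≤ 1 - δ → MeasurableSet s →
        s ⊆ Icc a b → (∀ x ∈ s, stepFun δ y u v x = c) →
        ∫⁻ x in s, ENNReal.ofReal (p x) * e x ≤ ENNReal.ofReal
          ((cdfTrunc δ μ σ f b - cdfTrunc δ μ σ f a) * Real.exp c) := by
      intro a b c s ha hab hb hs hsub hc
      calc ∫⁻ x in s, ENNReal.ofReal (p x) * e x
          = ∫⁻ x in s, ENNReal.ofReal (densTrunc δ μ σ f x) * ENNReal.ofReal (Real.exp c) := by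
            refine setLIntegral_congr_fun hs fun x hx => ?_
            simp only [he]
            rw [hp x ⟨ha.trans (hsub hx).1, (hsub hx).2.trans hb⟩, hc x hx]
        _ ≤ ∫⁻ x in Icc a b, ENNReal.ofReal (densTrunc δ μ σ f x) * ENNReal.ofReal (Real.exp c) :=
            lintegral_mono_set hsub
        _ = _ := by
            rw [lintegral_mul_const' _ _ ENNReal.ofReal_ne_top,
              hf.lintegral_densTrunc hσ hδ hδ' ha hab hb,
              ENNReal.ofReal_mul' (Real.exp_pos _).le]
    calc ∫⁻ x in I, ((fun x => ENNReal.ofReal (p₀ x)) *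
          fun x => ENNReal.ofReal (p x) / ENNReal.ofReal (p₀ x) * e x) x
        ≤ ∫⁻ x in I, ENNReal.ofReal (p x) * e x := by
          refine lintegral_mono fun x => ?_
          simp only [Pi.mul_apply]
          rw [← mul_assoc]
          exact mul_le_mul_left ENNReal.mul_div_le _
      _ = (∫⁻ x in Icc δ y, ENNReal.ofReal (p x) * e x) +
          ∫⁻ x in Ioc y (1 - δ), ENNReal.ofReal (p x) * e x := by
          rw [hunion, lintegral_union measurableSet_Ioc hdisj]
      _ ≤ _ := by
          rw [ENNReal.ofReal_add (mul_nonneg hF0 (Real.exp_pos _).le)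
            (mul_nonneg (by linarith) (Real.exp_pos _).le)]
          refine add_le_add ?_ ?_
          · have := hint le_rfl hy.1 hy.2 measurableSet_Icc subset_rfl fun x hx =>
              stepFun_left hx
            rwa [cdfTrunc_left, sub_zero] at this
          · have := hint hy.1 hy.2 le_rfl measurableSet_Ioc Ioc_subset_Icc_self fun x hx =>
              stepFun_right hx
            rwa [hf.cdfTrunc_right hσ hδ hδ'] at this

end Law

/-- A two-valued test function that separates success probabilities. -/
lemma exists_exp_test {a κ : ℝ} (ha : a ∈ Icc (0 : ℝ) 1) (hκ : 0 < κ) (hκ1 : κ ≤ 1) :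
    ∃ u v ψ : ℝ, ψ < 1 ∧ 0 < a * u + (1 - a) * v ∧ ∀ b ∈ Icc (0 : ℝ) 1, a + κ ≤ b →
      b * Real.exp u + (1 - b) * Real.exp v ≤ ψ := by
  have hexp : ∀ z : ℝ, |z| ≤ 1 → Real.exp z ≤ 1 + z + z ^ 2 := fun z hz => by
    have := (abs_le.1 (Real.abs_exp_sub_one_sub_id_le hz)).2
    linarith
  set c := a + κ / 2 with hc
  have hc0 : 0 ≤ c := by linarith [ha.1]
  have hc1 : c ≤ 3 / 2 := by linarith [ha.2]
  -- The test is `κ / 9` times `c` minus the success indicator, with `c` midway between `a` and `a +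
  -- κ`. From `exp z ≤ 1 + z + z²`, the linear gain `κ² / 18` exceeds the quadratic loss `κ² / 36`.
  refine ⟨κ / 9 * (c - 1), κ / 9 * c, 1 - κ ^ 2 / 36, by nlinarith, ?_, fun b hb hab => ?_⟩
  · have : a * (κ / 9 * (c - 1)) + (1 - a) * (κ / 9 * c) = κ / 9 * (κ / 2) := by rw [hc]; ring
    rw [this]
    positivity
  · have e1 := hexp (κ / 9 * (c - 1)) (by rw [abs_le]; constructor <;> nlinarith)
    have e2 := hexp (κ / 9 * c) (by rw [abs_le]; constructor <;> nlinarith)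
    have q1 : (c - 1) ^ 2 ≤ 9 / 4 := by nlinarith
    have q2 : c ^ 2 ≤ 9 / 4 := by nlinarith
    have q3 : b * (c - 1) ^ 2 + (1 - b) * c ^ 2 ≤ 9 / 4 := by nlinarith [hb.1, hb.2]
    calc b * Real.exp (κ / 9 * (c - 1)) + (1 - b) * Real.exp (κ / 9 * c)
        ≤ b * (1 + κ / 9 * (c - 1) + (κ / 9 * (c - 1)) ^ 2) +
          (1 - b) * (1 + κ / 9 * c + (κ / 9 * c) ^ 2) := by
          have := hb.1
          have : 0 ≤ 1 - b := by linarith [hb.2]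
          gcongr
      _ = 1 + κ / 9 * (c - b) + κ ^ 2 / 81 * (b * (c - 1) ^ 2 + (1 - b) * c ^ 2) := by ring
      _ ≤ 1 + κ / 9 * (-κ / 2) + κ ^ 2 / 81 * (9 / 4) := by
          have : c - b ≤ -κ / 2 := by rw [hc]; linarith
          gcongr
      _ = 1 - κ ^ 2 / 36 := by ring

/-! ### Stability of the modified parameters -/

/-- Monotone functions that are close to a continuous function on a fine grid are uniformly
close. -/
lemma exists_grid {G : ℝ → ℝ} {a b : ℝ} (hG : ContinuousOn G (Icc a b)) {κ : ℝ}
    (hκ : 0 < κ) : ∃ S : Finset ℝ, (∀ y ∈ S, y ∈ Icc a b) ∧ ∀ F : ℝ → ℝ, MonotoneOn F (Icc a b) →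
      (∀ y ∈ S, |F y - G y| < κ) → ∀ x ∈ Icc a b, |F x - G x| < 2 * κ := by
  rcases lt_or_ge b a with hab | hab
  · exact ⟨∅, by simp, fun F _ _ x hx => absurd (hx.1.trans hx.2) (not_le.2 hab)⟩
  obtain ⟨ρ, hρ, hGρ⟩ := Metric.uniformContinuousOn_iff.1
    (isCompact_Icc.uniformContinuousOn_of_continuous hG) κ hκ
  set h := ρ / 2 with hh
  have h0 : 0 < h := by positivity
  let y : ℕ → ℝ := fun k => min (a + k * h) b
  have hy : ∀ k, y k ∈ Icc a b := fun k =>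
    ⟨le_min (by have : (0 : ℝ) ≤ k * h := by positivity
                linarith) hab, min_le_right _ _⟩
  -- Both grid neighbours of `x`, with indices `k` and `k + 1`, must be included for `k` up to the
  -- floor.
  refine ⟨(Finset.range (⌊(b - a) / h⌋₊ + 2)).image y, ?_, fun F hF hS x hx => ?_⟩
  · intro z hz
    obtain ⟨k, -, rfl⟩ := Finset.mem_image.1 hz
    exact hy k
  set k := ⌊(x - a) / h⌋₊ with hk
  have hk1 : (k : ℝ) * h ≤ x - a := by
    rw [← le_div_iff₀ h0]
    exact Nat.floor_le (div_nonneg (by linarith [hx.1]) h0.le)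
  have hk2 : x - a < (k + 1) * h := by
    rw [← div_lt_iff₀ h0]
    exact Nat.lt_floor_add_one _
  have hkN : k ≤ ⌊(b - a) / h⌋₊ :=
    Nat.floor_le_floor (div_le_div_of_nonneg_right (by linarith [hx.2]) h0.le)
  have hmem : ∀ j, j ≤ k + 1 → |F (y j) - G (y j)| < κ := fun j hj =>
    hS _ (Finset.mem_image_of_mem _ (Finset.mem_range.2 (by lia)))
  have y1 : y k ≤ x := (min_le_left _ _).trans (by linarith)
  have y2 : x ≤ y (k + 1) := le_min (by push_cast; linarith) hx.2
  have y1' : x - h < y k := by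
    refine lt_min ?_ (by linarith [hx.2])
    linarith
  have y2' : y (k + 1) ≤ x + h := by
    refine (min_le_left _ _).trans ?_
    push_cast
    linarith
  have g1 := hGρ (y k) (hy k) x hx (by rw [Real.dist_eq, abs_lt]; constructor <;> linarith)
  have g2 := hGρ (y (k + 1)) (hy _) x hx (by rw [Real.dist_eq, abs_lt]; constructor <;> linarith)
  rw [Real.dist_eq, abs_lt] at g1 g2
  have f1 := abs_lt.1 (hmem k (by lia))
  have f2 := abs_lt.1 (hmem (k + 1) le_rfl)
  have m1 := hF (hy k) hx y1
  have m2 := hF hx (hy (k + 1)) y2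
  rw [abs_lt]
  constructor <;> linarith [f1.1, f2.2, g1.1, g2.2]

/-- The parameters are continuous functions of the normal quantiles of `F` at `1/4`, `1/2`, `3/4`,
since the true quantile difference is `1 / σ₀ ≠ 0`. The transformation is affine in `PhiInv ∘ F`,
which is uniformly close to `h₀ = (f₀ - μ₀) / σ₀`. -/
lemma exists_transOf_close {f₀ : ℝ → ℝ} (hf₀ : StrictMonoOn f₀ (Ioo 0 1))
    (hf₀_loc : f₀ (1 / 2) = 0) (hf₀_scale : f₀ (3 / 4) - f₀ (1 / 4) = 1) {δ : ℝ} (hδ : 0 < δ)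
    (hδ' : δ < 1 / 4) (μ₀ : ℝ) {σ₀ : ℝ} (hσ₀ : 0 < σ₀) {ε : ℝ} (hε : 0 < ε) :
    ∃ κ : ℝ, 0 < κ ∧ ∀ F : ℝ → ℝ, (∀ x ∈ Icc δ (1 - δ), |F x - cdfX μ₀ σ₀ f₀ x| < κ) →
      |muOf F - μ₀| < ε ∧ |sigmaOf F - σ₀| < ε ∧
        supDist δ (transOf F) f₀ < ENNReal.ofReal ε := by
  have hI := Icc_subset_Ioo_zero_one hδ
  have hδ1 : δ ≤ 1 - δ := by linarith
  have m1 : (1 / 4 : ℝ) ∈ Icc δ (1 - δ) := ⟨by linarith, by linarith⟩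
  have m2 : (1 / 2 : ℝ) ∈ Icc δ (1 - δ) := ⟨by linarith, by linarith⟩
  have m3 : (3 / 4 : ℝ) ∈ Icc δ (1 - δ) := ⟨by linarith, by linarith⟩
  let h₀ : ℝ → ℝ := fun x => (f₀ x - μ₀) / σ₀
  have hrange : ∀ x ∈ Icc δ (1 - δ), h₀ x ∈ Icc (h₀ δ) (h₀ (1 - δ)) := by
    intro x hx
    have a1 := hf₀.monotoneOn (hI ⟨le_rfl, hδ1⟩) (hI hx) hx.1
    have a2 := hf₀.monotoneOn (hI hx) (hI ⟨hδ1, le_rfl⟩) hx.2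
    exact ⟨div_le_div_of_nonneg_right (by linarith) hσ₀.le,
      div_le_div_of_nonneg_right (by linarith) hσ₀.le⟩
  set B := |h₀ δ| + |h₀ (1 - δ)| with hB
  have hB0 : 0 ≤ B := by positivity
  have hBx : ∀ x ∈ Icc δ (1 - δ), |h₀ x| ≤ B := by
    intro x hx
    obtain ⟨a1, a2⟩ := hrange x hx
    rw [abs_le]
    constructor
    · linarith [neg_abs_le (h₀ δ), abs_nonneg (h₀ (1 - δ))]
    · linarith [le_abs_self (h₀ (1 - δ)), abs_nonneg (h₀ δ)]
  have hd : h₀ (3 / 4) - h₀ (1 / 4) = 1 / σ₀ := by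
    simp only [h₀]
    rw [← sub_div, sub_sub_sub_cancel_right, hf₀_scale]
  have hd0 : h₀ (3 / 4) - h₀ (1 / 4) ≠ 0 := by rw [hd]; positivity
  -- `B + 1` will bound `PhiInv ∘ F`, so the errors in `μ` and `σ` contribute at most `ε₁ (B + 2) =
  -- ε / 4` to the error in `f`.
  set ε₁ := ε / (4 * (B + 2)) with hε₁
  have hε₁0 : 0 < ε₁ := by positivity
  have hε₁ε : ε₁ < ε := by
    rw [hε₁, div_lt_iff₀ (by positivity)]
    nlinarith
  have hev : ∀ᶠ z : ℝ × ℝ × ℝ in 𝓝 (h₀ (1 / 4), h₀ (1 / 2), h₀ (3 / 4)),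
      |-(z.2.1 / (z.2.2 - z.1)) - μ₀| < ε₁ ∧ |1 / (z.2.2 - z.1) - σ₀| < ε₁ := by
    have c1 : ContinuousAt (fun z : ℝ × ℝ × ℝ => |-(z.2.1 / (z.2.2 - z.1)) - μ₀|)
        (h₀ (1 / 4), h₀ (1 / 2), h₀ (3 / 4)) := by
      refine ContinuousAt.abs (ContinuousAt.sub (ContinuousAt.neg (ContinuousAt.div ?_ ?_ hd0))
        continuousAt_const) <;> fun_prop
    have c2 : ContinuousAt (fun z : ℝ × ℝ × ℝ => |1 / (z.2.2 - z.1) - σ₀|)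
        (h₀ (1 / 4), h₀ (1 / 2), h₀ (3 / 4)) := by
      refine ContinuousAt.abs (ContinuousAt.sub (ContinuousAt.div continuousAt_const ?_ hd0)
        continuousAt_const)
      fun_prop
    refine (c1.eventually_lt_const ?_).and (c2.eventually_lt_const ?_)
    · simp only [hd, h₀]
      rw [hf₀_loc]
      have : -((0 - μ₀) / σ₀ / (1 / σ₀)) - μ₀ = 0 := by field_simp; ring
      rw [this, abs_zero]
      exact hε₁0
    · simp only [hd]
      rw [one_div_one_div, sub_self, abs_zero]
      exact hε₁0
  obtain ⟨ρ, hρ, hball⟩ := Metric.eventually_nhds_iff.1 hev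
  set ε₂ := min (ρ / 2) (min 1 (ε / (4 * σ₀))) with hε₂
  have hε₂0 : 0 < ε₂ := by positivity
  obtain ⟨κ, hκ, hPhi⟩ := exists_abs_PhiInv_sub_le (h₀ δ) (h₀ (1 - δ)) hε₂0
  refine ⟨κ, hκ, fun F hF => ?_⟩
  have hH : ∀ x ∈ Icc δ (1 - δ), |PhiInv (F x) - h₀ x| ≤ ε₂ := fun x hx =>
    hPhi _ (hrange x hx) _ (hF x hx)
  have hρ2 : ε₂ < ρ := (min_le_left _ _).trans_lt (by linarith)
  obtain ⟨hmu, hsig⟩ := @hball (PhiInv (F (1 / 4)), PhiInv (F (1 / 2)), PhiInv (F (3 / 4))) (by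
    simp only [Prod.dist_eq, Real.dist_eq]
    exact max_lt ((hH _ m1).trans_lt hρ2) (max_lt ((hH _ m2).trans_lt hρ2)
      ((hH _ m3).trans_lt hρ2)))
  change |muOf F - μ₀| < ε₁ at hmu
  change |sigmaOf F - σ₀| < ε₁ at hsig
  refine ⟨hmu.trans hε₁ε, hsig.trans hε₁ε, ?_⟩
  refine lt_of_le_of_lt (b := ENNReal.ofReal (ε / 2)) ?_
    ((ENNReal.ofReal_lt_ofReal_iff hε).2 (by linarith))
  refine iSup₂_le fun x hx => ENNReal.ofReal_le_ofReal ?_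
  have hx1 := hH x hx
  have e1 : ε₂ ≤ 1 := (min_le_right _ _).trans (min_le_left _ _)
  have e2 : σ₀ * ε₂ ≤ ε / 4 := by
    calc σ₀ * ε₂ ≤ σ₀ * (ε / (4 * σ₀)) := by
          gcongr
          exact (min_le_right _ _).trans (min_le_right _ _)
      _ = ε / 4 := by field_simp
  have e3 : |PhiInv (F x)| ≤ B + 1 := by
    have := abs_add_le (PhiInv (F x) - h₀ x) (h₀ x)
    rw [sub_add_cancel] at this
    linarith [hBx x hx]
  have e4 : transOf F x - f₀ x = (muOf F - μ₀) + (sigmaOf F - σ₀) * PhiInv (F x) +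
      σ₀ * (PhiInv (F x) - h₀ x) := by
    simp only [transOf, h₀]
    field_simp
    ring
  rw [e4]
  calc |(muOf F - μ₀) + (sigmaOf F - σ₀) * PhiInv (F x) + σ₀ * (PhiInv (F x) - h₀ x)|
      ≤ |muOf F - μ₀| + |sigmaOf F - σ₀| * |PhiInv (F x)| + σ₀ * |PhiInv (F x) - h₀ x| := by
        refine (abs_add_le _ _).trans (add_le_add ((abs_add_le _ _).trans ?_) ?_)
        · rw [abs_mul]
        · rw [abs_mul, abs_of_pos hσ₀]
    _ ≤ ε₁ + ε₁ * (B + 1) + σ₀ * ε₂ := by gcongr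
    _ = ε₁ * (B + 2) + σ₀ * ε₂ := by ring
    _ ≤ ε / 4 + ε / 4 := by
        refine add_le_add (le_of_eq ?_) e2
        rw [hε₁]
        field_simp
    _ = ε / 2 := by ring

/-- The errors in `π⁻`, `π⁺` and `F*` enter with coefficients of absolute value `1 - F*`, `F*` and
`F₀ (1 - δ) - F₀ δ`, all at most one. -/
lemma abs_cdfMod_sub_lt {δ : ℝ} {t : ℕ → ℕ → ℝ} {z : Param × (ℝ × ℝ)} {μ₀ σ₀ : ℝ}
    {f₀ : ℝ → ℝ} (hf₀ : IsTransform f₀) (hσ₀ : 0 < σ₀) (hδ : 0 < δ) (hδ' : δ < 1 / 4) {κ x : ℝ}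
    (h1 : |z.2.1 - cdfX μ₀ σ₀ f₀ δ| < κ) (h2 : |z.2.2 - (1 - cdfX μ₀ σ₀ f₀ (1 - δ))| < κ)
    (hF : cdfTrunc δ z.1.1.1 z.1.1.2 (toFun t z.1.2) x ∈ Icc (0 : ℝ) 1)
    (h3 : |cdfTrunc δ z.1.1.1 z.1.1.2 (toFun t z.1.2) x - cdfTrunc δ μ₀ σ₀ f₀ x| < κ) :
    |cdfMod δ t z x - cdfX μ₀ σ₀ f₀ x| < 4 * κ := by
  have hlt := sub_pos.2 (hf₀.cdfX_lt (μ := μ₀) hσ₀ hδ hδ')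
  have hle : cdfX μ₀ σ₀ f₀ (1 - δ) - cdfX μ₀ σ₀ f₀ δ ≤ 1 := by
    have e1 : cdfX μ₀ σ₀ f₀ (1 - δ) ≤ 1 := cdf_le_one _ _
    have e2 : 0 ≤ cdfX μ₀ σ₀ f₀ δ := cdf_nonneg _ _
    linarith
  have hG : cdfX μ₀ σ₀ f₀ x = cdfX μ₀ σ₀ f₀ δ +
      (cdfX μ₀ σ₀ f₀ (1 - δ) - cdfX μ₀ σ₀ f₀ δ) * cdfTrunc δ μ₀ σ₀ f₀ x := by
    rw [cdfTrunc, mul_div_cancel₀ _ hlt.ne']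
    ring
  rw [hG, cdfMod]
  generalize cdfTrunc δ z.1.1.1 z.1.1.2 (toFun t z.1.2) x = F at *
  generalize cdfTrunc δ μ₀ σ₀ f₀ x = F₀ at *
  generalize cdfX μ₀ σ₀ f₀ δ = a at *
  generalize cdfX μ₀ σ₀ f₀ (1 - δ) = b at *
  have e : z.2.1 + (1 - z.2.2 - z.2.1) * F - (a + (b - a) * F₀) =
      (1 - F) * (z.2.1 - a) + -(F * (z.2.2 - (1 - b))) + (b - a) * (F - F₀) := by ring
  rw [e]
  calc |(1 - F) * (z.2.1 - a) + -(F * (z.2.2 - (1 - b))) + (b - a) * (F - F₀)|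
      ≤ |1 - F| * |z.2.1 - a| + |F| * |z.2.2 - (1 - b)| + |b - a| * |F - F₀| := by
        rw [← abs_mul, ← abs_mul, ← abs_mul, ← abs_neg (F * (z.2.2 - (1 - b)))]
        exact (abs_add_le _ _).trans (add_le_add_left (abs_add_le _ _) _)
    _ ≤ 1 * |z.2.1 - a| + 1 * |z.2.2 - (1 - b)| + 1 * |F - F₀| := by
        rw [abs_of_nonneg (by linarith [hF.2] : 0 ≤ 1 - F), abs_of_nonneg hF.1,
          abs_of_pos hlt]
        have := hF.1
        have := hF.2
        gcongr
        linarith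
    _ < 4 * κ := by
        have := abs_nonneg (F - F₀)
        linarith

/-! ### Densities close to the truth -/

/-- Perturbation of the true transformation to one with a positive derivative. -/
lemma IsTransform.exists_perturbation {f₀ : ℝ → ℝ} (hf₀ : IsTransform f₀)
    (hf₀_loc : f₀ (1 / 2) = 0) (hf₀_scale : f₀ (3 / 4) - f₀ (1 / 4) = 1) {δ : ℝ} (hδ : 0 < δ)
    {ε : ℝ} (hε : 0 < ε) :
    ∃ G g : ℝ → ℝ, (∀ x ∈ Ioo (0 : ℝ) 1, HasDerivAt G (g x) x) ∧ ContinuousOn g (Ioo 0 1) ∧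
      (∀ x ∈ Ioo (0 : ℝ) 1, 0 < g x) ∧ G (1 / 2) = 0 ∧ G (3 / 4) - G (1 / 4) = 1 ∧
      (∀ x ∈ Icc δ (1 - δ), |G x - f₀ x| < ε ∧ |g x - deriv f₀ x| < ε) ∧
      ∃ c > 0, ∀ x ∈ Icc δ (1 - δ), (1 - ε) * deriv f₀ x + c ≤ g x := by
  have hI := Icc_subset_Ioo_zero_one hδ
  obtain ⟨B₁, hB₁⟩ := (isCompact_Icc (a := δ) (b := 1 - δ)).exists_bound_of_continuousOn
    (hf₀.continuousOn.mono hI)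
  obtain ⟨B₂, hB₂⟩ := (isCompact_Icc (a := δ) (b := 1 - δ)).exists_bound_of_continuousOn
    (hf₀.cont.mono hI)
  set B := |B₁| + |B₂| with hB
  have hB0 : 0 ≤ B := by positivity
  set η := ε / (2 * (1 + B)) with hη
  have hη0 : 0 < η := by positivity
  have hηB : η * (1 + B) < ε := by
    have : η * (1 + B) = ε / 2 := by rw [hη]; field_simp
    linarith
  have hηε : η ≤ ε := by nlinarith
  have hη1 : 0 < 1 + η / 2 := by positivity
  have hdiv : ∀ {a b : ℝ}, |a| ≤ 1 → |b| ≤ B → |(b + η * a) / (1 + η / 2) - b| < ε := by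
    intro a b ha hb
    have e1 : (b + η * a) / (1 + η / 2) - b = η * (a - b / 2) / (1 + η / 2) := by field_simp; ring
    rw [e1, abs_div, abs_of_pos hη1, div_lt_iff₀ hη1, abs_mul, abs_of_pos hη0]
    have e2 : |a - b / 2| ≤ 1 + B := by
      rw [abs_le] at ha hb ⊢
      constructor <;> linarith [ha.1, ha.2, hb.1, hb.2]
    calc η * |a - b / 2| ≤ η * (1 + B) := by gcongr
      _ < ε := hηB
      _ ≤ ε * (1 + η / 2) := by nlinarith
  -- The linear term vanishes at `1/2` and adds `η / 2` to the increment over `[1/4, 3/4]`, which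
  -- the division undoes. Its slope yields the constant `c`, needed where `deriv f₀` vanishes.
  refine ⟨fun x => (f₀ x + η * (x - 1 / 2)) / (1 + η / 2),
    fun x => (deriv f₀ x + η * 1) / (1 + η / 2), fun x hx => ?_, ?_, fun x hx => ?_, ?_, ?_,
    fun x hx => ⟨?_, ?_⟩, η / (1 + η / 2), by positivity, fun x hx => ?_⟩
  · exact ((hf₀.diff x hx).hasDerivAt.add
      (((hasDerivAt_id x).sub_const _).const_mul η)).div_const _
  · have := hf₀.cont
    fun_prop
  · have := hf₀.deriv_nonneg hx
    positivity
  · simp only [hf₀_loc, sub_self, mul_zero, add_zero, zero_div]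
  · rw [← sub_div, div_eq_one_iff_eq hη1.ne']
    linarith
  · refine hdiv (by rw [abs_le]; constructor <;> linarith [hx.1, hx.2]) ?_
    exact (hB₁ x hx).trans ((le_abs_self _).trans (by rw [hB]; linarith [abs_nonneg B₂]))
  · refine hdiv (by simp) ?_
    exact (hB₂ x hx).trans ((le_abs_self _).trans (by rw [hB]; linarith [abs_nonneg B₁]))
  · have h1 := hf₀.deriv_nonneg (hI hx)
    simp only
    rw [mul_one, add_div]
    gcongr
    rw [le_div_iff₀ hη1]
    have h2 : (1 - ε) * (1 + η / 2) ≤ 1 := by nlinarith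
    nlinarith

/-- If `μ, σ` and `f` are close to the truth and `f'` is not much smaller than `f₀'`, then the
density is not much smaller than the true density. -/
lemma IsTransform.exists_densTrunc_ge {f₀ : ℝ → ℝ} (hf₀ : IsTransform f₀) {δ : ℝ} (hδ : 0 < δ)
    (hδ' : δ < 1 / 4) (μ₀ : ℝ) {σ₀ : ℝ} (hσ₀ : 0 < σ₀) {q : ℝ} (hq0 : 0 < q) (hq : q < 1) :
    ∃ ρ > 0, ∀ (μ σ : ℝ) (f : ℝ → ℝ) (d : ℝ → ℝ), |μ - μ₀| < ρ → |σ - σ₀| < ρ →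
      (∀ x ∈ Icc δ (1 - δ), |f x - f₀ x| < ρ) →
      ∀ x ∈ Icc δ (1 - δ), q * deriv f₀ x < d x → 0 < d x * (gaussianPDFReal 0 1
        ((f x - μ) / σ) / σ) / (cdfX μ σ f (1 - δ) - cdfX μ σ f δ) ∧
        q * q * densTrunc δ μ₀ σ₀ f₀ x ≤ d x * (gaussianPDFReal 0 1 ((f x - μ) / σ) / σ) /
          (cdfX μ σ f (1 - δ) - cdfX μ σ f δ) := by
  have hI := Icc_subset_Ioo_zero_one hδ
  have hδ1 : δ ≤ 1 - δ := by linarith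
  have hlt := sub_pos.2 (hf₀.cdfX_lt (μ := μ₀) hσ₀ hδ hδ')
  -- `K` is the density without the factor `f'`, as a function of `u = f₀ x` and of `μ`, `σ` and the
  -- errors of `f` at `x`, `1 - δ` and `δ`. With finitely many variables, continuity and compactness
  -- of the range of `u` give a uniform neighbourhood.
  let K : ℝ × ℝ × ℝ × ℝ × ℝ → ℝ → ℝ := fun w u =>
    gaussianPDFReal 0 1 ((u + w.2.2.1 - w.1) / w.2.1) / w.2.1 /
      (Phi ((f₀ (1 - δ) + w.2.2.2.1 - w.1) / w.2.1) - Phi ((f₀ δ + w.2.2.2.2 - w.1) / w.2.1))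
  have hK0 : ∀ u, 0 < K (μ₀, σ₀, 0, 0, 0) u := by
    intro u
    have := gaussianPDFReal_pos 0 1 ((u + 0 - μ₀) / σ₀) one_ne_zero
    simp only [cdfX] at hlt
    simp only [K, add_zero] at this ⊢
    positivity
  have hKc : ∀ u, ContinuousAt (fun z : (ℝ × ℝ × ℝ × ℝ × ℝ) × ℝ => K z.1 z.2)
      ((μ₀, σ₀, 0, 0, 0), u) := by
    intro u
    have hP := continuous_Phi
    have hg := continuous_gaussianPDFReal 0 1
    refine ContinuousAt.div (ContinuousAt.div ?_ (by fun_prop) hσ₀.ne') (ContinuousAt.sub ?_ ?_) ?_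
    · exact hg.continuousAt.comp (ContinuousAt.div (by fun_prop) (by fun_prop) hσ₀.ne')
    · exact hP.continuousAt.comp (ContinuousAt.div (by fun_prop) (by fun_prop) hσ₀.ne')
    · exact hP.continuousAt.comp (ContinuousAt.div (by fun_prop) (by fun_prop) hσ₀.ne')
    · simp only [cdfX] at hlt
      simpa only [add_zero] using hlt.ne'
  have hev : ∀ᶠ w in 𝓝 ((μ₀, σ₀, 0, 0, 0) : ℝ × ℝ × ℝ × ℝ × ℝ), ∀ u ∈ f₀ '' Icc δ (1 - δ),
      q * K (μ₀, σ₀, 0, 0, 0) u < K w u := by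
    refine (isCompact_Icc.image_of_continuousOn
      (hf₀.continuousOn.mono hI)).eventually_forall_of_forall_eventually fun u _ => ?_
    have c0 : ContinuousAt (fun z : (ℝ × ℝ × ℝ × ℝ × ℝ) × ℝ => q * K (μ₀, σ₀, 0, 0, 0) z.2)
        ((μ₀, σ₀, 0, 0, 0), u) := by
      refine continuousAt_const.mul ?_
      exact ContinuousAt.comp (f := fun z : (ℝ × ℝ × ℝ × ℝ × ℝ) × ℝ =>
        (((μ₀, σ₀, 0, 0, 0) : ℝ × ℝ × ℝ × ℝ × ℝ), z.2)) (x := ((μ₀, σ₀, 0, 0, 0), u))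
        (hKc u) (by fun_prop)
    refine (c0.eventually_lt (hKc u) ?_)
    exact mul_lt_of_lt_one_left (hK0 u) hq
  obtain ⟨ρ, hρ, hball⟩ := Metric.eventually_nhds_iff.1 hev
  refine ⟨ρ, hρ, fun μ σ f d hμ hσ hf x hx hd => ?_⟩
  have hKx : ∃ w : ℝ × ℝ × ℝ × ℝ × ℝ, q * K (μ₀, σ₀, 0, 0, 0) (f₀ x) < K w (f₀ x) ∧
      K w (f₀ x) = gaussianPDFReal 0 1 ((f x - μ) / σ) / σ /
        (cdfX μ σ f (1 - δ) - cdfX μ σ f δ) := by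
    refine ⟨(μ, σ, f x - f₀ x, f (1 - δ) - f₀ (1 - δ), f δ - f₀ δ),
      hball ?_ _ (mem_image_of_mem _ hx), ?_⟩
    · simp only [Prod.dist_eq, Real.dist_eq, sub_zero]
      exact max_lt hμ (max_lt hσ (max_lt (hf x hx) (max_lt (hf _ ⟨hδ1, le_rfl⟩)
        (hf _ ⟨le_rfl, hδ1⟩))))
    · simp only [K, cdfX, add_sub_cancel]
  obtain ⟨w, hw1, hw2⟩ := hKx
  have h0 := hf₀.deriv_nonneg (hI hx)
  have hKp : 0 < K w (f₀ x) := (mul_pos hq0 (hK0 _)).trans hw1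
  have hdp : 0 < d x := (mul_nonneg hq0.le h0).trans_lt hd
  rw [mul_div_assoc, ← hw2]
  refine ⟨mul_pos hdp hKp, ?_⟩
  have hden : densTrunc δ μ₀ σ₀ f₀ x = deriv f₀ x * K (μ₀, σ₀, 0, 0, 0) (f₀ x) := by
    simp only [densTrunc, K, cdfX, add_zero]
    rw [mul_div_assoc]
  rw [hden]
  calc q * q * (deriv f₀ x * K (μ₀, σ₀, 0, 0, 0) (f₀ x))
      = (q * deriv f₀ x) * (q * K (μ₀, σ₀, 0, 0, 0) (f₀ x)) := by ring
    _ ≤ d x * K w (f₀ x) := by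
      have := (hK0 (f₀ x)).le
      gcongr

/-! ### Measurability -/

lemma measurable_sigma {α : Type*} {β : α → Type*} [∀ a, MeasurableSpace (β a)] {γ : Type*}
    [MeasurableSpace γ] {f : Sigma β → γ} (h : ∀ a, Measurable fun b => f ⟨a, b⟩) :
    Measurable f := fun _ hs => MeasurableSpace.measurableSet_iInf.2 fun a => h a hs

/-- Padding the coefficients with zeros embeds all dimensions into one sequence space, after which
`J` ranges over a countable set. -/
lemma measurable_sum_coeff {b : ℕ → ℕ → ℝ → ℝ} (hb : ∀ J j, Measurable (b J j)) :
    Measurable fun z : SplineParam × ℝ => ∑ j : Fin z.1.1, z.1.2 j * b z.1.1 j z.2 := by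
  let e : SplineParam → ℕ × (ℕ → ℝ) := fun q =>
    (q.1, fun j => if h : j < q.1 then q.2 ⟨j, h⟩ else 0)
  have he : Measurable e := by
    refine measurable_sigma fun J => measurable_const.prodMk (measurable_pi_lambda _ fun j => ?_)
    by_cases h : j < J
    · simp only [h, dite_true]
      exact (measurable_pi_apply (⟨j, h⟩ : Fin J)).comp (WithLp.measurable_ofLp 2 (Fin J → ℝ))
    · simp only [h, dite_false]
      exact measurable_const
  have hg : Measurable fun z : ℕ × (ℕ → ℝ) × ℝ =>
      ∑ j ∈ Finset.range z.1, z.2.1 j * b z.1 j z.2.2 := by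
    refine measurable_from_prod_countable_right fun J => ?_
    simp only
    refine Finset.measurable_sum _ fun j _ => ?_
    have := hb J j
    fun_prop
  have hc : Measurable fun z : SplineParam × ℝ => ((e z.1).1, (e z.1).2, z.2) := by fun_prop
  convert! hg.comp hc using 1
  ext ⟨⟨J, θ⟩, x⟩
  simp only [Function.comp_apply, e]
  rw [Finset.sum_range]
  refine Finset.sum_congr rfl fun j _ => ?_
  rw [dif_pos j.2]

lemma measurable_toFun (t : ℕ → ℕ → ℝ) :
    Measurable fun z : SplineParam × ℝ => toFun t z.1 z.2 :=
  measurable_sum_coeff (b := fun J j => bspline (t J) 3 j) fun _ _ => measurable_bspline _ _ _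

lemma measurable_dspline (t : ℕ → ℕ → ℝ) :
    Measurable fun z : SplineParam × ℝ => dspline (t z.1.1) z.1.2 z.2 :=
  measurable_sum_coeff (b := fun J j => dbspline (t J) 2 j) fun _ _ => measurable_dbspline _ _ _

/-- The density of `F*` for a spline, with an explicit formula for the derivative. -/
def splineDens (δ : ℝ) (t : ℕ → ℕ → ℝ) (η : Param) (x : ℝ) : ℝ :=
  dspline (t η.2.1) η.2.2 x * (gaussianPDFReal 0 1 ((toFun t η.2 x - η.1.1) / η.1.2) / η.1.2) /
    (cdfX η.1.1 η.1.2 (toFun t η.2) (1 - δ) - cdfX η.1.1 η.1.2 (toFun t η.2) δ)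

lemma measurable_cdfX (t : ℕ → ℕ → ℝ) (x : ℝ) :
    Measurable fun η : Param => cdfX η.1.1 η.1.2 (toFun t η.2) x := by
  have h1 : Measurable fun η : Param => toFun t η.2 x :=
    (measurable_toFun t).comp (measurable_snd.prodMk measurable_const)
  refine continuous_Phi.measurable.comp ?_
  fun_prop

lemma measurable_cdfTrunc (δ : ℝ) (t : ℕ → ℕ → ℝ) (x : ℝ) :
    Measurable fun η : Param => cdfTrunc δ η.1.1 η.1.2 (toFun t η.2) x := by
  have h := measurable_cdfX t
  exact ((h x).sub (h δ)).div ((h (1 - δ)).sub (h δ))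

/-- Joint measurability in the parameter and the point is what the explicit `dspline`, in place of
`deriv`, provides. -/
lemma measurable_splineDens (δ : ℝ) (t : ℕ → ℕ → ℝ) :
    Measurable fun z : Param × ℝ => splineDens δ t z.1 z.2 := by
  have h1 : Measurable fun z : Param × ℝ => toFun t z.1.2 z.2 :=
    (measurable_toFun t).comp ((measurable_snd.comp measurable_fst).prodMk measurable_snd)
  have h2 : Measurable fun z : Param × ℝ => dspline (t z.1.2.1) z.1.2.2 z.2 :=
    (measurable_dspline t).comp ((measurable_snd.comp measurable_fst).prodMk measurable_snd)
  have h3 : ∀ x, Measurable fun z : Param × ℝ => cdfX z.1.1.1 z.1.1.2 (toFun t z.1.2) x :=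
    fun x => (measurable_cdfX t x).comp measurable_fst
  have h4 : Measurable fun z : Param × ℝ =>
      gaussianPDFReal 0 1 ((toFun t z.1.2 z.2 - z.1.1.1) / z.1.1.2) :=
    (measurable_gaussianPDFReal 0 1).comp (by fun_prop)
  exact ((h2.mul (h4.div (by fun_prop))).div ((h3 _).sub (h3 _)))

lemma measurable_densRatio {δ : ℝ} {p₀ : ℝ → ℝ} (h₀ : Measurable p₀) (t : ℕ → ℕ → ℝ) :
    Measurable (Function.uncurry fun η : Param => densRatio δ p₀ (splineDens δ t η)) := by
  have h := measurable_splineDens δ t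
  refine Measurable.ite (measurable_snd measurableSet_Icc) ?_ measurable_const
  have h1 : Measurable fun z : Param × ℝ => p₀ z.2 := h₀.comp measurable_snd
  have h2 : Measurable fun z : Param × ℝ => ENNReal.ofReal (splineDens δ t z.1 z.2) :=
    h.ennreal_ofReal
  exact h2.div h1.ennreal_ofReal

/-! ### The prior on splines -/

section Prior

variable {t : ℕ → ℕ → ℝ} {ζ : ∀ J : ℕ, Fin J → ℝ} {s : ℝ} {π : PMF ℕ}

lemma measurableSet_increasing (J : ℕ) :
    MeasurableSet {θ : EuclideanSpace ℝ (Fin J) | ∀ i j : Fin J, i < j → θ i < θ j} := by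
  simp only [ofPred_forall]
  refine MeasurableSet.iInter fun i => MeasurableSet.iInter fun j => MeasurableSet.iInter fun _ =>
    measurableSet_lt ?_ ?_ <;> fun_prop

instance isFiniteMeasure_splinePrior : IsFiniteMeasure (splinePrior t ζ s π) := by
  refine ⟨?_⟩
  rw [splinePrior, Measure.sum_apply _ MeasurableSet.univ]
  refine lt_of_le_of_lt (b := ∑' J, π J) (ENNReal.tsum_le_tsum fun J => ?_) ?_
  · rw [Measure.smul_apply, Measure.map_apply (measurable_sigma_mk J) MeasurableSet.univ,
      smul_eq_mul]
    refine mul_le_of_le_one_right zero_le ?_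
    rw [coeffPrior]
    exact prob_le_one
  · rw [π.tsum_coe]
    exact ENNReal.one_lt_top

lemma ae_splinePrior (hπ : ∀ J ∈ π.support, 4 ≤ J) :
    ∀ᵐ q ∂splinePrior t ζ s π, 4 ≤ q.1 ∧ ∀ i j : Fin q.1, i < j → q.2 i < q.2 j := by
  rw [splinePrior, Measure.ae_sum_iff]
  intro J
  by_cases hJ : π J = 0
  · simp [hJ]
  · refine Measure.ae_smul_measure ?_ _
    have hJ4 := hπ J hJ
    have hm : MeasurableSet
        {q : SplineParam | 4 ≤ q.1 ∧ ∀ i j : Fin q.1, i < j → q.2 i < q.2 j} := by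
      refine MeasurableSpace.measurableSet_iInf.2 fun K => ?_
      exact (MeasurableSet.const (4 ≤ K)).inter (measurableSet_increasing K)
    rw [ae_map_iff (measurable_sigma_mk J).aemeasurable hm]
    filter_upwards [ae_cond_mem (measurableSet_increasing J)] with θ hθ
    exact ⟨hJ4, hθ⟩

lemma isTransform_toFun (ht : ∀ J, 4 ≤ J → IsCubicKnots J (t J)) {q : SplineParam}
    (hq : 4 ≤ q.1) (hθ : ∀ i j : Fin q.1, i < j → q.2 i < q.2 j) : IsTransform (toFun t q) :=
  ⟨fun _ hx => ((ht _ hq).hasDerivAt_spline _ hx).differentiableAt,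
    ((ht _ hq).continuousOn_dspline _).congr fun _ hx =>
      ((ht _ hq).hasDerivAt_spline _ hx).deriv,
    (ht _ hq).strictMonoOn_spline hq hθ⟩

lemma splineDens_eq (ht : ∀ J, 4 ≤ J → IsCubicKnots J (t J)) {η : Param} (hq : 4 ≤ η.2.1)
    {δ x : ℝ} (hx : x ∈ Ioo (0 : ℝ) 1) :
    splineDens δ t η x = densTrunc δ η.1.1 η.1.2 (toFun t η.2) x := by
  have h : deriv (toFun t η.2) x = dspline (t η.2.1) η.2.2 x :=
    ((ht _ hq).hasDerivAt_spline _ hx).deriv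
  rw [splineDens, densTrunc, h]

end Prior

/-! ### The posterior distribution -/

section Posterior

variable {δ : ℝ} {t : ℕ → ℕ → ℝ} {Q : Measure Param} {p₀ : ℝ → ℝ}

/-- The likelihood of the truth. -/
def trueLik (δ : ℝ) (p₀ : ℝ → ℝ) (n : ℕ) (x : ℕ → ℝ) : ℝ≥0∞ :=
  ∏ i ∈ Finset.range n with x i ∈ Icc δ (1 - δ), ENNReal.ofReal (p₀ (x i))

lemma trueLik_ne_zero {n : ℕ} {x : ℕ → ℝ} (hx : ∀ i, x i ∈ Icc δ (1 - δ) → 0 < p₀ (x i)) :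
    trueLik δ p₀ n x ≠ 0 :=
  Finset.prod_ne_zero_iff.2 fun i hi =>
    (ENNReal.ofReal_pos.2 (hx i (Finset.mem_filter.1 hi).2)).ne'

lemma trueLik_ne_top {n : ℕ} {x : ℕ → ℝ} : trueLik δ p₀ n x ≠ ∞ :=
  ENNReal.prod_ne_top fun _ _ => ENNReal.ofReal_ne_top

lemma likelihood_eq {n : ℕ} {x : ℕ → ℝ} (hx : ∀ i, x i ∈ Icc δ (1 - δ) → 0 < p₀ (x i))
    {η : Param} (hη : ∀ x ∈ Icc δ (1 - δ),
      splineDens δ t η x = densTrunc δ η.1.1 η.1.2 (toFun t η.2) x) :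
    likelihood δ t n x η = trueLik δ p₀ n x *
      ∏ i ∈ Finset.range n, densRatio δ p₀ (splineDens δ t η) (x i) := by
  have h : ∏ i ∈ Finset.range n, densRatio δ p₀ (splineDens δ t η) (x i) =
      ∏ i ∈ Finset.range n with x i ∈ Icc δ (1 - δ),
        ENNReal.ofReal (splineDens δ t η (x i)) / ENNReal.ofReal (p₀ (x i)) := by
    rw [Finset.prod_filter]
    refine Finset.prod_congr rfl fun i _ => ?_
    simp only [densRatio]
  rw [h, likelihood, trueLik, ← Finset.prod_mul_distrib]
  refine Finset.prod_congr rfl fun i hi => ?_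
  have hi' := (Finset.mem_filter.1 hi).2
  rw [ENNReal.mul_div_cancel (ENNReal.ofReal_pos.2 (hx i hi')).ne' ENNReal.ofReal_ne_top, hη _ hi']

lemma setLIntegral_likelihood (hQ : ∀ᵐ η ∂Q, ∀ x ∈ Icc δ (1 - δ),
    splineDens δ t η x = densTrunc δ η.1.1 η.1.2 (toFun t η.2) x) (hp₀ : Measurable p₀) {n : ℕ}
    {x : ℕ → ℝ} (hx : ∀ i, x i ∈ Icc δ (1 - δ) → 0 < p₀ (x i)) (U : Set Param) :
    ∫⁻ η in U, likelihood δ t n x η ∂Q = trueLik δ p₀ n x *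
      intLik Q (fun η => densRatio δ p₀ (splineDens δ t η)) U n x := by
  rw [intLik, ← lintegral_const_mul]
  · refine lintegral_congr_ae ?_
    filter_upwards [ae_restrict_of_ae hQ] with η hη using likelihood_eq hx hη
  · exact Finset.measurable_prod _ fun i _ =>
      (measurable_densRatio hp₀ t).comp measurable_prodMk_right

lemma evidence_eq (hQ : ∀ᵐ η ∂Q, ∀ x ∈ Icc δ (1 - δ),
    splineDens δ t η x = densTrunc δ η.1.1 η.1.2 (toFun t η.2) x) (hp₀ : Measurable p₀) {n : ℕ}
    {x : ℕ → ℝ} (hx : ∀ i, x i ∈ Icc δ (1 - δ) → 0 < p₀ (x i)) :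
    evidence δ t Q n x = trueLik δ p₀ n x *
      intLik Q (fun η => densRatio δ p₀ (splineDens δ t η)) univ n x := by
  rw [← setLIntegral_likelihood hQ hp₀ hx, Measure.restrict_univ, evidence]

/-- The likelihood of the truth cancels in Bayes' formula. `U` need not be measurable, as `Q` is
s-finite. -/
lemma truncPosterior_apply [SFinite Q] (hQ : ∀ᵐ η ∂Q, ∀ x ∈ Icc δ (1 - δ),
    splineDens δ t η x = densTrunc δ η.1.1 η.1.2 (toFun t η.2) x) (hp₀ : Measurable p₀) {n : ℕ}
    {x : ℕ → ℝ} (hx : ∀ i, x i ∈ Icc δ (1 - δ) → 0 < p₀ (x i)) (U : Set Param) :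
    truncPosterior δ t Q n x U =
      intLik Q (fun η => densRatio δ p₀ (splineDens δ t η)) U n x /
        intLik Q (fun η => densRatio δ p₀ (splineDens δ t η)) univ n x := by
  rw [truncPosterior, Measure.smul_apply, withDensity_apply' _ U, setLIntegral_likelihood hQ hp₀ hx,
    evidence_eq hQ hp₀ hx, smul_eq_mul, mul_comm, ← div_eq_mul_inv,
    ENNReal.mul_div_mul_left _ _ (trueLik_ne_zero hx) trueLik_ne_top]

lemma truncPosterior_univ_le (n : ℕ) (x : ℕ → ℝ) : truncPosterior δ t Q n x univ ≤ 1 := by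
  rw [truncPosterior, Measure.smul_apply, withDensity_apply _ MeasurableSet.univ,
    Measure.restrict_univ, smul_eq_mul]
  exact ENNReal.inv_mul_le_one _

lemma countPosterior_univ_le (ρ : Measure (ℝ × ℝ)) (n : ℕ) (x : ℕ → ℝ) :
    countPosterior δ ρ n x univ ≤ 1 := by
  rw [countPosterior, Measure.smul_apply, withDensity_apply _ MeasurableSet.univ,
    Measure.restrict_univ, smul_eq_mul]
  exact ENNReal.inv_mul_le_one _

instance sFinite_countPosterior (ρ : Measure (ℝ × ℝ)) [SFinite ρ] (n : ℕ) (x : ℕ → ℝ) :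
    SFinite (countPosterior δ ρ n x) := by
  unfold countPosterior
  infer_instance

end Posterior

/-- The parameters of the posterior for which the model is regular. -/
def IsRegular (t : ℕ → ℕ → ℝ) (η : Param) : Prop :=
  0 < η.1.2 ∧ 4 ≤ η.2.1 ∧ IsTransform (toFun t η.2)

lemma IsRegular.splineDens_eq {t : ℕ → ℕ → ℝ} (ht : ∀ J, 4 ≤ J → IsCubicKnots J (t J))
    {η : Param} (h : IsRegular t η) {δ : ℝ} (hδ : 0 < δ) : ∀ x ∈ Icc δ (1 - δ),
      splineDens δ t η x = densTrunc δ η.1.1 η.1.2 (toFun t η.2) x := fun _ hx =>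
  Nonparanormal.splineDens_eq ht h.2.1 (Icc_subset_Ioo_zero_one hδ hx)

lemma ae_isRegular {t : ℕ → ℕ → ℝ} (ht : ∀ J, 4 ≤ J → IsCubicKnots J (t J))
    {ζ : ∀ J : ℕ, Fin J → ℝ} {s : ℝ} {π : PMF ℕ} (hπ : ∀ J ∈ π.support, 4 ≤ J)
    {M : Measure (ℝ × ℝ)} [SFinite M] (hM : ∀ᵐ p ∂M, 0 < p.2) :
    ∀ᵐ η ∂M.prod (splinePrior t ζ s π), IsRegular t η := by
  filter_upwards [Measure.quasiMeasurePreserving_fst.ae hM,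
    Measure.quasiMeasurePreserving_snd.ae (ae_splinePrior hπ)] with η h1 h2
  exact ⟨h1, h2.1, isTransform_toFun ht h2.1 h2.2⟩

section Consistency

variable {f₀ : ℝ → ℝ} {δ μ₀ σ₀ : ℝ} {t : ℕ → ℕ → ℝ} {ζ : ∀ J : ℕ, Fin J → ℝ} {s : ℝ} {π : PMF ℕ}
  {M : Measure (ℝ × ℝ)}

/-- The density of the truth on `[δ, 1 - δ]`, extended by zero. -/
def trueDens (δ μ₀ σ₀ : ℝ) (f₀ : ℝ → ℝ) : ℝ → ℝ :=
  (Icc δ (1 - δ)).indicator (densTrunc δ μ₀ σ₀ f₀)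

lemma trueDens_eq {x : ℝ} (hx : x ∈ Icc δ (1 - δ)) :
    trueDens δ μ₀ σ₀ f₀ x = densTrunc δ μ₀ σ₀ f₀ x := indicator_of_mem hx _

lemma measurable_trueDens (hf₀ : IsTransform f₀) (hδ : 0 < δ) :
    Measurable (trueDens δ μ₀ σ₀ f₀) := by
  classical
  rw [trueDens, ← Set.piecewise_eq_indicator]
  exact (hf₀.continuousOn_densTrunc.mono (Icc_subset_Ioo_zero_one hδ)).measurable_piecewise
    continuousOn_const measurableSet_Icc

/-- The true density may have zeros, but almost surely no observation hits them, so division by it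
is harmless. -/
lemma IsLaw.ae_trueDens_pos {ν : Measure ℝ} [IsProbabilityMeasure ν] (h : IsLaw μ₀ σ₀ f₀ ν)
    (hf₀ : IsTransform f₀) (hσ₀ : 0 < σ₀) (hδ : 0 < δ) (hδ' : δ < 1 / 4) :
    ∀ᵐ x ∂ν, x ∈ Icc δ (1 - δ) → 0 < trueDens δ μ₀ σ₀ f₀ x := by
  rw [← ae_restrict_iff' measurableSet_Icc, h.restrict_eq hf₀ hσ₀ hδ hδ']
  refine Measure.ae_smul_measure ?_ _
  have hw : (volume.restrict (Icc δ (1 - δ))).withDensity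
      (fun x => ENNReal.ofReal (densTrunc δ μ₀ σ₀ f₀ x)) =
      (volume.restrict (Icc δ (1 - δ))).withDensity
        fun x => ENNReal.ofReal (trueDens δ μ₀ σ₀ f₀ x) := by
    refine withDensity_congr_ae ((ae_restrict_iff' measurableSet_Icc).2
      (Eventually.of_forall fun x hx => ?_))
    simp only [trueDens_eq hx]
  rw [hw, ae_withDensity_iff (measurable_trueDens hf₀ hδ).ennreal_ofReal]
  refine Eventually.of_forall fun x hx => ?_
  by_contra! h'
  exact hx (ENNReal.ofReal_of_nonpos h')

/-- The prior charges the parameters for which the likelihood ratio is bounded below by `r < 1`. -/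
lemma prior_densRatio_ge_ne_zero (hf₀ : IsTransform f₀) (hf₀_loc : f₀ (1 / 2) = 0)
    (hf₀_scale : f₀ (3 / 4) - f₀ (1 / 4) = 1) (hδ : 0 < δ) (hδ' : δ < 1 / 4)
    (ht : ∀ J, 4 ≤ J → IsCubicKnots J (t J))
    (ht_mesh : ∀ h : ℝ, 0 < h → ∃ N : ℕ, ∀ J, N ≤ J → ∀ i, 3 ≤ i → i < J →
      t J (i + 1) - t J i < h) (hs : 0 < s) (hπ_inf : π.support.Infinite) (hσ₀ : 0 < σ₀)
    [SFinite M] (hM : (μ₀, σ₀) ∈ M.support) {r : ℝ≥0∞} (hr : r < 1) :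
    M.prod (splinePrior t ζ s π)
      {η | ∀ x, r ≤ densRatio δ (trueDens δ μ₀ σ₀ f₀) (splineDens δ t η) x} ≠ 0 := by
  obtain ⟨r', rfl⟩ : ∃ r' : ℝ≥0, r = r' := ⟨r.toNNReal, (ENNReal.coe_toNNReal (hr.trans_le
    le_top).ne).symm⟩
  have hr1 : (r' : ℝ) < 1 := by exact_mod_cast hr
  have hr0 : 0 ≤ (r' : ℝ) := r'.2
  -- One factor `q` is spent on the derivative and one on the rest of the density; `r' ≤ q * q` by
  -- the inequality of arithmetic and geometric means.
  set q : ℝ := (1 + r') / 2 with hq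
  have hq0 : 0 < q := by positivity
  have hq1 : q < 1 := by linarith
  have hqq : (r' : ℝ) ≤ q * q := by nlinarith [sq_nonneg (1 - (r' : ℝ))]
  obtain ⟨ρ, hρ, hdens⟩ := hf₀.exists_densTrunc_ge hδ hδ' μ₀ hσ₀ hq0 hq1
  set ε := min (ρ / 2) (1 - q) with hε
  have hε0 : 0 < ε := lt_min (by linarith) (by linarith)
  have hερ : ε ≤ ρ / 2 := min_le_left _ _
  have hεq : ε ≤ 1 - q := min_le_right _ _
  obtain ⟨G, g, hG, hgc, hg, hG0, hG1, hclose, c, hc, hge⟩ :=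
    hf₀.exists_perturbation hf₀_loc hf₀_scale hδ hε0
  -- A derivative within `c` of `g` exceeds `(1 - ε) f₀' ≥ q f₀'`, including where `f₀'` vanishes.
  have hpos := splinePrior_pos hδ hδ' ht ht_mesh ζ hs hπ_inf hG hgc hg hG0 hG1
    (ε := min (ρ / 2) c) (lt_min (by linarith) hc)
  have hV : 0 < M {p | |p.1 - μ₀| < ρ ∧ |p.2 - σ₀| < ρ} := by
    refine (Measure.mem_support_iff_forall _).1 hM _ ?_
    have c1 : Continuous fun p : ℝ × ℝ => |p.1 - μ₀| := by fun_prop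
    have c2 : Continuous fun p : ℝ × ℝ => |p.2 - σ₀| := by fun_prop
    exact (c1.continuousAt.eventually_lt_const (by simpa using hρ)).and
      (c2.continuousAt.eventually_lt_const (by simpa using hρ))
  refine ne_of_gt (lt_of_lt_of_le (ENNReal.mul_pos hV.ne' hpos.ne') ?_)
  rw [← Measure.prod_prod]
  refine measure_mono ?_
  rintro ⟨⟨μ, σ⟩, q'⟩ ⟨⟨hμ, hσ⟩, -, hq'⟩ x
  simp only at hμ hσ hq'
  unfold densRatio
  split_ifs with hx
  · have hI := Icc_subset_Ioo_zero_one hδ hx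
    obtain ⟨h1, h2⟩ := hdens μ σ (toFun t q') (dspline (t q'.1) q'.2) hμ hσ (fun y hy => by
      have e1 := ((hq' y hy).1.trans_le (min_le_left _ _))
      have e2 := (hclose y hy).1
      have e3 := abs_add_le (toFun t q' y - G y) (G y - f₀ y)
      rw [sub_add_sub_cancel] at e3
      linarith) x hx (by
      have e1 := (abs_lt.1 ((hq' x hx).2.trans_le (min_le_right _ _))).1
      have e2 := hge x hx
      have e3 : q * deriv f₀ x ≤ (1 - ε) * deriv f₀ x :=
        mul_le_mul_of_nonneg_right (by linarith) (hf₀.deriv_nonneg hI)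
      linarith)
    change 0 < splineDens δ t ((μ, σ), q') x at h1
    change _ ≤ splineDens δ t ((μ, σ), q') x at h2
    rw [ENNReal.le_div_iff_mul_le (Or.inr (ENNReal.ofReal_pos.2 h1).ne')
      (Or.inl ENNReal.ofReal_ne_top), trueDens_eq hx, ← ENNReal.ofReal_coe_nnreal,
      ← ENNReal.ofReal_mul hr0]
    refine ENNReal.ofReal_le_ofReal (le_trans ?_ h2)
    by_cases h3 : 0 ≤ densTrunc δ μ₀ σ₀ f₀ x
    · gcongr
    · exact absurd (hf₀.densTrunc_nonneg hσ₀ hδ hδ' hI) h3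
  · exact hr.le

/-- The posterior mass of a set of parameters that is separated from the truth by the value of `F*`
at one point tends to zero. -/
lemma ae_tendsto_intLik_of_test (hf₀ : IsTransform f₀) (hσ₀ : 0 < σ₀) (hδ : 0 < δ)
    (hδ' : δ < 1 / 4) (ht : ∀ J, 4 ≤ J → IsCubicKnots J (t J)) {Q : Measure Param} [SFinite Q]
    (hreg : ∀ᵐ η ∂Q, IsRegular t η)
    (hlow : ∀ r < 1, Q {η | ∀ x, r ≤ densRatio δ (trueDens δ μ₀ σ₀ f₀) (splineDens δ t η) x} ≠ 0)
    {Ω : Type*} [MeasurableSpace Ω] {P : Measure Ω} [IsProbabilityMeasure P] {X : ℕ → Ω → ℝ}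
    (hX : ∀ i, Measurable (X i)) (hi : iIndepFun X P) {ν : Measure ℝ} [IsProbabilityMeasure ν]
    (hlaw : IsLaw μ₀ σ₀ f₀ ν) (hν : ∀ i, P.map (X i) = ν)
    (hfin : ∀ᵐ ω ∂P, ∃ m, intLik Q
      (fun η => densRatio δ (trueDens δ μ₀ σ₀ f₀) (splineDens δ t η)) univ m
        (fun i => X i ω) ≠ ∞)
    {U : Set Param} (hU : MeasurableSet U) {y : ℝ} (hy : y ∈ Icc δ (1 - δ)) {u v ψ : ℝ}
    (hψ : ψ < 1) (huv : 0 < cdfTrunc δ μ₀ σ₀ f₀ y * u + (1 - cdfTrunc δ μ₀ σ₀ f₀ y) * v)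
    (htest : ∀ η ∈ U, IsRegular t η → cdfTrunc δ η.1.1 η.1.2 (toFun t η.2) y * Real.exp u +
      (1 - cdfTrunc δ η.1.1 η.1.2 (toFun t η.2) y) * Real.exp v ≤ ψ) :
    ∀ᵐ ω ∂P, Tendsto (fun n =>
      intLik Q (fun η => densRatio δ (trueDens δ μ₀ σ₀ f₀) (splineDens δ t η)) U n
        (fun i => X i ω) /
      intLik Q (fun η => densRatio δ (trueDens δ μ₀ σ₀ f₀) (splineDens δ t η)) univ n
        (fun i => X i ω)) atTop (𝓝 0) := by
  have hI0 := hlaw.measure_Icc_pos hf₀ hσ₀ hδ hδ'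
  refine ae_tendsto_intLik_div hX hi hν (measurable_densRatio (measurable_trueDens hf₀ hδ) t) hlow
    hfin hU (measurable_stepFun δ y u v) (abs_stepFun_le δ y u v) ?_
    -- Observations outside the interval carry no information and contribute their full mass; the
    -- rest is reduced by `ψ`.
    (ρ := ν (Icc δ (1 - δ))ᶜ + ν (Icc δ (1 - δ)) * ENNReal.ofReal ψ) ?_ ?_
  · rw [hlaw.integral_stepFun hf₀ hσ₀ hδ hδ' hy]
    exact mul_pos (ENNReal.toReal_pos hI0.ne' (measure_ne_top _ _)) huv
  · rw [← prob_add_prob_compl (μ := ν) (measurableSet_Icc (a := δ) (b := 1 - δ)),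
      add_comm (ν (Icc δ (1 - δ)))]
    refine ENNReal.add_lt_add_left (measure_ne_top _ _) ?_
    calc ν (Icc δ (1 - δ)) * ENNReal.ofReal ψ < ν (Icc δ (1 - δ)) * 1 :=
          (ENNReal.mul_lt_mul_iff_right hI0.ne' (measure_ne_top _ _)).2 (ENNReal.ofReal_lt_one.2 hψ)
      _ = _ := mul_one _
  · filter_upwards [hreg] with η hη hηU
    refine (hlaw.lintegral_densRatio_le hf₀ hσ₀ hδ hδ' hη.2.2 hη.1 (hη.splineDens_eq ht hδ)
      ((measurable_splineDens δ t).comp measurable_prodMk_left) (fun x hx => trueDens_eq hx)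
      (measurable_trueDens hf₀ hδ) hy u v).trans ?_
    gcongr
    exact htest η hηU hη

/-- Deviations in the two directions are tested separately; a downward one is an upward one of `1 -
F*`, with the two values of the test exchanged. -/
lemma ae_tendsto_intLik_cdfTrunc (hf₀ : IsTransform f₀) (hσ₀ : 0 < σ₀) (hδ : 0 < δ)
    (hδ' : δ < 1 / 4) (ht : ∀ J, 4 ≤ J → IsCubicKnots J (t J)) {Q : Measure Param} [SFinite Q]
    (hreg : ∀ᵐ η ∂Q, IsRegular t η)
    (hlow : ∀ r < 1, Q {η | ∀ x, r ≤ densRatio δ (trueDens δ μ₀ σ₀ f₀) (splineDens δ t η) x} ≠ 0)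
    {Ω : Type*} [MeasurableSpace Ω] {P : Measure Ω} [IsProbabilityMeasure P] {X : ℕ → Ω → ℝ}
    (hX : ∀ i, Measurable (X i)) (hi : iIndepFun X P) {ν : Measure ℝ} [IsProbabilityMeasure ν]
    (hlaw : IsLaw μ₀ σ₀ f₀ ν) (hν : ∀ i, P.map (X i) = ν)
    (hfin : ∀ᵐ ω ∂P, ∃ m, intLik Q
      (fun η => densRatio δ (trueDens δ μ₀ σ₀ f₀) (splineDens δ t η)) univ m
        (fun i => X i ω) ≠ ∞)
    {y : ℝ} (hy : y ∈ Icc δ (1 - δ)) {κ : ℝ} (hκ : 0 < κ) (hκ1 : κ ≤ 1) :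
    ∀ᵐ ω ∂P, Tendsto (fun n =>
      intLik Q (fun η => densRatio δ (trueDens δ μ₀ σ₀ f₀) (splineDens δ t η))
        {η | κ ≤ |cdfTrunc δ η.1.1 η.1.2 (toFun t η.2) y - cdfTrunc δ μ₀ σ₀ f₀ y|} n
        (fun i => X i ω) /
      intLik Q (fun η => densRatio δ (trueDens δ μ₀ σ₀ f₀) (splineDens δ t η)) univ n
        (fun i => X i ω)) atTop (𝓝 0) := by
  have hF₀ := hf₀.cdfTrunc_mem (μ := μ₀) hσ₀ hδ hδ' hy
  set a := cdfTrunc δ μ₀ σ₀ f₀ y with ha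
  have hm := measurable_cdfTrunc δ t y
  obtain ⟨u, v, ψ, hψ, huv, htest⟩ := exists_exp_test hF₀ hκ hκ1
  obtain ⟨u', v', ψ', hψ', huv', htest'⟩ := exists_exp_test (a := 1 - a)
    ⟨by linarith [hF₀.2], by linarith [hF₀.1]⟩ hκ hκ1
  have h1 := ae_tendsto_intLik_of_test hf₀ hσ₀ hδ hδ' ht hreg hlow hX hi hlaw hν hfin
    (U := {η | a + κ ≤ cdfTrunc δ η.1.1 η.1.2 (toFun t η.2) y})
    (measurableSet_le measurable_const hm) hy hψ huv fun η hη hr =>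
      htest _ (hr.2.2.cdfTrunc_mem hr.1 hδ hδ' hy) hη
  have h2 := ae_tendsto_intLik_of_test hf₀ hσ₀ hδ hδ' ht hreg hlow hX hi hlaw hν hfin
    (U := {η | cdfTrunc δ η.1.1 η.1.2 (toFun t η.2) y ≤ a - κ})
    (measurableSet_le hm measurable_const) hy (u := v') (v := u') hψ'
    (by rw [← ha]; linarith) fun η hη hr => by
      have h3 := hr.2.2.cdfTrunc_mem (μ := η.1.1) hr.1 hδ hδ' hy
      have h4 := htest' (1 - cdfTrunc δ η.1.1 η.1.2 (toFun t η.2) y)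
        ⟨by linarith [h3.2], by linarith [h3.1]⟩ (by
          have : cdfTrunc δ η.1.1 η.1.2 (toFun t η.2) y ≤ a - κ := hη
          linarith)
      linarith
  filter_upwards [h1, h2] with ω h1 h2
  have h3 := h1.add h2
  rw [add_zero] at h3
  refine tendsto_of_tendsto_of_tendsto_of_le_of_le tendsto_const_nhds h3 (fun _ => zero_le)
    fun n => ?_
  simp only
  rw [← ENNReal.add_div]
  refine ENNReal.div_le_div_right ((lintegral_mono_set ?_).trans (lintegral_union_le _ _ _)) _
  intro η hη
  rcases le_abs.1 (show κ ≤ |_| from hη) with h | h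
  · left
    simp only [mem_ofPred_eq]
    linarith
  · right
    simp only [mem_ofPred_eq]
    linarith

/-- Consistency of the modified posterior. -/
theorem ae_tendsto_modifiedPosteriorProb (hf₀ : IsTransform f₀) (hf₀_loc : f₀ (1 / 2) = 0)
    (hf₀_scale : f₀ (3 / 4) - f₀ (1 / 4) = 1) (hσ₀ : 0 < σ₀) (hδ : 0 < δ)
    (hδ' : δ < 1 / 4) (ht : ∀ J, 4 ≤ J → IsCubicKnots J (t J)) {Q : Measure Param} [SFinite Q]
    (hreg : ∀ᵐ η ∂Q, IsRegular t η)
    (hlow : ∀ r < 1, Q {η | ∀ x, r ≤ densRatio δ (trueDens δ μ₀ σ₀ f₀) (splineDens δ t η) x} ≠ 0)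
    {ρ : Measure (ℝ × ℝ)} [IsProbabilityMeasure ρ]
    {Ω : Type*} [MeasurableSpace Ω] {P : Measure Ω} [IsProbabilityMeasure P] {X : ℕ → Ω → ℝ}
    (hX : ∀ i, Measurable (X i)) (hi : iIndepFun X P) {ν : Measure ℝ} [IsProbabilityMeasure ν]
    (hlaw : IsLaw μ₀ σ₀ f₀ ν) (hν : ∀ i, P.map (X i) = ν)
    (hfin : ∀ᵐ ω ∂P, ∃ n, evidence δ t Q n (fun i => X i ω) ≠ ∞)
    (hcount : ∀ ε : ℝ, 0 < ε → ∀ᵐ ω ∂P, Tendsto (fun n => countPosterior δ ρ n (fun i => X i ω)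
      {p | |p.1 - cdfX μ₀ σ₀ f₀ δ| < ε ∧ |p.2 - (1 - cdfX μ₀ σ₀ f₀ (1 - δ))| < ε}) atTop (𝓝 1))
    {ε : ℝ} (hε : 0 < ε) :
    ∀ᵐ ω ∂P, Tendsto (fun n => modifiedPosteriorProb δ t Q ρ μ₀ σ₀ f₀ ε n (fun i => X i ω))
      atTop (𝓝 1) := by
  set p₀ := trueDens δ μ₀ σ₀ f₀ with hp₀
  set ℓ : Param → ℝ → ℝ≥0∞ := fun η => densRatio δ p₀ (splineDens δ t η) with hℓ
  have hp₀m : Measurable p₀ := measurable_trueDens hf₀ hδ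
  have hdens : ∀ᵐ η ∂Q, ∀ x ∈ Icc δ (1 - δ),
      splineDens δ t η x = densTrunc δ η.1.1 η.1.2 (toFun t η.2) x := by
    filter_upwards [hreg] with η hη using hη.splineDens_eq ht hδ
  have hpos : ∀ᵐ ω ∂P, ∀ i, X i ω ∈ Icc δ (1 - δ) → 0 < p₀ (X i ω) := by
    refine ae_all_iff.2 fun i => ?_
    have := hlaw.ae_trueDens_pos hf₀ hσ₀ hδ hδ'
    rw [← hν i] at this
    exact ae_of_ae_map (hX i).aemeasurable this
  have hfin' : ∀ᵐ ω ∂P, ∃ m, intLik Q ℓ univ m (fun i => X i ω) ≠ ∞ := by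
    filter_upwards [hfin, hpos] with ω ⟨n, hn⟩ hω
    refine ⟨n, fun h => hn ?_⟩
    rw [evidence_eq hdens hp₀m hω]
    change trueLik δ p₀ n _ * intLik Q ℓ univ n _ = ∞
    rw [h, ENNReal.mul_top (trueLik_ne_zero hω)]
  have hone : ∀ᵐ η ∂Q, ∫⁻ x, ℓ η x ∂ν ≤ 1 := by
    filter_upwards [hreg] with η hη
    have h := hlaw.lintegral_densRatio_le hf₀ hσ₀ hδ hδ' hη.2.2 hη.1 (hη.splineDens_eq ht hδ)
      ((measurable_splineDens δ t).comp measurable_prodMk_left) (fun x hx => trueDens_eq hx)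
      (measurable_trueDens hf₀ hδ) (y := δ) ⟨le_rfl, by linarith⟩ 0 0
    have h0 : ∀ x, stepFun δ δ 0 0 x = 0 := fun x => by simp [stepFun]
    simp only [h0, Real.exp_zero, ENNReal.ofReal_one, mul_one, add_sub_cancel] at h
    rwa [add_comm, prob_add_prob_compl measurableSet_Icc] at h
  have htop := ae_intLik_ne_top hX hi hν (measurable_densRatio hp₀m t) hone hfin'
  have hne : ∀ x n, intLik Q ℓ univ n x ≠ 0 := by
    intro x n h0
    have h1 := le_intLik (Q := Q) (ℓ := ℓ) (measurable_densRatio hp₀m t) (2⁻¹) n x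
    have h2 := hlow 2⁻¹ (by simp)
    rw [show intLik Q (fun η => densRatio δ p₀ (splineDens δ t η)) univ n x = 0 from h0,
      nonpos_iff_eq_zero, mul_eq_zero] at h1
    exact h1.elim (pow_ne_zero n (by simp)) h2
  obtain ⟨κ₀, hκ₀, hclose⟩ :=
    exists_transOf_close hf₀.mono hf₀_loc hf₀_scale hδ hδ' μ₀ hσ₀ hε
  -- The quarter pays for the factor 4 in `abs_cdfMod_sub_lt`; the grid is used with `κ / 2` because
  -- `exists_grid` doubles the error.
  set κ := min (κ₀ / 4) 1 with hκ
  have hκpos : 0 < κ := by positivity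
  have hκle : 4 * κ ≤ κ₀ := by linarith [min_le_left (κ₀ / 4) 1]
  obtain ⟨S, hSI, hS⟩ := exists_grid
    ((hf₀.continuousOn_cdfTrunc (δ := δ) (μ := μ₀) (σ := σ₀)).mono (Icc_subset_Ioo_zero_one hδ))
    (half_pos hκpos)
  let V : ℝ → Set Param := fun y =>
    {η | κ / 2 ≤ |cdfTrunc δ η.1.1 η.1.2 (toFun t η.2) y - cdfTrunc δ μ₀ σ₀ f₀ y|}
  have hV : ∀ᵐ ω ∂P, ∀ y ∈ S, Tendsto (fun n => intLik Q ℓ (V y) n (fun i => X i ω) /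
      intLik Q ℓ univ n (fun i => X i ω)) atTop (𝓝 0) := by
    rw [Finset.eventually_all]
    exact fun y hy => ae_tendsto_intLik_cdfTrunc hf₀ hσ₀ hδ hδ' ht hreg hlow hX hi hlaw hν hfin'
      (hSI y hy) (half_pos hκpos) (by linarith [min_le_right (κ₀ / 4) 1])
  filter_upwards [hpos, htop, hV, hcount κ hκpos] with ω hω htopω hVω hcω
  set x : ℕ → ℝ := fun i => X i ω with hx
  let N : Set Param := {η | ¬ IsRegular t η}
  let A : Set Param := {η | IsRegular t η ∧ ∀ y ∈ S, η ∉ V y}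
  let B : Set (ℝ × ℝ) :=
    {p | |p.1 - cdfX μ₀ σ₀ f₀ δ| < κ ∧ |p.2 - (1 - cdfX μ₀ σ₀ f₀ (1 - δ))| < κ}
  have hpost : ∀ n U, truncPosterior δ t Q n x U = intLik Q ℓ U n x / intLik Q ℓ univ n x :=
    fun n U => truncPosterior_apply hdens hp₀m hω U
  have hAlow : ∀ᶠ n in atTop, 1 - ∑ y ∈ S, intLik Q ℓ (V y) n x / intLik Q ℓ univ n x ≤
      truncPosterior δ t Q n x A := by
    filter_upwards [htopω] with n hn
    have h1 : truncPosterior δ t Q n x univ = 1 := by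
      rw [hpost, ENNReal.div_self (hne _ _) hn]
    have hN : truncPosterior δ t Q n x N = 0 := by
      rw [hpost, intLik, setLIntegral_measure_zero _ _ (ae_iff.1 hreg), ENNReal.zero_div]
    rw [tsub_le_iff_right, ← h1]
    -- A parameter is good, irregular (a null set) or wrong at some grid point.
    calc truncPosterior δ t Q n x univ
        ≤ truncPosterior δ t Q n x ((A ∪ N) ∪ ⋃ y ∈ S, V y) := by
          refine measure_mono fun η _ => ?_
          by_cases hη : IsRegular t η
          · by_cases h2 : ∀ y ∈ S, η ∉ V y
            · exact Or.inl (Or.inl ⟨hη, h2⟩)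
            · push Not at h2
              obtain ⟨y, hy, h3⟩ := h2
              exact Or.inr (mem_biUnion hy h3)
          · exact Or.inl (Or.inr hη)
      _ ≤ (truncPosterior δ t Q n x A + truncPosterior δ t Q n x N) +
          ∑ y ∈ S, truncPosterior δ t Q n x (V y) :=
          (measure_union_le _ _).trans (add_le_add (measure_union_le _ _)
            (measure_biUnion_finset_le _ _))
      _ = _ := by
          rw [hN, add_zero]
          simp only [hpost]
  have hsum : Tendsto (fun n => ∑ y ∈ S, intLik Q ℓ (V y) n x / intLik Q ℓ univ n x) atTop
      (𝓝 0) := by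
    have := tendsto_finsetSum S fun y hy => hVω y hy
    simpa using this
  have hlow1 : Tendsto (fun n => (1 - ∑ y ∈ S, intLik Q ℓ (V y) n x / intLik Q ℓ univ n x) *
      countPosterior δ ρ n x B) atTop (𝓝 1) := by
    have h1 := ENNReal.Tendsto.sub (tendsto_const_nhds (x := (1 : ℝ≥0∞))) hsum
      (Or.inl ENNReal.one_ne_top)
    rw [tsub_zero] at h1
    have h2 := ENNReal.Tendsto.mul h1 (Or.inl one_ne_zero) hcω (Or.inl one_ne_zero)
    rwa [mul_one] at h2
  -- The event contains the rectangle `A ×ˢ B`, whose mass is the product of the two posterior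
  -- masses, and the total mass is at most one.
  refine tendsto_of_tendsto_of_tendsto_of_le_of_le' hlow1 tendsto_const_nhds ?_ ?_
  · filter_upwards [hAlow] with n hn
    calc _ ≤ truncPosterior δ t Q n x A * countPosterior δ ρ n x B := mul_le_mul_left hn _
      _ = ((truncPosterior δ t Q n x).prod (countPosterior δ ρ n x)) (A ×ˢ B) :=
          (Measure.prod_prod _ _).symm
      _ ≤ _ := by
          refine measure_mono ?_
          rintro z ⟨⟨hz1, hz2⟩, hz3, hz4⟩
          refine hclose _ fun y hy => lt_of_lt_of_le ?_ hκle
          refine abs_cdfMod_sub_lt hf₀ hσ₀ hδ hδ' hz3 hz4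
            (hz1.2.2.cdfTrunc_mem hz1.1 hδ hδ' hy) ?_
          have h5 := hS _ (hz1.2.2.monotoneOn_cdfTrunc hz1.1 hδ hδ')
            (fun y hy => not_le.1 (hz2 y hy)) y hy
          rwa [mul_div_cancel₀ _ two_ne_zero] at h5
  · refine Eventually.of_forall fun n => ?_
    calc modifiedPosteriorProb δ t Q ρ μ₀ σ₀ f₀ ε n x
        ≤ ((truncPosterior δ t Q n x).prod (countPosterior δ ρ n x)) (univ ×ˢ univ) :=
          measure_mono fun z _ => ⟨mem_univ _, mem_univ _⟩
      _ = truncPosterior δ t Q n x univ * countPosterior δ ρ n x univ := Measure.prod_prod _ _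
      _ ≤ 1 * 1 := mul_le_mul' (truncPosterior_univ_le n x) (countPosterior_univ_le ρ n x)
      _ = 1 := mul_one 1

end Consistency

end Nonparanormal

end

/-! ### Proof of the two claims -/

theorem mainTheorem2
    -- the true transformation
    (f₀ : ℝ → ℝ) (hf₀ : ContDiffOn ℝ 1 f₀ (Ioo 0 1)) (hf₀_mono : StrictMonoOn f₀ (Ioo 0 1))
    (hf₀_loc : f₀ (1 / 2) = 0) (hf₀_scale : f₀ (3 / 4) - f₀ (1 / 4) = 1)
    (δ : ℝ) (hδ : 0 < δ) (hδ' : δ < 1 / 4)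
    -- the knots, and the prior on the transformation
    (t : ℕ → ℕ → ℝ) (ht : ∀ J, 4 ≤ J → Nonparanormal.IsCubicKnots J (t J))
    (ht_mesh : ∀ h : ℝ, 0 < h → ∃ N : ℕ, ∀ J, N ≤ J → ∀ i, 3 ≤ i → i < J →
      t J (i + 1) - t J i < h)
    (ζ : ∀ J : ℕ, Fin J → ℝ) (s : ℝ) (hs : 0 < s)
    (π : PMF ℕ) (hπ : ∀ J ∈ π.support, 4 ≤ J) (hπ_inf : π.support.Infinite) :
    -- the prior charges all neighbourhoods of the truth
    (∀ ε : ℝ, 0 < ε → 0 < Nonparanormal.splinePrior t ζ s π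
      {q | Nonparanormal.supDist δ (Nonparanormal.toFun t q) f₀ < ENNReal.ofReal ε ∧
        Nonparanormal.supDist δ (deriv (Nonparanormal.toFun t q)) (deriv f₀)
          < ENNReal.ofReal ε}) ∧
    -- posterior consistency
    (∀ (μ₀ σ₀ : ℝ), 0 < σ₀ →
      -- a prior `M` on `(μ, σ)`, possibly improper, with `(μ₀, σ₀)` in its support, and a prior
      -- `ρ` on the probabilities `(π⁻, π⁺)`
      ∀ (M : Measure (ℝ × ℝ)) [SigmaFinite M], (∀ᵐ p ∂M, 0 < p.2) → (μ₀, σ₀) ∈ M.support →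
      ∀ (ρ : Measure (ℝ × ℝ)) [IsProbabilityMeasure ρ],
      (∀ᵐ p ∂ρ, 0 ≤ p.1 ∧ 0 ≤ p.2 ∧ p.1 + p.2 ≤ 1) →
      -- independent observations with `f₀ (X i) ∼ N(μ₀, σ₀²)`
      ∀ {Ω : Type*} [MeasurableSpace Ω] (P : Measure Ω) [IsProbabilityMeasure P]
        (X : ℕ → Ω → ℝ), (∀ i, Measurable (X i)) → (∀ i, ∀ᵐ ω ∂P, X i ω ∈ Ioo 0 1) →
      iIndepFun X P →
      (∀ i, P.map (fun ω => f₀ (X i ω)) = gaussianReal μ₀ (Real.toNNReal (σ₀ ^ 2))) →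
      -- `M` is a proper prior, or else it leads almost surely to a proper posterior
      (IsProbabilityMeasure M ∨ ∀ᵐ ω ∂P, ∃ n, Nonparanormal.evidence δ t
        (M.prod (Nonparanormal.splinePrior t ζ s π)) n (fun i => X i ω) ≠ ∞) →
      -- the posterior of `(π⁻, π⁺)` is consistent
      (∀ ε : ℝ, 0 < ε → ∀ᵐ ω ∂P, Tendsto (fun n =>
        Nonparanormal.countPosterior δ ρ n (fun i => X i ω)
          {p | |p.1 - Nonparanormal.cdfX μ₀ σ₀ f₀ δ| < ε ∧
            |p.2 - (1 - Nonparanormal.cdfX μ₀ σ₀ f₀ (1 - δ))| < ε}) atTop (𝓝 1)) →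
      ∀ ε : ℝ, 0 < ε → ∀ᵐ ω ∂P, Tendsto (fun n =>
        Nonparanormal.modifiedPosteriorProb δ t (M.prod (Nonparanormal.splinePrior t ζ s π)) ρ
          μ₀ σ₀ f₀ ε n (fun i => X i ω)) atTop (𝓝 1)) := by
  have hf₀' : Nonparanormal.IsTransform f₀ :=
    ⟨fun x hx => (hf₀.differentiableOn one_ne_zero).differentiableAt (isOpen_Ioo.mem_nhds hx),
      hf₀.continuousOn_deriv_of_isOpen isOpen_Ioo le_rfl, hf₀_mono⟩
  refine ⟨fun ε hε => ?_, ?_⟩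
  -- Two errors of `ε / 4` bound the suprema by `ε / 2`, which keeps the inequality strict.
  · obtain ⟨G, g, hG, hgc, hg, hG0, hG1, hclose, -⟩ :=
      hf₀'.exists_perturbation hf₀_loc hf₀_scale hδ (by linarith : 0 < ε / 4)
    refine (Nonparanormal.splinePrior_pos hδ hδ' ht ht_mesh ζ hs hπ_inf hG hgc hg hG0 hG1
      (by linarith : 0 < ε / 4)).trans_le (measure_mono ?_)
    rintro q ⟨hq4, hq⟩
    have hlt : ENNReal.ofReal (ε / 2) < ENNReal.ofReal ε :=
      (ENNReal.ofReal_lt_ofReal_iff hε).2 (by linarith)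
    refine ⟨(iSup₂_le fun x hx => ENNReal.ofReal_le_ofReal ?_).trans_lt hlt,
      (iSup₂_le fun x hx => ENNReal.ofReal_le_ofReal ?_).trans_lt hlt⟩
    · have h1 := (hq x hx).1
      have h2 := (hclose x hx).1
      linarith [abs_sub_le (Nonparanormal.toFun t q x) (G x) (f₀ x)]
    · have h1 := (hq x hx).2
      have h2 := (hclose x hx).2
      have h3 : deriv (Nonparanormal.toFun t q) x = Nonparanormal.dspline (t q.1) q.2 x :=
        ((ht _ hq4).hasDerivAt_spline q.2
          (Nonparanormal.Icc_subset_Ioo_zero_one hδ hx)).deriv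
      rw [h3]
      linarith [abs_sub_le (Nonparanormal.dspline (t q.1) q.2 x) (g x) (deriv f₀ x)]
  · intro μ₀ σ₀ hσ₀ M _ hM hMsupp ρ _ _ Ω _ P _ X hX hX01 hi hlaw hproper hcount ε hε
    have hν : ∀ i, Nonparanormal.IsLaw μ₀ σ₀ f₀ (P.map (X i)) := fun i =>
      Nonparanormal.isLaw_map (hX i) (hX01 i) hf₀_mono hσ₀ (hlaw i)
    have hprob : ∀ i, IsProbabilityMeasure (P.map (X i)) := fun i =>
      Measure.isProbabilityMeasure_map (hX i).aemeasurable
    have hfin : ∀ᵐ ω ∂P, ∃ n, Nonparanormal.evidence δ t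
        (M.prod (Nonparanormal.splinePrior t ζ s π)) n (fun i => X i ω) ≠ ∞ := by
      rcases hproper with hproper | hproper
      -- Without observations the likelihood is an empty product, so the evidence is the total mass
      -- of a finite prior.
      · refine Eventually.of_forall fun ω => ⟨0, ?_⟩
        simp [Nonparanormal.evidence, Nonparanormal.likelihood]
      · exact hproper
    exact Nonparanormal.ae_tendsto_modifiedPosteriorProb hf₀' hf₀_loc hf₀_scale hσ₀ hδ hδ' ht
      (Nonparanormal.ae_isRegular ht hπ hM)
      (fun r hr => Nonparanormal.prior_densRatio_ge_ne_zero hf₀' hf₀_loc hf₀_scale hδ hδ' ht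
        ht_mesh hs hπ_inf hσ₀ hMsupp hr)
      hX hi (hν 0) (fun i => (hν i).eq (hν 0)) hfin hcount hε
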